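/- All posets are finite. A poset is \((3+1)\)-free if it contains no chain \(a<b<c\) together with an element \(d\) incomparable to each of \(a,b,c\). For a vertex \(a\) of a \((3+1)\)-free poset \(P\) let \(D_a=\{x: x<a\}\) and \(U_a=\{x: x>a\}\). A top of a tangle is a connected component with at least two vertices of the graph on \(P\) joining \(a,b\) whenever \(D_a,D_b\) are incomparable under inclusion; a bottom of a tangle is defined in the same way with \(U_a,U_b\). A tangle is a pair \((A,B)\) of a top \(A\) and a bottom \(B\) of a tangle such that some induced \((2+2)\) subposet has its two top vertices in \(A\) and its two bottom vertices in \(B\). A clone set is a class of the relation "\(D_a=D_b\) and \(U_a=U_b\)" on the vertices that lie in no tangle. The clone sets and tangles are the parts of \(P\). Let \(\ell(a)\) be the level of \(a\) (minimal vertices have level \(1\), minimal vertices of what remains have level \(2\), and so on). A listing \((X_1,\dots,X_k)\) of all the parts is compatible if for \(a\in X_i\), \(b\in X_j\), \(i\ne j\), one has \(a<b\) exactly when \(\ell(a)\le \ell(b)-2\), or \(\ell(a)=\ell(b)-1\) and \(i<j\). Replacing in a compatible listing each clone set on level \(i\) by the letter \(c_i\) and each tangle on levels \(i,i+1\) by the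 letter \(t_{i\,i+1}\) gives a word; its class in the monoid generated by these letters subject to \(c_ic_j=c_jc_i\) for \(|i-j|\ge 2\), \(c_it_{j\,j+1}=t_{j\,j+1}c_i\) for \(i\le j-2\) or \(i\ge j+3\), and \(t_{i\,i+1}t_{j\,j+1}=t_{j\,j+1}t_{i\,i+1}\) for \(|i-j|\ge 3\), is the skeleton of \(P\). Let \(S(c,t)=\sum_{r,s\ge 0} S_{r,s}\,c^r t^s\in\mathbb{Q}[[c,t]]\), where \(S_{r,s}\) is the number of distinct skeleta of \((3+1)\)-free posets with \(r\) clone sets and \(s\) tangles. Let \(p_{\mathrm{lbl}}(n)\) be the number of \((3+1)\)-free posets on \(\{1,\dots,n\}\). Let \(T_{\mathrm{lbl}}(x,y)=\sum_{i,j\ge 0}\tau_{i,j}\frac{x^iy^j}{i!\,j!}\), where \(\tau_{i,j}\) is the number of labelled tangles with \(i\) labelled bottom vertices and \(j\) labelled top vertices, i.e. of \((3+1)\)-free posets on these \(i+j\) vertices consisting of the single tangle with that bottom and that top. Let \[B_{\mathrm{lbl}}(x)=\sum_{n\ge 0}\sum_{i=0}^n\binom{n}{i}2^{i(n-i)}\frac{x^n}{n!}.\]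 **Corollary.** The series \(S(c,t)\) is the unique formal power series with \[S(c,t)=1+\frac{c}{1+c}\,S(c,t)^2+t\,S(c,t)^3 .\] The series \(e^x-1\), \(T_{\mathrm{lbl}}(x,x)\) and \(2e^{-x}-1-B_{\mathrm{lbl}}(x)^{-1}\) have zero constant term, and \[\sum_{n\ge 0}p_{\mathrm{lbl}}(n)\frac{x^n}{n!}=S\bigl(e^x-1,\;T_{\mathrm{lbl}}(x,x)\bigr)=S\bigl(e^x-1,\;2e^{-x}-1-B_{\mathrm{lbl}}(x)^{-1}\bigr).\] -/

import Mathlib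

noncomputable section

namespace ThreePlusOne

/-! ### `(3+1)`-free posets and the tangle decomposition -/

section Poset

variable {P : Type} [PartialOrder P]

/-- Incomparable elements of a poset; in particular they are distinct. -/
def Incomp (a b : P) : Prop := ¬ a ≤ b ∧ ¬ b ≤ a

variable (P) in
/-- A poset is `(3+1)`-free if it has no chain `a < b < c` together with an element `d` that is
incomparable to `a`, `b` and `c`. -/
def IsFree : Prop :=
  ¬ ∃ a b c d : P, a < b ∧ b < c ∧ Incomp d a ∧ Incomp d b ∧ Incomp d c

/-- `a` and `b` are clones: they have the same strict downset and the same strict upset. -/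
def Clones (a b : P) : Prop := Set.Iio a = Set.Iio b ∧ Set.Ioi a = Set.Ioi b

variable (P) in
/-- The graph on `P` whose edges join vertices with incomparable strict downsets. -/
def topGraph : SimpleGraph P where
  Adj a b := ¬ Set.Iio a ⊆ Set.Iio b ∧ ¬ Set.Iio b ⊆ Set.Iio a
  symm := ⟨fun _ _ h => ⟨h.2, h.1⟩⟩
  loopless := ⟨fun _ h => h.1 subset_rfl⟩

variable (P) in
/-- The graph on `P` whose edges join vertices with incomparable strict upsets. -/
def botGraph : SimpleGraph P where
  Adj a b := ¬ Set.Ioi a ⊆ Set.Ioi b ∧ ¬ Set.Ioi b ⊆ Set.Ioi a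
  symm := ⟨fun _ _ h => ⟨h.2, h.1⟩⟩
  loopless := ⟨fun _ h => h.1 subset_rfl⟩

/-- `A` is the top of a tangle. -/
def IsTangleTop (A : Set P) : Prop :=
  A.Nontrivial ∧ ∃ C : (topGraph P).ConnectedComponent, C.supp = A

/-- `B` is the bottom of a tangle. -/
def IsTangleBot (B : Set P) : Prop :=
  B.Nontrivial ∧ ∃ C : (botGraph P).ConnectedComponent, C.supp = B

/-- There is an induced `(2+2)` subposet whose two top vertices are in `A` and whose two bottom
vertices are in `B`. -/
def Matched (A B : Set P) : Prop :=
  ∃ a₁ ∈ A, ∃ a₂ ∈ A, ∃ b₁ ∈ B, ∃ b₂ ∈ B, b₁ < a₁ ∧ b₂ < a₂ ∧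
    Incomp a₁ a₂ ∧ Incomp b₁ b₂ ∧ Incomp a₁ b₂ ∧ Incomp a₂ b₁

/-- `(A, B)` is a tangle with top `A` and bottom `B`. -/
def IsTangle (A B : Set P) : Prop :=
  IsTangleTop A ∧ IsTangleBot B ∧ Matched A B

variable (P) in
/-- The vertices that belong to some tangle. -/
def tangled : Set P := {a | ∃ A B : Set P, IsTangle A B ∧ a ∈ A ∪ B}

/-- `C` is a clone set: a class of clones among the vertices that are in no tangle. -/
def IsCloneSet (C : Set P) : Prop :=
  ∃ a ∉ tangled P, C = {b | b ∉ tangled P ∧ Clones a b}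

variable (P) in
/-- Candidates for parts: a set, or a pair consisting of a top and a bottom. -/
inductive Part : Type
  | clone (C : Set P) : Part
  | tangle (A B : Set P) : Part

namespace Part

/-- The vertices of a part. -/
def verts : Part P → Set P
  | clone C => C
  | tangle A B => A ∪ B

/-- Being a part of the tangle decomposition of `P`. -/
def IsPart : Part P → Prop
  | clone C => IsCloneSet C
  | tangle A B => IsTangle A B

end Part

/-! ### Levels, compatible listings and skeleta -/

variable (P) in
/-- The union of the lowest `k` levels of `P`: each level consists of the minimal elements of what
remains after the lower levels have been removed. -/
def lowLevels : ℕ → Set P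
  | 0 => ∅
  | k + 1 => lowLevels k ∪ {a | Minimal (fun x => x ∉ lowLevels k) a}

/-- The level of a vertex of a finite poset, numbered so that minimal vertices have level `1`. -/
def level (a : P) : ℕ := sInf {k | a ∈ lowLevels P k}

/-- A compatible listing of the parts of `P`: each part occurs exactly once, and the order between
vertices of different parts is given by their levels and the order of the parts in the list. -/
def IsCompatibleListing (L : List (Part P)) : Prop :=
  L.Nodup ∧ (∀ X, X ∈ L ↔ X.IsPart) ∧
  ∀ i j : Fin L.length, i ≠ j → ∀ a ∈ (L.get i).verts, ∀ b ∈ (L.get j).verts,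
    (a < b ↔ level a + 2 ≤ level b ∨ (level a + 1 = level b ∧ i < j))

end Poset

/-- The alphabet: `c i` stands for $c_{i+1}$ and `t i` stands for $t_{i+1\,i+2}$, so that the
letters are exactly $c_1, c_2, \dots$ and $t_{12}, t_{23}, \dots$. -/
inductive Letter : Type
  | c (i : ℕ) : Letter
  | t (i : ℕ) : Letter

namespace Letter

/-- Is the letter one of the $c_i$? -/
def isC : Letter → Bool
  | c _ => true
  | t _ => false

/-- Is the letter one of the $t_{i\,i+1}$? -/
def isT : Letter → Bool
  | c _ => false
  | t _ => true

end Letter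

/-- The commutation relations. -/
inductive CommRel : FreeMonoid Letter → FreeMonoid Letter → Prop
  | cc (i j : ℕ) (h : i + 2 ≤ j ∨ j + 2 ≤ i) :
      CommRel (.of (.c i) * .of (.c j)) (.of (.c j) * .of (.c i))
  | ct (i j : ℕ) (h : i + 2 ≤ j ∨ j + 3 ≤ i) :
      CommRel (.of (.c i) * .of (.t j)) (.of (.t j) * .of (.c i))
  | tt (i j : ℕ) (h : i + 3 ≤ j ∨ j + 3 ≤ i) :
      CommRel (.of (.t i) * .of (.t j)) (.of (.t j) * .of (.t i))

/-- The free partially commuting monoid that contains the skeleta. -/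
abbrev TraceMonoid : Type := PresentedMonoid CommRel

/-- The letter of a part: $c_k$ for a clone set on level `k`, and $t_{k\,k+1}$ for a tangle whose
bottom is on level `k` and whose top is on level `k + 1`. -/
def HasLetter {P : Type} [PartialOrder P] : Part P → Letter → Prop
  | .clone C, .c i => ∀ a ∈ C, level a = i + 1
  | .tangle A B, .t i => (∀ b ∈ B, level b = i + 1) ∧ ∀ a ∈ A, level a = i + 2
  | _, _ => False

/-- The word `w` is obtained from some compatible listing of the parts of `P`. -/
def IsWordOf (P : Type) [PartialOrder P] (w : List Letter) : Prop :=
  ∃ L : List (Part P), IsCompatibleListing L ∧ List.Forall₂ HasLetter L w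

/-- The skeleta of finite `(3+1)`-free posets that have `r` clone sets and `s` tangles. -/
def skeleta (r s : ℕ) : Set TraceMonoid :=
  {m | ∃ (P : Type) (_ : PartialOrder P) (w : List Letter),
    Finite P ∧ IsFree P ∧ IsWordOf P w ∧
    w.countP Letter.isC = r ∧ w.countP Letter.isT = s ∧
    PresentedMonoid.mk CommRel (FreeMonoid.ofList w) = m}

/-! ### Generating functions -/

open Nat (factorial)

/-- The generating function $S(c,t)$ of skeleta; variable `0` is $c$ and variable `1` is $t$. -/
def skeletonGF : MvPowerSeries (Fin 2) ℚ := fun d => ((skeleta (d 0) (d 1)).ncard : ℚ)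

/-- The cubic equation $S = 1 + \frac{c}{1+c} S^2 + t S^3$. -/
def SatisfiesCubic (S : MvPowerSeries (Fin 2) ℚ) : Prop :=
  S = 1 + MvPowerSeries.X 0 * (1 + MvPowerSeries.X 0)⁻¹ * S ^ 2 + MvPowerSeries.X 1 * S ^ 3

/-- The number of `(3+1)`-free posets with `n` labelled vertices. -/
def numPosets (n : ℕ) : ℕ :=
  Nat.card {p : PartialOrder (Fin n) // @IsFree (Fin n) p}

/-- The exponential generating function for labelled `(3+1)`-free posets. -/
def posetEGF : PowerSeries ℚ :=
  PowerSeries.mk fun n => (numPosets n : ℚ) / (factorial n : ℚ)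

/-- The number of labelled tangles with `i` labelled bottom vertices and `j` labelled top vertices,
that is, of `(3+1)`-free posets on these vertices which consist of this single tangle. -/
def numTangles (i j : ℕ) : ℕ :=
  Nat.card {p : PartialOrder (Fin i ⊕ Fin j) //
    @IsFree _ p ∧ @IsTangle _ p (Set.range Sum.inr) (Set.range Sum.inl)}

/-- The exponential generating function $T_{lbl}(x,y)$ for labelled tangles, where $x$ (variable
`0`) marks bottom vertices and $y$ (variable `1`) marks top vertices. -/
def tangleEGF : MvPowerSeries (Fin 2) ℚ :=
  fun d => (numTangles (d 0) (d 1) : ℚ) / ((factorial (d 0) : ℚ) * (factorial (d 1) : ℚ))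

/-- $F(f, g)$ for a power series $F$ in two variables and power series $f$, $g$ in one variable
(meaningful when $f$ and $g$ have no constant term). -/
def subst₂ (F : MvPowerSeries (Fin 2) ℚ) (f g : PowerSeries ℚ) : PowerSeries ℚ :=
  MvPowerSeries.subst (![f, g] : Fin 2 → MvPowerSeries Unit ℚ) F

/-- The series $T_{lbl}(x,x)$. -/
def tangleDiag : PowerSeries ℚ := subst₂ tangleEGF PowerSeries.X PowerSeries.X

/-- $B_{lbl}(x)$, the exponential generating function for labelled bicoloured graphs. -/
def bicolouredEGF : PowerSeries ℚ :=
  PowerSeries.mk fun n =>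
    (∑ i ∈ Finset.range (n + 1), (n.choose i : ℚ) * 2 ^ (i * (n - i))) / (factorial n : ℚ)

/-- The series $2e^{-x} - 1 - B_{lbl}(x)^{-1}$. -/
def tangleSeries : PowerSeries ℚ :=
  2 * PowerSeries.evalNegHom (PowerSeries.exp ℚ) - 1 - bicolouredEGF⁻¹

end ThreePlusOne

end

/-! Levels are numbered from $0$ below, so a letter $c_i$ occupies level $i$ and a letter $t_i$
occupies levels $i,i+1$. In a $(3+1)$-free poset a vertex lies below everything at least two levels
higher, so only the relations between adjacent levels carry information. Such a `Layered` structure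
is described by a list of parts, each a set on one level or a tangle on two. Between different
parts, a vertex lies below a vertex one level up exactly when its part comes earlier in the list.

Existence of a list: `exists_first_piece` finds a part that can stand first. It rests on
`CutConn.transfer`, which deduces connectivity of the top of a tangle from that of its bottom. The
list is then sorted until its word is canonical: if two consecutive letters commute, the higher one
comes first, and no $c_i$ is followed by an equal $c_i$. Uniqueness, `IsDecomp.unique`: a vertex
below $x$ but not below $y$, where $x,y$ share a level, has its part squeezed between those of $y$
and $x$. So vertices split in both directions share a part in every list. Conversely every list
defines a $(3+1)$-free structure, and its levels are the true ones exactly when the word is empty or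
starts on level $0$ (`IsDecomp.grounded_iff`).

Consequently labelled posets are the fillings of the canonical words that are empty or start on
level $0$. Each $c$ contributes $e^x-1$ and each $t$ contributes $T=T_{\mathrm{lbl}}(x,x)$. All
these words occur, and different canonical words have different traces, so they also represent the
skeleta once each. Therefore the poset series is $S(e^x-1,T)$.

For the cubic, let $u_h$ count the canonical words that are empty or have a first letter with lowest
level less than $h$. Removing the first letter gives $u_{h+1}=u_h+\frac{c}{1+c}u_{h+2}+t\,u_{h+3}$
with $u_0=1$. This recurrence has only one solution in power series with a given initial value, so
$u_{k+h}=u_ku_h$ and $u_h=S^h$; the case $h=0$ is the cubic.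

For $T$, bicoloured graphs are the layered structures on two levels. Their words use $c_0,c_1,t_0$,
no two of which commute, so the word series is rational and $B_{\mathrm{lbl}}\cdot(2e^{-x}-1-T)=1$.
-/

noncomputable section
namespace ThreePlusOne
open scoped Classical

/-! ### Canonical words -/

namespace Letter

/-- The lowest level that a letter occupies. -/
def lo : Letter → ℕ
  | c i => i
  | t i => i

/-- The highest level that a letter occupies. -/
def hi : Letter → ℕ
  | c i => i
  | t i => i + 1

@[simp] theorem lo_c (i : ℕ) : (c i).lo = i := rfl
@[simp] theorem lo_t (i : ℕ) : (t i).lo = i := rfl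
@[simp] theorem hi_c (i : ℕ) : (c i).hi = i := rfl
@[simp] theorem hi_t (i : ℕ) : (t i).hi = i + 1 := rfl
@[simp] theorem isC_c (i : ℕ) : (c i).isC = true := rfl
@[simp] theorem isC_t (i : ℕ) : (t i).isC = false := rfl
@[simp] theorem isT_c (i : ℕ) : (c i).isT = false := rfl
@[simp] theorem isT_t (i : ℕ) : (t i).isT = true := rfl

theorem lo_le_hi (x : Letter) : x.lo ≤ x.hi := by cases x <;> simp

theorem hi_le_lo (x : Letter) : x.hi ≤ x.lo + 1 := by cases x <;> simp

/-- The letters that commute by one of the relations. -/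
def Indep (x y : Letter) : Prop := x.hi + 2 ≤ y.lo ∨ y.hi + 2 ≤ x.lo

theorem Indep.symm {x y : Letter} (h : Indep x y) : Indep y x := Or.symm h

theorem not_indep_self (x : Letter) : ¬ Indep x x := by
  have := x.lo_le_hi
  unfold Indep
  omega

/-- `y` may follow `x` in a canonical word. -/
def Link (x y : Letter) : Prop := y.lo ≤ x.hi + 1 ∧ ¬ (x = y ∧ x.isC = true)

end Letter

open Letter

/-- Words in lexicographic normal form without two equal consecutive `c`'s. -/
def Canonical (w : List Letter) : Prop := w.IsChain Link

/-- The class of a word in the trace monoid. -/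
def trace (w : List Letter) : TraceMonoid := PresentedMonoid.mk CommRel (FreeMonoid.ofList w)

theorem trace_append (w w' : List Letter) : trace (w ++ w') = trace w * trace w' := by
  simp [trace, FreeMonoid.ofList_append]

theorem trace_cons (x : Letter) (w : List Letter) : trace (x :: w) = trace [x] * trace w :=
  trace_append [x] w

/-- The three families of commutation relations amount to one condition: the levels of the two
letters are at least two apart. -/
theorem trace_comm {x y : Letter} (h : Indep x y) :
    trace [x] * trace [y] = trace [y] * trace [x] := by
  have key : ∀ u v : FreeMonoid Letter, CommRel u v →
      PresentedMonoid.mk CommRel u = PresentedMonoid.mk CommRel v := fun u v huv =>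
    (Con.eq _).2 (ConGen.Rel.of _ _ huv)
  unfold Indep at h
  change PresentedMonoid.mk CommRel (.of x * .of y) = PresentedMonoid.mk CommRel (.of y * .of x)
  rcases x with i | i <;> rcases y with j | j <;> simp only [lo_c, lo_t, hi_c, hi_t] at h
  · exact key _ _ (.cc i j h)
  · exact key _ _ (.ct i j (by omega))
  · exact (key _ _ (.ct j i (by omega))).symm
  · exact key _ _ (.tt i j (by omega))

theorem trace_mul_comm {x : Letter} : ∀ {w : List Letter}, (∀ z ∈ w, Indep x z) →
    trace [x] * trace w = trace w * trace [x]
  | [], _ => by simp [trace]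
  | z :: w, h => by
    rw [trace_cons z, ← mul_assoc, trace_comm (h z (by simp)), mul_assoc,
      trace_mul_comm (fun z hz => h z (by simp [hz])), mul_assoc]

/-! ### Traces through their projections to pairs of dependent letters -/

section FilterEq

variable {α : Type*} {lab : α → Letter}

/-- Two labelled lists have the same restriction to every pair of elements whose labels do not
commute. -/
def FilterEq (lab : α → Letter) (L L' : List α) : Prop :=
  ∀ a b, ¬ Indep (lab a) (lab b) →
    L.filter (fun z => z = a ∨ z = b) = L'.filter (fun z => z = a ∨ z = b)

theorem FilterEq.symm {L L' : List α} (h : FilterEq lab L L') : FilterEq lab L' L :=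
  fun a b hab => (h a b hab).symm

theorem FilterEq.mem {L L' : List α} (h : FilterEq lab L L') {x : α} (hx : x ∈ L) : x ∈ L' := by
  have h1 := h x x (not_indep_self _)
  have h2 : x ∈ L.filter (fun z => z = x ∨ z = x) := by simp [hx]
  rw [h1] at h2
  exact (List.mem_filter.1 h2).1

/-- If something dependent on `x` preceded the first `x` of `L'`, the restrictions of the two lists
to this pair would begin differently. So `x` can be pulled to the front of `L'` by commutations. -/
theorem FilterEq.split {x : α} {L L' : List α} (h : FilterEq lab (x :: L) L') :
    ∃ p q, L' = p ++ x :: q ∧ x ∉ p ∧ (∀ z ∈ p, Indep (lab x) (lab z)) ∧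
      FilterEq lab L (p ++ q) := by
  obtain ⟨p, q, rfl, hp⟩ := List.eq_append_cons_of_mem (h.mem (x := x) (by simp))
  have hind : ∀ z ∈ p, Indep (lab x) (lab z) := by
    intro z hz
    by_contra hdep
    have h1 := h x z hdep
    simp only [List.filter_append] at h1
    obtain ⟨z', r, hr⟩ : ∃ z' r, p.filter (fun y => y = x ∨ y = z) = z' :: r :=
      List.exists_cons_of_ne_nil fun h0 => by
        have := List.filter_eq_nil_iff.1 h0 z hz
        simp at this
    have hz' : z' ∈ p := by
      have : z' ∈ p.filter (fun y => y = x ∨ y = z) := by rw [hr]; simp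
      exact (List.mem_filter.1 this).1
    rw [hr] at h1
    simp only [true_or, decide_true, List.filter_cons_of_pos, List.cons_append,
      List.cons.injEq] at h1
    exact hp (h1.1 ▸ hz')
  refine ⟨p, q, rfl, hp, hind, fun a b hab => ?_⟩
  have h1 := h a b hab
  by_cases hx : x = a ∨ x = b
  · have h0 : p.filter (fun y => y = a ∨ y = b) = [] := by
      rw [List.filter_eq_nil_iff]
      intro z hz
      simp only [decide_eq_true_eq]
      rcases hx with rfl | rfl
      · rintro (rfl | rfl)
        · exact hp hz
        · exact hab (hind _ hz)
      · rintro (rfl | rfl)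
        · exact hab (hind _ hz).symm
        · exact hp hz
    rw [List.filter_cons_of_pos (by simpa using hx), List.filter_append, h0, List.nil_append,
      List.filter_cons_of_pos (by simpa using hx)] at h1
    rw [List.filter_append, h0, List.nil_append]
    exact (List.cons.inj h1).2
  · rw [List.filter_cons_of_neg (by simpa using hx), List.filter_append,
      List.filter_cons_of_neg (by simpa using hx)] at h1
    rw [List.filter_append, h1]

theorem FilterEq.eq_nil {L' : List α} (h : FilterEq lab [] L') : L' = [] :=
  List.eq_nil_iff_forall_not_mem.2 fun _ hx => by simpa using h.symm.mem hx

theorem FilterEq.trace_eq : ∀ {L L' : List α}, FilterEq lab L L' →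
    trace (L.map lab) = trace (L'.map lab)
  | [], L', h => by rw [h.eq_nil]
  | x :: L, L', h => by
    obtain ⟨p, q, rfl, -, hp, hL⟩ := h.split
    rw [List.map_cons, trace_cons, hL.trace_eq, List.map_append, List.map_append, List.map_cons,
      trace_append, trace_append, trace_cons (lab x) (q.map lab), ← mul_assoc, ← mul_assoc,
      trace_mul_comm]
    simpa using hp

/-- The letter just before `b` cannot be far below `b`, so by commutation it is far above. Going
backwards, a letter linked to one far above `b` is too high to be far below `b`, hence is again far
above it. -/
theorem canonical_far {b : Letter} {q : List Letter} : ∀ {a : Letter} {u : List Letter},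
    Canonical (a :: (u ++ b :: q)) → (∀ z ∈ a :: u, Indep b z) → b.hi + 2 ≤ a.lo
  | a, [], h, hi => by
    have h1 := (List.isChain_cons_cons.1 h).1.1
    have h2 := hi a (by simp)
    unfold Indep at h2
    omega
  | a, a' :: u, h, hi => by
    have h' := List.isChain_cons_cons.1 h
    have h1 := h'.1.1
    have h2 := hi a (by simp)
    have h3 := canonical_far (a := a') (u := u) h'.2 (fun z hz => hi z (by simp [hz]))
    have := b.lo_le_hi
    unfold Indep at h2
    omega

/-- If the first elements differed, each could be pulled in front of the other; by `canonical_far`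
each would be far below the other. -/
theorem FilterEq.eq_of_canonical : ∀ {L L' : List α}, FilterEq lab L L' →
    Canonical (L.map lab) → Canonical (L'.map lab) → L = L'
  | [], L', h, _, _ => h.eq_nil.symm
  | x :: L, L', h, hc, hc' => by
    obtain ⟨p, q, hL', hxp, hp, hL⟩ := h.split
    rcases p with _ | ⟨y, p⟩
    · subst hL'
      rw [List.nil_append, hL.eq_of_canonical hc.tail hc'.tail]
      rfl
    · subst hL'
      obtain ⟨p', q', hL'', hyp', hp', -⟩ := h.symm.split
      rcases p' with _ | ⟨x', p'⟩
      · simp only [List.nil_append, List.cons.injEq] at hL''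
        simp [hL''.1] at hxp
      · simp only [List.cons_append, List.cons.injEq] at hL''
        obtain ⟨rfl, rfl⟩ := hL''
        have h1 := canonical_far (a := lab y) (u := p.map lab) (b := lab x) (q := q.map lab)
          (by simpa using hc') (by simpa using hp)
        have h2 := canonical_far (a := lab x) (u := p'.map lab) (b := lab y) (q := q'.map lab)
          (by simpa using hc) (by simpa using hp')
        have h3 := (lab x).lo_le_hi
        have h4 := (lab y).lo_le_hi
        omega

/-- Both restrictions are sorted by the relation "occurs earlier in `L'`", which is antisymmetric
because nothing is repeated. -/
theorem filterEq_of_perm {L L' : List α} (hL : L.Nodup) (hp : L.Perm L')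
    (h : ∀ a b, a ≠ b → ¬ Indep (lab a) (lab b) → [a, b].Sublist L → [a, b].Sublist L') :
    FilterEq lab L L' := by
  intro a b hab
  have hL' : L'.Nodup := hp.nodup_iff.1 hL
  refine List.Perm.eq_of_pairwise (le := fun u v => [u, v].Sublist L') ?_ ?_ ?_ (hp.filter _)
  · intro u v hu _ h1 h2
    by_contra huv
    have hi1 := (List.pairwise_iff_forall_sublist (R := fun a b => L'.idxOf a < L'.idxOf b)).1 ?_ h1
    have hi2 := (List.pairwise_iff_forall_sublist (R := fun a b => L'.idxOf a < L'.idxOf b)).1 ?_ h2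
    · omega
    all_goals
      rw [List.pairwise_iff_getElem]
      intro i j hi hj hij
      rw [List.Nodup.idxOf_getElem hL', List.Nodup.idxOf_getElem hL']
      exact hij
  · rw [List.pairwise_iff_forall_sublist]
    intro u v huv
    have hmem := fun z (hz : z ∈ [u, v]) => List.mem_filter.1 (huv.subset hz)
    have hu := (hmem u (by simp)).2
    have hv := (hmem v (by simp)).2
    have hne : u ≠ v := by
      have := (hL.filter _).sublist huv
      simpa using this
    refine h u v hne ?_ (huv.trans List.filter_sublist)
    simp only [decide_eq_true_eq] at hu hv
    rcases hu with rfl | rfl <;> rcases hv with rfl | rfl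
    · exact absurd rfl hne
    · exact hab
    · exact fun h => hab h.symm
    · exact absurd rfl hne
  · rw [List.pairwise_iff_forall_sublist]
    exact fun huv => huv.trans List.filter_sublist

end FilterEq

/-- The projection of a trace to the free monoid on two letters that do not commute. -/
def project (a b : Letter) (hab : ¬ Indep a b) : TraceMonoid →* FreeMonoid Letter :=
  PresentedMonoid.lift (fun z => if z = a ∨ z = b then FreeMonoid.of z else 1) (by
    have key : ∀ x y : Letter, Indep x y →
        (if x = a ∨ x = b then FreeMonoid.of x else 1) *
          (if y = a ∨ y = b then FreeMonoid.of y else 1) =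
        (if y = a ∨ y = b then FreeMonoid.of y else 1) *
          (if x = a ∨ x = b then FreeMonoid.of x else 1) := by
      intro x y hxy
      split_ifs with h1 h2 <;> try simp
      exfalso
      rcases h1 with rfl | rfl <;> rcases h2 with rfl | rfl
      · exact not_indep_self _ hxy
      · exact hab hxy
      · exact hab hxy.symm
      · exact not_indep_self _ hxy
    rintro _ _ (⟨i, j, h⟩ | ⟨i, j, h⟩ | ⟨i, j, h⟩) <;>
      simp only [map_mul, FreeMonoid.lift_eval_of] <;> apply key <;>
      simp only [Indep, lo_c, lo_t, hi_c, hi_t] <;> omega)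

theorem project_trace (a b : Letter) (hab : ¬ Indep a b) (w : List Letter) :
    project a b hab (trace w) = FreeMonoid.ofList (w.filter fun z => z = a ∨ z = b) := by
  induction w with
  | nil => simp [trace]
  | cons x w ih =>
    rw [trace_cons, map_mul, ih]
    have : project a b hab (trace [x]) = if x = a ∨ x = b then FreeMonoid.of x else 1 := rfl
    rw [this]
    split_ifs with h
    · rw [List.filter_cons_of_pos (by simpa using h), FreeMonoid.ofList_cons]
    · rw [List.filter_cons_of_neg (by simpa using h), one_mul]

theorem filterEq_of_trace_eq {w w' : List Letter} (h : trace w = trace w') :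
    FilterEq id w w' := by
  intro a b hab
  have := congrArg (project a b hab) h
  rwa [project_trace, project_trace] at this

theorem Canonical.eq_of_trace_eq {w w' : List Letter} (hw : Canonical w) (hw' : Canonical w')
    (h : trace w = trace w') : w = w' :=
  (filterEq_of_trace_eq h).eq_of_canonical (by simpa using hw) (by simpa using hw')

/-! ### Generating functions of sets of words -/

/-- The words of a set that have `d 0` letters `c` and `d 1` letters `t`. -/
def graded (W : Set (List Letter)) (d : Fin 2 →₀ ℕ) : Set (List Letter) :=
  {w ∈ W | w.countP isC = d 0 ∧ w.countP isT = d 1}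

/-- The generating function of a set of words by the numbers of letters `c` and `t`. -/
def wordGF (W : Set (List Letter)) : MvPowerSeries (Fin 2) ℚ := fun d => ((graded W d).ncard : ℚ)

theorem coeff_wordGF (W : Set (List Letter)) (d : Fin 2 →₀ ℕ) :
    MvPowerSeries.coeff d (wordGF W) = ((graded W d).ncard : ℚ) := rfl

/-- A set of words is locally finite if it has finitely many words of each length. -/
def LocallyFin (W : Set (List Letter)) : Prop := ∀ n, {w ∈ W | w.length = n}.Finite

theorem countP_add (w : List Letter) : w.countP isC + w.countP isT = w.length := by
  induction w with
  | nil => rfl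
  | cons x w ih => rcases x with i | i <;> simp [List.countP_cons] <;> omega

theorem LocallyFin.mono {W W' : Set (List Letter)} (h : LocallyFin W) (hW : W' ⊆ W) :
    LocallyFin W' := fun n => (h n).subset fun _ hw => ⟨hW hw.1, hw.2⟩

theorem LocallyFin.graded {W : Set (List Letter)} (h : LocallyFin W) (d : Fin 2 →₀ ℕ) :
    (graded W d).Finite :=
  (h (d 0 + d 1)).subset fun w hw => ⟨hw.1, by rw [← countP_add, hw.2.1, hw.2.2]⟩

theorem LocallyFin.cons {W : Set (List Letter)} (h : LocallyFin W) (x : Letter) :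
    LocallyFin ((x :: ·) '' W) := fun n => by
  refine ((h (n - 1)).image (x :: ·)).subset ?_
  rintro _ ⟨⟨w, hw, rfl⟩, hn⟩
  refine ⟨w, ⟨hw, ?_⟩, rfl⟩
  simp only [List.length_cons] at hn
  omega

theorem wordGF_union {A B : Set (List Letter)} (hA : LocallyFin A) (hB : LocallyFin B)
    (hAB : Disjoint A B) : wordGF (A ∪ B) = wordGF A + wordGF B := by
  ext d
  rw [map_add, coeff_wordGF, coeff_wordGF, coeff_wordGF]
  have : graded (A ∪ B) d = graded A d ∪ graded B d := by
    ext w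
    simp only [graded, Set.mem_union, Set.mem_ofPred_eq]
    tauto
  rw [this, Set.ncard_union_eq _ (hA.graded d) (hB.graded d)]
  · push_cast
    rfl
  · exact hAB.mono (fun _ h => h.1) (fun _ h => h.1)

theorem wordGF_nil : wordGF {[]} = 1 := by
  ext d
  rw [coeff_wordGF, MvPowerSeries.coeff_one]
  split_ifs with h
  · have : graded {[]} d = {[]} := by
      ext w
      simp only [graded, Set.mem_singleton_iff, Set.mem_ofPred_eq, h]
      constructor
      · exact fun h => h.1
      · rintro rfl
        simp
    rw [this]
    simp
  · have : graded {[]} d = ∅ := by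
      ext w
      simp only [graded, Set.mem_singleton_iff, Set.mem_ofPred_eq, Set.mem_empty_iff_false,
        iff_false]
      rintro ⟨rfl, h0, h1⟩
      apply h
      ext i
      fin_cases i
      · exact h0.symm
      · exact h1.symm
    rw [this]
    simp

/-- The variable that marks a letter. -/
def mark : Letter → Fin 2
  | .c _ => 0
  | .t _ => 1

@[simp] theorem mark_c (i : ℕ) : mark (.c i) = 0 := rfl
@[simp] theorem mark_t (i : ℕ) : mark (.t i) = 1 := rfl

theorem wordGF_cons (x : Letter) (W : Set (List Letter)) :
    wordGF ((x :: ·) '' W) = MvPowerSeries.X (mark x) * wordGF W := by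
  ext d
  rw [MvPowerSeries.X_def, MvPowerSeries.coeff_monomial_mul, coeff_wordGF, coeff_wordGF, one_mul]
  split_ifs with h
  · have h1 : 1 ≤ d (mark x) := by simpa using h (mark x)
    have : graded ((x :: ·) '' W) d = (x :: ·) '' graded W (d - Finsupp.single (mark x) 1) := by
      ext w
      simp only [graded, Set.mem_ofPred_eq, Set.mem_image, Finsupp.coe_tsub, Pi.sub_apply]
      constructor
      · rintro ⟨⟨v, hv, rfl⟩, h0, h1⟩
        refine ⟨v, ⟨hv, ?_, ?_⟩, rfl⟩ <;> rcases x with i | i <;> simp [List.countP_cons] at h0 h1 h ⊢ <;> omega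
      · rintro ⟨v, ⟨hv, h0, h1⟩, rfl⟩
        refine ⟨⟨v, hv, rfl⟩, ?_, ?_⟩ <;> rcases x with i | i <;> simp [List.countP_cons] at * <;> omega
    rw [this, Set.ncard_image_of_injective _ (List.cons_injective)]
  · have : graded ((x :: ·) '' W) d = ∅ := by
      rw [Set.eq_empty_iff_forall_notMem]
      rintro _ ⟨⟨w, -, rfl⟩, h0, h1⟩
      apply h
      rw [Finsupp.single_le_iff]
      rcases x with i | i <;> simp [List.countP_cons] at h0 h1 ⊢ <;> omega
    rw [this]
    simp

/-! ### The cubic equation -/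

/-- The canonical words that can follow a letter whose highest level is `h - 2`. -/
def wordsBelow (h : ℕ) : Set (List Letter) := {w | Canonical w ∧ ∀ x ∈ w.head?, x.lo < h}

/-- The canonical words that can follow the letter `c h`. -/
def wordsAfter (h : ℕ) : Set (List Letter) := {w ∈ wordsBelow (h + 2) | w.head? ≠ some (c h)}

theorem cons_c_canonical {h : ℕ} {w : List Letter} :
    Canonical (c h :: w) ↔ w ∈ wordsAfter h := by
  simp only [Canonical, List.isChain_cons, wordsAfter, wordsBelow, Set.mem_ofPred_eq, Link]
  rcases w with _ | ⟨y, w⟩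
  · simp
  · simp only [List.head?_cons, Option.mem_def, Option.some.injEq, forall_eq', hi_c, isC_c,
      and_true, ne_eq, Nat.lt_succ_iff]
    rw [eq_comm (a := y)]
    tauto

theorem cons_t_canonical {h : ℕ} {w : List Letter} :
    Canonical (t h :: w) ↔ w ∈ wordsBelow (h + 3) := by
  simp only [Canonical, List.isChain_cons, wordsBelow, Set.mem_ofPred_eq, Link]
  rcases w with _ | ⟨y, w⟩
  · simp
  · simp only [List.head?_cons, Option.mem_def, Option.some.injEq, forall_eq', hi_t, isC_t,
      Bool.false_eq_true, and_false, not_false_eq_true, and_true, Nat.lt_succ_iff]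
    tauto

theorem wordsBelow_zero : wordsBelow 0 = {[]} := by
  ext w
  rcases w with _ | ⟨y, w⟩
  · simp [wordsBelow, Canonical]
  · simp [wordsBelow]

/-- The additional words are those whose first letter has lowest level exactly `h`. The next letter
may start one level above the top of that letter, whence the bounds `h + 2` (inside `wordsAfter h`)
and `h + 3`. -/
theorem wordsBelow_succ (h : ℕ) : wordsBelow (h + 1) =
    wordsBelow h ∪ ((c h :: ·) '' wordsAfter h ∪ (t h :: ·) '' wordsBelow (h + 3)) := by
  ext w
  rcases w with _ | ⟨y, w⟩
  · simp [wordsBelow, Canonical]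
  · have h1 : y :: w ∈ (c h :: ·) '' wordsAfter h ↔ y = c h ∧ Canonical (c h :: w) := by
      rw [cons_c_canonical]
      constructor
      · rintro ⟨w', hw', h⟩
        simp only [List.cons.injEq] at h
        obtain ⟨rfl, rfl⟩ := h
        exact ⟨rfl, hw'⟩
      · rintro ⟨rfl, h⟩
        exact ⟨w, h, rfl⟩
    have h2 : y :: w ∈ (t h :: ·) '' wordsBelow (h + 3) ↔ y = t h ∧ Canonical (t h :: w) := by
      rw [cons_t_canonical]
      constructor
      · rintro ⟨w', hw', h⟩
        simp only [List.cons.injEq] at h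
        obtain ⟨rfl, rfl⟩ := h
        exact ⟨rfl, hw'⟩
      · rintro ⟨rfl, h⟩
        exact ⟨w, h, rfl⟩
    rw [Set.mem_union, Set.mem_union, h1, h2]
    simp only [wordsBelow, Set.mem_ofPred_eq, List.head?_cons, Option.mem_def, Option.some.injEq,
      forall_eq']
    constructor
    · rintro ⟨hc, hy⟩
      rcases Nat.lt_succ_iff_lt_or_eq.1 hy with hy | hy
      · exact Or.inl ⟨hc, hy⟩
      · rcases y with i | i <;> simp only [lo_c, lo_t] at hy <;> subst hy
        · exact Or.inr (Or.inl ⟨rfl, hc⟩)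
        · exact Or.inr (Or.inr ⟨rfl, hc⟩)
    · rintro (⟨hc, hy⟩ | ⟨rfl, hc⟩ | ⟨rfl, hc⟩)
      · exact ⟨hc, by omega⟩
      · exact ⟨hc, by simp⟩
      · exact ⟨hc, by simp⟩

/-- A leading `c h` can be added or removed freely. This is where the factor $1+c$ comes from. -/
theorem wordsBelow_add_two (h : ℕ) :
    wordsBelow (h + 2) = wordsAfter h ∪ (c h :: ·) '' wordsAfter h := by
  ext w
  simp only [Set.mem_union, Set.mem_image]
  constructor
  · intro hw
    by_cases hh : w.head? = some (c h)
    · right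
      obtain ⟨w', rfl⟩ := List.head?_eq_some_iff.1 hh
      exact ⟨w', cons_c_canonical.1 hw.1, rfl⟩
    · exact Or.inl ⟨hw, hh⟩
  · rintro (hw | ⟨w', hw', rfl⟩)
    · exact hw.1
    · exact ⟨cons_c_canonical.2 hw', by simp⟩

/-- The alphabet is infinite, but each letter bounds the lowest level of its successor. -/
theorem locallyFin_wordsBelow (h : ℕ) : LocallyFin (wordsBelow h) := by
  intro n
  induction n generalizing h with
  | zero =>
    refine (Set.finite_singleton ([] : List Letter)).subset fun w hw => ?_
    exact List.length_eq_zero_iff.1 hw.2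
  | succ n ih =>
    have : {w ∈ wordsBelow h | w.length = n + 1} ⊆
        ⋃ i ∈ Set.Iio h, ((c i :: ·) '' {w ∈ wordsBelow (i + 2) | w.length = n} ∪
          (t i :: ·) '' {w ∈ wordsBelow (i + 3) | w.length = n}) := by
      rintro w ⟨⟨hc, hh⟩, hn⟩
      rcases w with _ | ⟨y, w⟩
      · simp at hn
      · have hy := hh y rfl
        simp only [List.length_cons, Nat.add_right_cancel_iff] at hn
        simp only [Set.mem_iUnion]
        rcases y with i | i
        · exact ⟨i, hy, Or.inl ⟨w, ⟨(cons_c_canonical.1 hc).1, hn⟩, rfl⟩⟩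
        · exact ⟨i, hy, Or.inr ⟨w, ⟨cons_t_canonical.1 hc, hn⟩, rfl⟩⟩
    exact (Set.Finite.biUnion (Set.finite_Iio h) fun i _ =>
      ((ih _).image _).union ((ih _).image _)).subset this

theorem locallyFin_wordsAfter (h : ℕ) : LocallyFin (wordsAfter h) :=
  (locallyFin_wordsBelow (h + 2)).mono fun _ hw => hw.1

theorem constantCoeff_one_add_X (i : Fin 2) :
    MvPowerSeries.constantCoeff (1 + MvPowerSeries.X i : MvPowerSeries (Fin 2) ℚ) ≠ 0 := by
  simp

/-- The series $c/(1+c)$. -/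
def cloneSeries : MvPowerSeries (Fin 2) ℚ := MvPowerSeries.X 0 * (1 + MvPowerSeries.X 0)⁻¹

theorem one_add_mul_cloneSeries :
    (1 + MvPowerSeries.X 0) * cloneSeries = MvPowerSeries.X 0 := by
  rw [cloneSeries, mul_left_comm, MvPowerSeries.mul_inv_cancel _ (constantCoeff_one_add_X 0),
    mul_one]

theorem one_add_X_ne_zero : (1 + MvPowerSeries.X 0 : MvPowerSeries (Fin 2) ℚ) ≠ 0 := fun h =>
  constantCoeff_one_add_X 0 (by rw [h, map_zero])

theorem constantCoeff_cloneSeries : MvPowerSeries.constantCoeff cloneSeries = 0 := by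
  simp [cloneSeries]

theorem wordGF_wordsBelow_succ (h : ℕ) : wordGF (wordsBelow (h + 1)) = wordGF (wordsBelow h) +
    cloneSeries * wordGF (wordsBelow (h + 2)) +
      MvPowerSeries.X 1 * wordGF (wordsBelow (h + 3)) := by
  have hlo : ∀ {h : ℕ} {w : List Letter}, w ∈ wordsBelow h → ∀ x ∈ w.head?, x.lo < h :=
    fun hw => hw.2
  have h1 : wordGF (wordsBelow (h + 2)) = (1 + MvPowerSeries.X 0) * wordGF (wordsAfter h) := by
    rw [wordsBelow_add_two, wordGF_union (locallyFin_wordsAfter h)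
      ((locallyFin_wordsAfter h).cons _), wordGF_cons, mark_c, add_mul, one_mul]
    rw [Set.disjoint_left]
    rintro _ hw ⟨w, -, rfl⟩
    exact hw.2 rfl
  have h2 : wordGF (wordsBelow (h + 1)) = wordGF (wordsBelow h) +
      (MvPowerSeries.X 0 * wordGF (wordsAfter h) +
        MvPowerSeries.X 1 * wordGF (wordsBelow (h + 3))) := by
    rw [wordsBelow_succ, wordGF_union (locallyFin_wordsBelow h), wordGF_union, wordGF_cons,
      wordGF_cons, mark_c, mark_t]
    · exact (locallyFin_wordsAfter h).cons _
    · exact (locallyFin_wordsBelow _).cons _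
    · rw [Set.disjoint_left]
      rintro _ ⟨w, -, rfl⟩ ⟨w', -, h⟩
      simp at h
    · refine (((locallyFin_wordsBelow (h + 1)).mono ?_))
      rw [wordsBelow_succ h]
      exact Set.subset_union_right
    · rw [Set.disjoint_left]
      rintro _ hw (⟨w, -, rfl⟩ | ⟨w, -, rfl⟩)
      · simpa using hlo hw _ rfl
      · simpa using hlo hw _ rfl
  rw [h2, h1, ← mul_assoc, mul_comm cloneSeries, one_add_mul_cloneSeries, add_assoc]

/-- Later terms enter only with coefficients of positive order. If all terms have order at least
$n$, then induction on the index, starting from `u 0 = 0`, shows that all have order at least $n+1$.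
-/
theorem eq_zero_of_recurrence {a b : MvPowerSeries (Fin 2) ℚ}
    (ha : MvPowerSeries.constantCoeff a = 0) (hb : MvPowerSeries.constantCoeff b = 0)
    {u : ℕ → MvPowerSeries (Fin 2) ℚ} (h0 : u 0 = 0)
    (hu : ∀ h, u (h + 1) = u h + a * u (h + 2) + b * u (h + 3)) (h : ℕ) : u h = 0 := by
  rw [← MvPowerSeries.one_le_order_iff_constCoeff_eq_zero] at ha hb
  have key : ∀ (n h : ℕ), (n : ℕ∞) ≤ (u h).order := by
    intro n
    induction n with
    | zero => simp
    | succ n ih =>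
      have hmul : ∀ {f : MvPowerSeries (Fin 2) ℚ}, 1 ≤ f.order → ∀ h,
          ((n + 1 : ℕ) : ℕ∞) ≤ (f * u h).order := fun {f} hf h => by
        refine le_trans ?_ MvPowerSeries.le_order_mul
        rw [Nat.cast_add, add_comm, Nat.cast_one]
        exact add_le_add hf (ih h)
      intro h
      induction h with
      | zero => simp [h0]
      | succ h ihh =>
        rw [hu h]
        refine le_trans (le_min (le_trans (le_min ihh (hmul ha _))
          MvPowerSeries.min_order_le_add) (hmul hb _)) MvPowerSeries.min_order_le_add
  rw [← MvPowerSeries.order_eq_top_iff, ENat.eq_top_iff_forall_ge]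
  exact fun n => key n h

/-- For fixed `k` both sides satisfy the same linear recurrence in `h` with the same value at $0$.
No bijective splitting of words is needed. -/
theorem wordGF_wordsBelow_add (k h : ℕ) :
    wordGF (wordsBelow (k + h)) = wordGF (wordsBelow k) * wordGF (wordsBelow h) := by
  have := eq_zero_of_recurrence constantCoeff_cloneSeries (b := MvPowerSeries.X 1) (by simp)
    (u := fun h => wordGF (wordsBelow (k + h)) - wordGF (wordsBelow k) * wordGF (wordsBelow h))
    (by simp [wordsBelow_zero, wordGF_nil]) (fun h => by
      simp only [← add_assoc]
      rw [wordGF_wordsBelow_succ h, wordGF_wordsBelow_succ (k + h)]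
      ring) h
  exact sub_eq_zero.1 this

theorem satisfiesCubic_wordGF : SatisfiesCubic (wordGF (wordsBelow 1)) := by
  have h2 := wordGF_wordsBelow_add 1 1
  have h3 := wordGF_wordsBelow_add 2 1
  have h1 := wordGF_wordsBelow_succ 0
  simp only [Nat.reduceAdd, zero_add] at h1 h2 h3
  rw [h2] at h3
  rw [h3, h2, wordsBelow_zero, wordGF_nil] at h1
  change _ = 1 + cloneSeries * _ ^ 2 + _
  rw [pow_two, pow_succ, pow_two]
  exact h1

/-- The difference of the two equations is `S - S'` times a series with constant term $1$. -/
theorem SatisfiesCubic.unique {S S' : MvPowerSeries (Fin 2) ℚ} (h : SatisfiesCubic S)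
    (h' : SatisfiesCubic S') : S = S' := by
  change S = 1 + cloneSeries * S ^ 2 + _ at h
  change S' = 1 + cloneSeries * S' ^ 2 + _ at h'
  have key : (S - S') * (1 - (cloneSeries * (S + S') +
      MvPowerSeries.X 1 * (S ^ 2 + S * S' + S' ^ 2))) = 0 := by
    linear_combination h - h'
  rcases mul_eq_zero.1 key with h | h
  · exact sub_eq_zero.1 h
  · have := congrArg MvPowerSeries.constantCoeff h
    simp [constantCoeff_cloneSeries] at this

/-! ### Words of bicoloured graphs -/

/-- The canonical words in the letters of the lowest two levels. -/
def bicolouredWords : Set (List Letter) := {w | Canonical w ∧ ∀ x ∈ w, x.hi ≤ 1}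

theorem locallyFin_bicolouredWords : LocallyFin bicolouredWords :=
  (locallyFin_wordsBelow 2).mono fun w hw => ⟨hw.1, fun x hx => by
    have := hw.2 x (List.mem_of_mem_head? hx)
    have := x.lo_le_hi
    omega⟩

theorem bicoloured_cons_t {w : List Letter} (hw : w ∈ bicolouredWords) :
    t 0 :: w ∈ bicolouredWords := by
  refine ⟨cons_t_canonical.2 ⟨hw.1, fun x hx => ?_⟩, by simpa using hw.2⟩
  have := hw.2 x (List.mem_of_mem_head? hx)
  have := x.lo_le_hi
  omega

theorem bicoloured_cons_c {w : List Letter} {i : ℕ} (hi : i ≤ 1) :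
    c i :: w ∈ bicolouredWords ↔ w ∈ bicolouredWords ∧ w.head? ≠ some (c i) := by
  constructor
  · intro h
    exact ⟨⟨h.1.tail, fun x hx => h.2 x (by simp [hx])⟩, (cons_c_canonical.1 h.1).2⟩
  · rintro ⟨h, hh⟩
    refine ⟨cons_c_canonical.2 ⟨⟨h.1, fun x hx => ?_⟩, hh⟩, by simpa using ⟨hi, h.2⟩⟩
    have := h.2 x (List.mem_of_mem_head? hx)
    have := x.lo_le_hi
    omega

/-- On two levels the only forbidden pattern is a repeated $c_0$ or $c_1$. By the first letter,
$Z=1+\frac{2c}{1+c}Z+tZ$, and $1-\frac{2c}{1+c}=\frac{2}{1+c}-1$. -/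
theorem wordGF_bicoloured : (2 * (1 + MvPowerSeries.X 0)⁻¹ - 1 - MvPowerSeries.X 1) *
    wordGF bicolouredWords = 1 := by
  let G : ℕ → Set (List Letter) := fun i => {w ∈ bicolouredWords | w.head? ≠ some (c i)}
  have hfin : ∀ i, LocallyFin (G i) := fun i => locallyFin_bicolouredWords.mono fun _ h => h.1
  have hsplit : ∀ i ≤ 1, bicolouredWords = G i ∪ (c i :: ·) '' G i := by
    intro i hi
    ext w
    constructor
    · intro hw
      by_cases hh : w.head? = some (c i)
      · right
        obtain ⟨w', rfl⟩ := List.head?_eq_some_iff.1 hh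
        exact ⟨w', (bicoloured_cons_c hi).1 hw, rfl⟩
      · exact Or.inl ⟨hw, hh⟩
    · rintro (hw | ⟨w', hw', rfl⟩)
      · exact hw.1
      · exact (bicoloured_cons_c hi).2 hw'
  have hG : ∀ i ≤ 1, wordGF bicolouredWords = (1 + MvPowerSeries.X 0) * wordGF (G i) := by
    intro i hi
    conv_lhs => rw [hsplit i hi]
    rw [wordGF_union (hfin i) ((hfin i).cons _), wordGF_cons, mark_c, add_mul, one_mul]
    rw [Set.disjoint_left]
    rintro _ hw ⟨w, -, rfl⟩
    exact hw.2 rfl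
  have hdec : bicolouredWords = {[]} ∪ ((c 0 :: ·) '' G 0 ∪ ((c 1 :: ·) '' G 1 ∪
      (t 0 :: ·) '' bicolouredWords)) := by
    ext w
    constructor
    · intro hw
      rcases w with _ | ⟨y, w⟩
      · exact Or.inl rfl
      · have hy := hw.2 y (by simp)
        rcases y with i | i
        · simp only [hi_c] at hy
          have h1 := (bicoloured_cons_c hy).1 hw
          interval_cases i
          · exact Or.inr (Or.inl ⟨w, h1, rfl⟩)
          · exact Or.inr (Or.inr (Or.inl ⟨w, h1, rfl⟩))
        · simp only [hi_t] at hy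
          obtain rfl : i = 0 := by omega
          exact Or.inr (Or.inr (Or.inr ⟨w, ⟨hw.1.tail, fun x hx => hw.2 x (by simp [hx])⟩, rfl⟩))
    · rintro (rfl | ⟨w, hw, rfl⟩ | ⟨w, hw, rfl⟩ | ⟨w, hw, rfl⟩)
      · exact ⟨by simp [Canonical], by simp⟩
      · exact (bicoloured_cons_c (by omega)).2 hw
      · exact (bicoloured_cons_c (by omega)).2 hw
      · exact bicoloured_cons_t hw
  have hfin' : LocallyFin ((c 1 :: ·) '' G 1 ∪ (t 0 :: ·) '' bicolouredWords) :=
    locallyFin_bicolouredWords.mono (by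
      conv_rhs => rw [hdec]
      exact Set.subset_union_right.trans Set.subset_union_right)
  have hrec : wordGF bicolouredWords = 1 + (MvPowerSeries.X 0 * wordGF (G 0) +
      (MvPowerSeries.X 0 * wordGF (G 1) + MvPowerSeries.X 1 * wordGF bicolouredWords)) := by
    conv_lhs => rw [hdec]
    rw [wordGF_union, wordGF_union, wordGF_union, wordGF_cons, wordGF_cons, wordGF_cons,
      wordGF_nil]
    · rfl
    · exact (hfin 1).cons _
    · exact locallyFin_bicolouredWords.cons _
    · rw [Set.disjoint_left]
      rintro _ ⟨w, -, rfl⟩ ⟨w', -, h⟩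
      simp at h
    · exact (hfin 0).cons _
    · exact hfin'
    · rw [Set.disjoint_left]
      rintro _ ⟨w, -, rfl⟩ (⟨w', -, h⟩ | ⟨w', -, h⟩) <;> simp at h
    · exact locallyFin_bicolouredWords.mono (by
        rintro _ rfl
        exact ⟨by simp [Canonical], by simp⟩)
    · exact locallyFin_bicolouredWords.mono (by
        conv_rhs => rw [hdec]
        exact Set.subset_union_right)
    · rw [Set.disjoint_left]
      rintro _ rfl (⟨w', -, h⟩ | ⟨w', -, h⟩ | ⟨w', -, h⟩) <;> simp at h
  have hinv := MvPowerSeries.mul_inv_cancel _ (constantCoeff_one_add_X 0)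
  have hG0 := hG 0 (by omega)
  have hG1 := hG 1 (by omega)
  generalize wordGF bicolouredWords = Z at *
  generalize wordGF (G 0) = Z0 at *
  generalize wordGF (G 1) = Z1 at *
  apply mul_left_cancel₀ one_add_X_ne_zero
  linear_combination (2 * Z) * hinv + (1 + MvPowerSeries.X 0) * hrec -
    MvPowerSeries.X 0 * hG0 - MvPowerSeries.X 0 * hG1

/-! ### Tangle relations -/

section Layered

variable {V : Type}

/-- The elements of `B` distinguish `x` and `y` in both directions. -/
def Splits (r : V → V → Prop) (B : Set V) (x y : V) : Prop :=
  (∃ b ∈ B, r b x ∧ ¬ r b y) ∧ ∃ b ∈ B, r b y ∧ ¬ r b x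

/-- `A` has at least two elements and is connected by the relation `Splits r B`. -/
def CutConn (r : V → V → Prop) (B A : Set V) : Prop :=
  A.Nontrivial ∧ ∀ S ⊆ A, S.Nonempty → (A \ S).Nonempty → ∃ x ∈ S, ∃ y ∈ A \ S, Splits r B x y

/-- The relation `r` between `B` and `A` makes them the bottom and the top of a tangle. -/
def TangleRel (r : V → V → Prop) (B A : Set V) : Prop :=
  CutConn r B A ∧ CutConn (flip r) A B

theorem Splits.symm {r : V → V → Prop} {B : Set V} {x y : V} (h : Splits r B x y) :
    Splits r B y x := ⟨h.2, h.1⟩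

theorem Splits.mono {r : V → V → Prop} {B B' : Set V} (hB : B ⊆ B') {x y : V}
    (h : Splits r B x y) : Splits r B' x y := by
  obtain ⟨⟨b, hb, h1⟩, b', hb', h2⟩ := h
  exact ⟨⟨b, hB hb, h1⟩, b', hB hb', h2⟩

/-- Otherwise a fibre of `f` would be a cut of `A` that no splitting pair crosses. -/
theorem CutConn.eq_of_splits {r : V → V → Prop} {B A : Set V} (h : CutConn r B A) {β : Type*}
    {f : V → β} (hf : ∀ x ∈ A, ∀ y ∈ A, Splits r B x y → f x = f y) {x y : V} (hx : x ∈ A)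
    (hy : y ∈ A) : f x = f y := by
  by_contra hne
  obtain ⟨u, hu, v, hv, huv⟩ := h.2 {z ∈ A | f x = f z} (fun _ hz => hz.1) ⟨x, hx, rfl⟩
    ⟨y, hy, fun hy' => hne hy'.2⟩
  exact hv.2 ⟨hv.1, hu.2.trans (hf u hu.1 v hv.1 huv)⟩

theorem CutConn.exists_splits {r : V → V → Prop} {B A : Set V} (h : CutConn r B A) {x : V}
    (hx : x ∈ A) : ∃ y ∈ A, Splits r B x y := by
  obtain ⟨z, hz, hzx⟩ := h.1.exists_ne x
  obtain ⟨u, rfl, v, hv, huv⟩ := h.2 {x} (by simpa using hx) ⟨x, rfl⟩ ⟨z, hz, hzx⟩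
  exact ⟨v, hv.1, huv⟩

/-- Suppose that no splitting pair crosses a cut of `A`. For each edge of the splitting graph on
`B`, all elements of `A` that tell its ends apart lie on one side of the cut, and edges with a
common end get the same side. As `B` is connected, all edges get the same side. By `hA` every
element of `A` tells apart the ends of some edge, so the other side is empty. -/
theorem CutConn.transfer {r : V → V → Prop} {B A : Set V} (h : CutConn (flip r) A B)
    (hA : ∀ z ∈ A, (∃ b ∈ B, r b z) ∧ ∃ b ∈ B, ¬ r b z) : CutConn r B A := by
  have edge : ∀ z ∈ A, ∃ b ∈ B, ∃ b' ∈ B, Splits (flip r) A b b' ∧ r b z ∧ ¬ r b' z := by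
    intro z hz
    obtain ⟨⟨b, hb, hbz⟩, b', hb', hbz'⟩ := hA z hz
    by_contra! hno
    have := h.eq_of_splits (f := fun b => r b z) (fun x hx y hy hxy => by
      have h1 := hno x hx y hy hxy
      have h2 := hno y hy x hx hxy.symm
      exact propext ⟨h1, h2⟩) hb hb'
    exact hbz' (this ▸ hbz)
  refine ⟨?_, fun S hS hne hne' => ?_⟩
  · obtain ⟨b, hb⟩ := h.1.nonempty
    obtain ⟨b', hb', ⟨z, hz, h1⟩, z', hz', h2⟩ := h.exists_splits hb
    refine ⟨z, hz, z', hz', ?_⟩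
    rintro rfl
    exact h1.2 h2.1
  · by_contra! hno
    have hno' : ∀ x ∈ S, ∀ y ∈ A, y ∉ S → ¬ Splits r B x y := fun x hx y hy hyS =>
      hno x hx y ⟨hy, hyS⟩
    -- The two witnesses of an edge split each other, and `z` splits from one of them, so both lie
    -- on the side of `z`.
    have star1 : ∀ b ∈ B, ∀ b' ∈ B, Splits (flip r) A b b' → ∀ z ∈ S,
        ((r b z ∧ ¬ r b' z) ∨ (r b' z ∧ ¬ r b z)) →
        ∃ p ∈ S, ∃ p' ∈ S, (r b p ∧ ¬ r b' p) ∧ (r b' p' ∧ ¬ r b p') := by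
      rintro b hb b' hb' ⟨⟨p, hp, hp1⟩, p', hp', hp2⟩ z hz hzz
      have hpp : Splits r B p p' := ⟨⟨b, hb, hp1.1, hp2.2⟩, b', hb', hp2.1, hp1.2⟩
      rcases hzz with hzz | hzz
      · have hp'S : p' ∈ S := by
          by_contra hn
          exact hno' z hz p' hp' hn ⟨⟨b, hb, hzz.1, hp2.2⟩, b', hb', hp2.1, hzz.2⟩
        refine ⟨p, ?_, p', hp'S, hp1, hp2⟩
        by_contra hn
        exact hno' p' hp'S p hp hn hpp.symm
      · have hpS : p ∈ S := by
          by_contra hn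
          exact hno' z hz p hp hn ⟨⟨b', hb', hzz.1, hp1.2⟩, b, hb, hp1.1, hzz.2⟩
        refine ⟨p, hpS, p', ?_, hp1, hp2⟩
        by_contra hn
        exact hno' p hpS p' hp' hn hpp
    -- If the edges `b b'` and `b b''` had different sides, the absence of crossing pairs would
    -- force `r b' q` and `r b'' p`; then `b'` and `b''` split `p` from `q` across the cut.
    have star : ∀ b ∈ B, ∀ b' ∈ B, ∀ b'' ∈ B, Splits (flip r) A b b' → Splits (flip r) A b b'' →
        ∀ z ∈ S, ((r b z ∧ ¬ r b' z) ∨ (r b' z ∧ ¬ r b z)) →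
        ∀ z' ∈ A, ((r b z' ∧ ¬ r b'' z') ∨ (r b'' z' ∧ ¬ r b z')) → z' ∈ S := by
      intro b hb b' hb' b'' hb'' h1 h2 z hz hzz z' hz' hzz'
      by_contra hz'S
      obtain ⟨p, hp, p', hp', hbp, hbp'⟩ := star1 b hb b' hb' h1 z hz hzz
      obtain ⟨⟨q, hq, hbq⟩, q', hq', hbq'⟩ := h2
      have hqq : Splits r B q q' := ⟨⟨b, hb, hbq.1, hbq'.2⟩, b'', hb'', hbq'.1, hbq.2⟩
      simp only [flip] at hbq hbq'
      have hnS : q ∉ S ∧ q' ∉ S := by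
        by_cases hqS : q ∈ S
        · exfalso
          have hq'S : q' ∈ S := by
            by_contra hn
            exact hno' q hqS q' hq' hn hqq
          rcases hzz' with hh | hh
          · exact hno' q' hq'S z' hz' hz'S ⟨⟨b'', hb'', hbq'.1, hh.2⟩, b, hb, hh.1, hbq'.2⟩
          · exact hno' q hqS z' hz' hz'S ⟨⟨b, hb, hbq.1, hh.2⟩, b'', hb'', hh.1, hbq.2⟩
        · refine ⟨hqS, fun hq'S => ?_⟩
          exact hno' q' hq'S q hq hqS hqq.symm
      have e1 : r b' q := by
        by_contra hn
        exact hno' p' hp' q hq hnS.1 ⟨⟨b', hb', hbp'.1, hn⟩, b, hb, hbq.1, hbp'.2⟩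
      have e2 : r b'' p := by
        by_contra hn
        exact hno' p hp q' hq' hnS.2 ⟨⟨b, hb, hbp.1, hbq'.2⟩, b'', hb'', hbq'.1, hn⟩
      exact hno' p hp q hq hnS.1 ⟨⟨b'', hb'', e2, hbq.2⟩, b', hb', e1, hbp.2⟩
    let f : V → Prop := fun b => ∃ b' ∈ B, Splits (flip r) A b b' ∧ ∃ z ∈ S,
      (r b z ∧ ¬ r b' z) ∨ (r b' z ∧ ¬ r b z)
    have hf : ∀ x ∈ B, ∀ y ∈ B, Splits (flip r) A x y → f x → f y := by
      rintro x hx y hy hxy ⟨b', hb', hxb', z, hz, hzz⟩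
      obtain ⟨z', hz', hzz'⟩ := hxy.1
      have := star x hx b' hb' y hy hxb' hxy z hz hzz z' hz' (Or.inl hzz')
      exact ⟨x, hx, hxy.symm, z', this, Or.inr hzz'⟩
    obtain ⟨z, hz⟩ := hne
    obtain ⟨z', hz', hz'S⟩ := hne'
    obtain ⟨b, hb, b', hb', hbb, hbz⟩ := edge z (hS hz)
    obtain ⟨d, hd, d', hd', hdd, hdz⟩ := edge z' hz'
    have hfb : f b := ⟨b', hb', hbb, z, hz, Or.inl hbz⟩
    have hfd : f d := by
      rw [← h.eq_of_splits (f := f) (fun x hx y hy hxy =>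
        propext ⟨hf x hx y hy hxy, hf y hy x hx hxy.symm⟩) hb hd]
      exact hfb
    obtain ⟨e, he, hde, y, hy, hyy⟩ := hfd
    exact hz'S (star d hd e he d' hd' hde hdd y hy hyy z' hz' (Or.inl hdz))

/-! ### Layered structures and their decompositions -/

/-- Levels and an order on the set `s` such that all relations between levels that are not
adjacent are forced. -/
structure Layered (ℓ : V → ℕ) (lt : V → V → Prop) (s : Set V) : Prop where
  far : ∀ a ∈ s, ∀ b ∈ s, ℓ a + 2 ≤ ℓ b → lt a b
  near : ∀ a ∈ s, ∀ b ∈ s, lt a b → ℓ a + 1 ≤ ℓ b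

/-- The relation `lt` is `(3+1)`-free on `s`. -/
def FreeOn (lt : V → V → Prop) (s : Set V) : Prop :=
  ∀ a ∈ s, ∀ b ∈ s, ∀ c ∈ s, ∀ d ∈ s, lt a b → lt b c → lt a d ∨ lt d c

/-- `X` can serve as a part with a given letter. -/
def Piece (ℓ : V → ℕ) (lt : V → V → Prop) : Letter → Set V → Prop
  | .c i, X => X.Nonempty ∧ ∀ v ∈ X, ℓ v = i
  | .t i, X => (∀ v ∈ X, ℓ v = i ∨ ℓ v = i + 1) ∧
      TangleRel lt {v ∈ X | ℓ v = i} {v ∈ X | ℓ v = i + 1}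

/-- The relations between `X` and `Y` on adjacent levels are as if `X` comes before `Y`. -/
def Precedes (ℓ : V → ℕ) (lt : V → V → Prop) (X Y : Set V) : Prop :=
  ∀ a ∈ X, ∀ b ∈ Y, (ℓ b = ℓ a + 1 → lt a b) ∧ (ℓ a = ℓ b + 1 → ¬ lt b a)

/-- `L` is a list of parts, with their letters, that is compatible with the structure on `s`. -/
structure IsDecomp (ℓ : V → ℕ) (lt : V → V → Prop) (s : Set V) (L : List (Letter × Set V)) :
    Prop where
  layered : Layered ℓ lt s
  piece : ∀ p ∈ L, Piece ℓ lt p.1 p.2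
  pairwise : L.Pairwise fun p q => Disjoint p.2 q.2 ∧ Precedes ℓ lt p.2 q.2
  cover : ∀ v, v ∈ s ↔ ∃ p ∈ L, v ∈ p.2

theorem Layered.mono {ℓ : V → ℕ} {lt : V → V → Prop} {s s' : Set V} (h : Layered ℓ lt s)
    (hs : s' ⊆ s) : Layered ℓ lt s' :=
  ⟨fun a ha b hb => h.far a (hs ha) b (hs hb), fun a ha b hb => h.near a (hs ha) b (hs hb)⟩

theorem FreeOn.mono {lt : V → V → Prop} {s s' : Set V} (h : FreeOn lt s) (hs : s' ⊆ s) :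
    FreeOn lt s' :=
  fun a ha b hb c hc d hd => h a (hs ha) b (hs hb) c (hs hc) d (hs hd)

theorem isDecomp_nil {ℓ : V → ℕ} {lt : V → V → Prop} {s : Set V} :
    IsDecomp ℓ lt s [] ↔ s = ∅ := by
  constructor
  · intro h
    ext v
    simpa using h.cover v
  · rintro rfl
    exact ⟨⟨by simp, by simp⟩, by simp, by simp, by simp⟩

/-- This recursive form supports both the construction of decompositions and their enumeration. -/
theorem isDecomp_cons {ℓ : V → ℕ} {lt : V → V → Prop} {s : Set V} {x : Letter} {X : Set V}
    {L : List (Letter × Set V)} : IsDecomp ℓ lt s ((x, X) :: L) ↔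
      Layered ℓ lt s ∧ X ⊆ s ∧ Piece ℓ lt x X ∧ Precedes ℓ lt X (s \ X) ∧
        IsDecomp ℓ lt (s \ X) L := by
  constructor
  · intro h
    have hp := List.pairwise_cons.1 h.pairwise
    refine ⟨h.layered, fun v hv => (h.cover v).2 ⟨(x, X), by simp, hv⟩, h.piece (x, X) (by simp), ?_,
      h.layered.mono Set.sdiff_subset, fun p hp => h.piece p (by simp [hp]), hp.2, fun v => ?_⟩
    · rintro a ha b ⟨hb, hbX⟩
      obtain ⟨p, hp', hbp⟩ := (h.cover b).1 hb
      rcases List.mem_cons.1 hp' with rfl | hp'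
      · exact absurd hbp hbX
      · exact (hp.1 p hp').2 a ha b hbp
    · rw [Set.mem_sdiff, h.cover]
      constructor
      · rintro ⟨⟨p, hp', hvp⟩, hv⟩
        rcases List.mem_cons.1 hp' with rfl | hp'
        · exact absurd hvp hv
        · exact ⟨p, hp', hvp⟩
      · rintro ⟨p, hp', hvp⟩
        exact ⟨⟨p, by simp [hp'], hvp⟩, fun hv =>
          Set.disjoint_left.1 (hp.1 p hp').1 hv hvp⟩
  · rintro ⟨hlay, hX, hpiece, hprec, h⟩
    have hsub : ∀ p ∈ L, p.2 ⊆ s \ X := fun p hp v hv => (h.cover v).2 ⟨p, hp, hv⟩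
    refine ⟨hlay, ?_, ?_, fun v => ?_⟩
    · intro p hp
      rcases List.mem_cons.1 hp with rfl | hp
      · exact hpiece
      · exact h.piece p hp
    · refine List.pairwise_cons.2 ⟨fun p hp => ⟨?_, fun a ha b hb => ?_⟩, h.pairwise⟩
      · exact Set.disjoint_left.2 fun v hv hvp => (hsub p hp hvp).2 hv
      · exact hprec a ha b (hsub p hp hb)
    · simp only [List.mem_cons, exists_eq_or_imp, ← h.cover, Set.mem_sdiff]
      constructor
      · intro hv
        by_cases hvX : v ∈ X
        · exact Or.inl hvX
        · exact Or.inr ⟨hv, hvX⟩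
      · rintro (hv | hv)
        · exact hX hv
        · exact hv.1

theorem Piece.lo_hi {ℓ : V → ℕ} {lt : V → V → Prop} {x : Letter} {X : Set V}
    (h : Piece ℓ lt x X) : (∃ v ∈ X, ℓ v = x.lo) ∧ (∃ v ∈ X, ℓ v = x.hi) ∧
      ∀ v ∈ X, x.lo ≤ ℓ v ∧ ℓ v ≤ x.hi := by
  rcases x with i | i
  · obtain ⟨v, hv⟩ := h.1
    exact ⟨⟨v, hv, h.2 v hv⟩, ⟨v, hv, h.2 v hv⟩, fun v hv => by simp [h.2 v hv]⟩
  · obtain ⟨v, hv⟩ := h.2.1.1.nonempty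
    obtain ⟨u, hu⟩ := h.2.2.1.nonempty
    refine ⟨⟨u, hu⟩, ⟨v, hv⟩, fun v hv => ?_⟩
    have := h.1 v hv
    simp only [lo_t, hi_t]
    omega

theorem Piece.nonempty {ℓ : V → ℕ} {lt : V → V → Prop} {x : Letter} {X : Set V}
    (h : Piece ℓ lt x X) : X.Nonempty := by
  obtain ⟨v, hv, -⟩ := h.lo_hi.1
  exact ⟨v, hv⟩

theorem Piece.letter_unique {ℓ : V → ℕ} {lt : V → V → Prop} {x y : Letter} {X : Set V}
    (hx : Piece ℓ lt x X) (hy : Piece ℓ lt y X) : x = y := by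
  obtain ⟨⟨a, ha, ha'⟩, ⟨b, hb, hb'⟩, hX⟩ := hx.lo_hi
  obtain ⟨⟨c, hc, hc'⟩, ⟨d, hd, hd'⟩, hY⟩ := hy.lo_hi
  have h1 := hY a ha
  have h2 := hY b hb
  have h3 := hX c hc
  have h4 := hX d hd
  rcases x with i | i <;> rcases y with j | j <;>
    simp only [lo_c, hi_c, lo_t, hi_t] at * <;> first | omega | (congr 1; omega)

/-! ### Existence of decompositions -/

/-- All bottom vertices of a first part must be `low`: nothing one level down is below them. On the
highest level with a low vertex, one with the most upper neighbours either dominates its level, and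
is a first part by itself, or generates a first tangle. -/
theorem exists_first_piece {ℓ : V → ℕ} {lt : V → V → Prop} {s : Set V}
    (hfree : FreeOn lt s) (hfin : s.Finite) (hne : s.Nonempty) :
    ∃ x X, X ⊆ s ∧ Piece ℓ lt x X ∧ Precedes ℓ lt X (s \ X) := by
  let low : V → Prop := fun v => ∀ u ∈ s, ℓ u + 1 = ℓ v → ¬ lt u v
  have hMne : {v ∈ s | low v}.Nonempty := by
    obtain ⟨v, hv, hmin⟩ := Set.exists_min_image s ℓ hfin hne
    refine ⟨v, hv, fun u hu huv => ?_⟩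
    have := hmin u hu
    omega
  -- By maximality of this level, every vertex above it has a vertex below it one level down.
  obtain ⟨v₀, hv₀, hmax⟩ := Set.exists_max_image {v ∈ s | low v} ℓ (hfin.subset fun _ h => h.1) hMne
  obtain ⟨i, hi⟩ : ∃ i, i = ℓ v₀ := ⟨_, rfl⟩
  have hM : ∀ z ∈ s, i < ℓ z → ∃ u ∈ s, ℓ u + 1 = ℓ z ∧ lt u z := by
    intro z hz hiz
    by_contra! hno
    have := hmax z ⟨hz, hno⟩
    omega
  let U : V → Set V := fun x => {z ∈ s | ℓ z = i + 1 ∧ lt x z}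
  have hUfin : ∀ x, (U x).Finite := fun x => hfin.subset fun _ h => h.1
  obtain ⟨x₀, ⟨hx₀s, hx₀low, hx₀⟩, hx₀max⟩ := Set.exists_max_image {v ∈ s | low v ∧ ℓ v = i}
    (fun x => (U x).ncard) (hfin.subset fun _ h => h.1) ⟨v₀, hv₀.1, hv₀.2, hi.symm⟩
  have hmaxU : ∀ y ∈ s, low y → ℓ y = i → U x₀ ⊆ U y → U y ⊆ U x₀ := by
    intro y hy hylow hyi hsub
    rw [Set.eq_of_subset_of_ncard_le hsub (hx₀max y ⟨hy, hylow, hyi⟩) (hUfin y)]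
  have hnonlow : ∀ y ∈ s, ¬ low y → ℓ y = i → ∀ x ∈ s, low x → ℓ x = i → U y ⊆ U x := by
    intro y hy hylow hyi x hx hxlow hxi z hz
    simp only [low, not_forall, not_not] at hylow
    obtain ⟨u, hu, huy, hlt⟩ := hylow
    rcases hfree u hu y hy z hz.1 x hx hlt hz.2.2 with h | h
    · exact absurd h (hxlow u hu (by omega))
    · exact ⟨hz.1, hz.2.1, h⟩
  -- In this case `x₀` is below the whole next level, since each vertex there is above some vertex
  -- of level `i`. Larger clone sets arise later by merging singletons.
  by_cases hall : ∀ y ∈ s, ℓ y = i → U y ⊆ U x₀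
  · refine ⟨.c i, {x₀}, by simpa using hx₀s, ⟨⟨x₀, rfl⟩, by simpa using hx₀⟩, ?_⟩
    rintro _ rfl b ⟨hb, -⟩
    refine ⟨fun h => ?_, fun h => hx₀low b hb h.symm⟩
    obtain ⟨u, hu, hub, hlt⟩ := hM b hb (by omega)
    exact (hall u hu (by omega) ⟨hb, by omega, hlt⟩).2.2
  push Not at hall
  obtain ⟨y₁, hy₁s, hy₁i, hy₁U⟩ := hall
  -- The bottom is the component of `x₀` among low vertices of level `i` with incomparable upper
  -- neighbourhoods. The top consists of the vertices one level up that are not above all of it.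
  let E : V → V → Prop := fun a b => (b ∈ s ∧ ℓ b = i ∧ low b) ∧ ¬ U a ⊆ U b ∧ ¬ U b ⊆ U a
  let B : Set V := {y | (y ∈ s ∧ ℓ y = i ∧ low y) ∧ Relation.ReflTransGen E x₀ y}
  let A : Set V := {z ∈ s | ℓ z = i + 1 ∧ ∃ b ∈ B, ¬ lt b z}
  have hx₀B : x₀ ∈ B := ⟨⟨hx₀s, hx₀, hx₀low⟩, .refl⟩
  have hy₁low : low y₁ := by
    by_contra h
    exact hy₁U (hnonlow y₁ hy₁s h hy₁i x₀ hx₀s hx₀low hx₀)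
  have hy₁B : y₁ ∈ B := ⟨⟨hy₁s, hy₁i, hy₁low⟩, .single ⟨⟨hy₁s, hy₁i, hy₁low⟩,
    fun h => hy₁U (hmaxU y₁ hy₁s hy₁low hy₁i h), hy₁U⟩⟩
  -- For low `y` the inclusion passes along an edge from `b` to `c`: as `y` is not adjacent to `c`,
  -- its failure at `c` would give `U c ⊆ U y ⊆ U b`.
  have hBfirst : ∀ y ∈ s, ℓ y = i → y ∉ B → ∀ b ∈ B, U y ⊆ U b := by
    intro y hy hyi hyB b hb
    by_cases hylow : low y
    · obtain ⟨-, hreach⟩ := hb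
      induction hreach with
      | refl =>
        by_contra hsub
        exact hyB ⟨⟨hy, hyi, hylow⟩, .single ⟨⟨hy, hyi, hylow⟩,
          fun h => hsub (hmaxU y hy hylow hyi h), hsub⟩⟩
      | tail hbc hE ih =>
        by_contra hsub
        refine hyB ⟨⟨hy, hyi, hylow⟩, (hbc.tail hE).tail ⟨⟨hy, hyi, hylow⟩, fun h => ?_, hsub⟩⟩
        exact hE.2.2 (h.trans ih)
    · exact hnonlow y hy hylow hyi b hb.1.1 hb.1.2.2 hb.1.2.1
  have hE : ∀ x ∈ B, ∀ y ∈ B, ¬ U x ⊆ U y → ¬ U y ⊆ U x → Splits (flip lt) A x y := by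
    intro x hx y hy hxy hyx
    obtain ⟨z, hz, hzy⟩ := Set.not_subset.1 hxy
    obtain ⟨w, hw, hwx⟩ := Set.not_subset.1 hyx
    have hzy' : ¬ lt y z := fun h => hzy ⟨hz.1, hz.2.1, h⟩
    have hwx' : ¬ lt x w := fun h => hwx ⟨hw.1, hw.2.1, h⟩
    exact ⟨⟨z, ⟨hz.1, hz.2.1, y, hy, hzy'⟩, hz.2.2, hzy'⟩,
      w, ⟨hw.1, hw.2.1, x, hx, hwx'⟩, hw.2.2, hwx'⟩
  have hBconn : CutConn (flip lt) A B := by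
    refine ⟨⟨x₀, hx₀B, y₁, hy₁B, fun h => hy₁U (h ▸ subset_rfl)⟩, fun S hS hSne hSne' => ?_⟩
    by_contra! hno
    have hstep : ∀ x ∈ B, ∀ y ∈ B, E x y → (x ∈ S ↔ y ∈ S) := by
      intro x hx y hy hxy
      have hs := hE x hx y hy hxy.2.1 hxy.2.2
      constructor
      · intro hxS
        by_contra hyS
        exact hno x hxS y ⟨hy, hyS⟩ hs
      · intro hyS
        by_contra hxS
        exact hno y hyS x ⟨hx, hxS⟩ hs.symm
    have hall : ∀ y ∈ B, x₀ ∈ S ↔ y ∈ S := by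
      rintro y ⟨-, hy⟩
      induction hy with
      | refl => rfl
      | tail hbc hE ih =>
        rename_i b c
        have hbB : b ∈ B := by
          refine ⟨?_, hbc⟩
          rcases Relation.ReflTransGen.cases_tail hbc with h | ⟨d, -, hd⟩
          · exact h ▸ hx₀B.1
          · exact hd.1
        exact ih.trans (hstep b hbB c ⟨hE.1, hbc.tail hE⟩ hE)
    obtain ⟨a, ha⟩ := hSne
    obtain ⟨b, hb, hbS⟩ := hSne'
    exact hbS ((hall b hb).1 ((hall a (hS ha)).2 ha))
  have hsep : ∀ z ∈ A, (∃ b ∈ B, lt b z) ∧ ∃ b ∈ B, ¬ lt b z := by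
    rintro z ⟨hz, hzi, hzb⟩
    refine ⟨?_, hzb⟩
    obtain ⟨u, hu, huz, hlt⟩ := hM z hz (by omega)
    by_cases huB : u ∈ B
    · exact ⟨u, huB, hlt⟩
    · exact ⟨x₀, hx₀B, (hBfirst u hu (by omega) huB x₀ hx₀B ⟨hz, hzi, hlt⟩).2.2⟩
  have hAconn : CutConn lt B A := hBconn.transfer hsep
  have hBs : {v ∈ B ∪ A | ℓ v = i} = B := by
    ext v
    constructor
    · rintro ⟨hv | hv, hvi⟩
      · exact hv
      · have := hv.2.1
        omega
    · exact fun hv => ⟨Or.inl hv, hv.1.2.1⟩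
  have hAs : {v ∈ B ∪ A | ℓ v = i + 1} = A := by
    ext v
    constructor
    · rintro ⟨hv | hv, hvi⟩
      · have := hv.1.2.1
        omega
      · exact hv
    · exact fun hv => ⟨Or.inr hv, hv.2.1⟩
  refine ⟨.t i, B ∪ A, ?_, ⟨?_, ?_⟩, ?_⟩
  · rintro v (hv | hv)
    · exact hv.1.1
    · exact hv.1
  · rintro v (hv | hv)
    · exact Or.inl hv.1.2.1
    · exact Or.inr hv.2.1
  · rw [hBs, hAs]
    exact ⟨hAconn, hBconn⟩
  · rintro a (ha | ha) b ⟨hb, hbX⟩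
    · refine ⟨fun h => ?_, fun h => ha.1.2.2 b hb h.symm⟩
      by_contra hlt
      exact hbX (Or.inr ⟨hb, by rw [h, ha.1.2.1], a, ha, hlt⟩)
    · obtain ⟨has, hai, b₂, hb₂, hb₂a⟩ := id ha
      refine ⟨fun h => ?_, fun h hlt => ?_⟩
      · by_contra hlt
        -- Freeness puts this `z`, which is on the level of `a`, into `A`. It also carries "below
        -- `b`" along splitting pairs, hence through the connected set `A` from `z` to `a`.
        obtain ⟨z, hz, hzb, hzlt⟩ := hM b hb (by omega)
        have hb₂z : ¬ lt b₂ z := fun h' => by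
          rcases hfree b₂ hb₂.1.1 z hz b hb a has h' hzlt with h'' | h''
          · exact hb₂a h''
          · exact hlt h''
        have hzA : z ∈ A := ⟨hz, by omega, b₂, hb₂, hb₂z⟩
        have hstep : ∀ x ∈ A, ∀ y ∈ A, Splits lt B x y → lt x b → lt y b := by
          rintro x hx y hy ⟨⟨d, hd, hdx, hdy⟩, -⟩ hxb
          rcases hfree d hd.1.1 x hx.1 b hb y hy.1 hdx hxb with h'' | h''
          · exact absurd h'' hdy
          · exact h''
        have := hAconn.eq_of_splits (f := fun x => lt x b) (fun x hx y hy hxy =>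
          propext ⟨hstep x hx y hy hxy, hstep y hy x hx hxy.symm⟩) hzA ha
        exact hlt (this ▸ hzlt)
      · have hbB : b ∉ B := fun h => hbX (Or.inl h)
        exact hb₂a (hBfirst b hb (by omega) hbB b₂ hb₂ ⟨has, hai, hlt⟩).2.2

/-- Parts without vertices on adjacent levels do not constrain each other's position. -/
theorem IsDecomp.swap {ℓ : V → ℕ} {lt : V → V → Prop} {s : Set V} {x y : Letter} {X Y : Set V}
    {L : List (Letter × Set V)} (hxy : x.hi + 2 ≤ y.lo)
    (h : IsDecomp ℓ lt s ((x, X) :: (y, Y) :: L)) : IsDecomp ℓ lt s ((y, Y) :: (x, X) :: L) := by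
  have hp := List.pairwise_cons.1 h.pairwise
  have hp' := List.pairwise_cons.1 hp.2
  refine ⟨h.layered, fun p hp => h.piece p ?_, ?_, fun v => ?_⟩
  · simp only [List.mem_cons] at hp ⊢
    tauto
  · refine List.pairwise_cons.2 ⟨fun p hpL => ?_, List.pairwise_cons.2 ⟨fun p hpL =>
      hp.1 p (by simp [hpL]), hp'.2⟩⟩
    rcases List.mem_cons.1 hpL with rfl | hpL
    · refine ⟨(hp.1 (y, Y) (by simp)).1.symm, fun a ha b hb => ?_⟩
      have h1 := (h.piece (y, Y) (by simp)).lo_hi.2.2 a ha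
      have h2 := (h.piece (x, X) (by simp)).lo_hi.2.2 b hb
      have h3 := x.lo_le_hi
      dsimp only at h1 h2
      constructor <;> intro <;> omega
    · exact hp'.1 p hpL
  · rw [h.cover]
    simp only [List.mem_cons, exists_eq_or_imp]
    tauto

theorem IsDecomp.merge {ℓ : V → ℕ} {lt : V → V → Prop} {s : Set V} {i : ℕ} {X Y : Set V}
    {L : List (Letter × Set V)} (h : IsDecomp ℓ lt s ((.c i, X) :: (.c i, Y) :: L)) :
    IsDecomp ℓ lt s ((.c i, X ∪ Y) :: L) := by
  obtain ⟨hlay, hX, hpX, hprX, h'⟩ := isDecomp_cons.1 h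
  obtain ⟨-, hY, hpY, hprY, h''⟩ := isDecomp_cons.1 h'
  refine isDecomp_cons.2 ⟨hlay, Set.union_subset hX (hY.trans Set.sdiff_subset),
    ⟨hpX.1.mono Set.subset_union_left, ?_⟩, ?_, by rwa [← Set.sdiff_sdiff]⟩
  · rintro v (hv | hv)
    · exact hpX.2 v hv
    · exact hpY.2 v hv
  · rintro a (ha | ha) b ⟨hb, hbX⟩
    · exact hprX a ha b ⟨hb, fun h => hbX (Or.inl h)⟩
    · exact hprY a ha b ⟨⟨hb, fun h => hbX (Or.inl h)⟩, fun h => hbX (Or.inr h)⟩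

/-- An insertion sort: the new part moves behind all parts far above it and is merged if it then
meets an equal clone letter. The claim about the head keeps the recursive call linked to the letter
in front of it. -/
theorem IsDecomp.insert {ℓ : V → ℕ} {lt : V → V → Prop} {x : Letter} {X : Set V} :
    ∀ {L : List (Letter × Set V)} {s : Set V}, IsDecomp ℓ lt s ((x, X) :: L) →
      Canonical (L.map Prod.fst) → ∃ L', IsDecomp ℓ lt s L' ∧ Canonical (L'.map Prod.fst) ∧
        ∀ y ∈ (L'.map Prod.fst).head?, y = x ∨ y ∈ (L.map Prod.fst).head?
  | [], s, h, _ => ⟨_, h, by simp [Canonical], by simp⟩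
  | (y, Y) :: L, s, h, hc => by
    by_cases hxy : x.hi + 2 ≤ y.lo
    · obtain ⟨hlay, hY, hpY, hprY, h'⟩ := isDecomp_cons.1 (h.swap hxy)
      obtain ⟨L', hL', hc', hhead⟩ := h'.insert hc.tail
      refine ⟨(y, Y) :: L', isDecomp_cons.2 ⟨hlay, hY, hpY, hprY, hL'⟩, ?_, by simp⟩
      refine List.isChain_cons.2 ⟨fun z hz => ?_, hc'⟩
      rcases hhead z hz with rfl | hz
      · have h1 := z.lo_le_hi
        have h2 := y.lo_le_hi
        refine ⟨?_, fun h => ?_⟩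
        · dsimp only
          omega
        · have := congrArg Letter.lo h.1
          dsimp only at this
          omega
      · exact (List.isChain_cons.1 hc).1 z hz
    · by_cases hxy' : x = y ∧ x.isC = true
      · obtain ⟨rfl, hx⟩ := hxy'
        rcases x with i | i
        · exact ⟨_, h.merge, hc, by simp⟩
        · simp at hx
      · refine ⟨_, h, List.isChain_cons.2 ⟨?_, hc⟩, by simp⟩
        simp only [List.map_cons, List.head?_cons, Option.mem_def, Option.some.injEq, forall_eq']
        exact ⟨by omega, hxy'⟩

theorem exists_isDecomp {ℓ : V → ℕ} {lt : V → V → Prop} {s : Set V} (hfin : s.Finite)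
    (hlay : Layered ℓ lt s) (hfree : FreeOn lt s) :
    ∃ L, IsDecomp ℓ lt s L ∧ Canonical (L.map Prod.fst) := by
  induction hn : s.ncard using Nat.strong_induction_on generalizing s with
  | _ n ih =>
    rcases s.eq_empty_or_nonempty with rfl | hne
    · exact ⟨[], isDecomp_nil.2 rfl, by simp [Canonical]⟩
    · obtain ⟨x, X, hX, hp, hpr⟩ := exists_first_piece (ℓ := ℓ) hfree hfin hne
      have hlt : (s \ X).ncard < s.ncard := Set.ncard_lt_ncard
        (hX.sdiff_ssubset_of_nonempty hp.nonempty) hfin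
      obtain ⟨L, hL, hc⟩ := ih _ (hn ▸ hlt) (hfin.subset Set.sdiff_subset)
        (hlay.mono Set.sdiff_subset) (hfree.mono Set.sdiff_subset) rfl
      obtain ⟨L', hL', hc', -⟩ := (isDecomp_cons.2 ⟨hlay, hX, hp, hpr, hL⟩).insert hc
      exact ⟨L', hL', hc'⟩

end Layered

section Layered

variable {V : Type}

/-! ### Uniqueness of decompositions -/

/-- Otherwise, reading backwards from position `k`, the link condition makes every letter lie at
least two levels above `i`, down to position `j`, where the letter is `c i` itself. -/
theorem Canonical.exists_between {w : List Letter} (hw : Canonical w) {i j k : ℕ} (hjk : j < k)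
    (hk : k < w.length) (hwj : w[j] = c i) (hwk : w[k] = c i) :
    ∃ m, ∃ h : m < k, j < m ∧ w[m] ≠ c i ∧ ¬ Indep (c i) w[m] := by
  by_contra! hno
  have hlink := List.isChain_iff_getElem.1 hw
  have key : ∀ d m, ∀ h : m + d + 1 = k, j ≤ m → i + 2 ≤ (w[m]'(by omega)).lo := by
    intro d
    induction d with
    | zero =>
      rintro m rfl hjm
      have h2 := hlink m (by omega)
      simp only [Nat.add_zero] at hwk
      rw [hwk] at h2
      have hmi : w[m] ≠ c i := fun h => h2.2 (by simp [h])
      have hjm' : j < m := lt_of_le_of_ne hjm (by rintro rfl; exact hmi hwj)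
      have h4 := hno m (by omega) hjm' hmi
      have h5 := w[m].lo_le_hi
      have h6 := h2.1
      unfold Indep at h4
      simp only [hi_c, lo_c] at h4 h6
      omega
    | succ d ih =>
      intro m h hjm
      have h1 := ih (m + 1) (by omega) (by omega)
      have h3 := (hlink m (by omega)).1
      have hmi : w[m] ≠ c i := fun h => by
        rw [h, hi_c] at h3
        omega
      have hjm' : j < m := lt_of_le_of_ne hjm (by rintro rfl; exact hmi hwj)
      have h4 := hno m (by omega) hjm' hmi
      have h5 := w[m].lo_le_hi
      unfold Indep at h4
      simp only [hi_c, lo_c] at h4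
      omega
  have := key (k - j - 1) j (by omega) le_rfl
  rw [hwj] at this
  simp at this

/-- The index of the part that contains `v`. -/
def pos (L : List (Letter × Set V)) (v : V) : ℕ := L.findIdx fun p => decide (v ∈ p.2)

namespace IsDecomp

variable {ℓ : V → ℕ} {lt : V → V → Prop} {s : Set V} {L L' : List (Letter × Set V)}

theorem pos_lt (h : IsDecomp ℓ lt s L) {v : V} (hv : v ∈ s) : pos L v < L.length := by
  obtain ⟨p, hp, hvp⟩ := (h.cover v).1 hv
  exact List.findIdx_lt_length_of_exists ⟨p, hp, by simpa using hvp⟩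

theorem mem_pos (h : IsDecomp ℓ lt s L) {v : V} (hv : v ∈ s) :
    v ∈ (L[pos L v]'(h.pos_lt hv)).2 := by
  have := List.findIdx_getElem (w := h.pos_lt hv)
  exact of_decide_eq_true this

theorem pos_eq (h : IsDecomp ℓ lt s L) {v : V} {k : ℕ} (hk : k < L.length) (hv : v ∈ L[k].2) :
    pos L v = k := by
  have hvs : v ∈ s := (h.cover v).2 ⟨_, List.getElem_mem hk, hv⟩
  have hp := List.pairwise_iff_getElem.1 h.pairwise
  rcases lt_trichotomy (pos L v) k with hlt | heq | hlt
  · exact absurd hv (Set.disjoint_left.1 (hp _ _ (h.pos_lt hvs) hk hlt).1 (h.mem_pos hvs))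
  · exact heq
  · exact absurd (h.mem_pos hvs) (Set.disjoint_left.1 (hp _ _ hk (h.pos_lt hvs) hlt).1 hv)

theorem mem_iff_pos (h : IsDecomp ℓ lt s L) {v : V} (hv : v ∈ s) {k : ℕ} (hk : k < L.length) :
    v ∈ L[k].2 ↔ pos L v = k := by
  refine ⟨h.pos_eq hk, ?_⟩
  rintro rfl
  exact h.mem_pos hv

theorem subset (h : IsDecomp ℓ lt s L) {k : ℕ} (hk : k < L.length) : L[k].2 ⊆ s :=
  fun v hv => (h.cover v).2 ⟨_, List.getElem_mem hk, hv⟩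

theorem precedes (h : IsDecomp ℓ lt s L) {a b : V} (ha : a ∈ s) (hb : b ∈ s)
    (hab : pos L a < pos L b) : (ℓ b = ℓ a + 1 → lt a b) ∧ (ℓ a = ℓ b + 1 → ¬ lt b a) :=
  (List.pairwise_iff_getElem.1 h.pairwise _ _ (h.pos_lt ha) (h.pos_lt hb) hab).2 a (h.mem_pos ha) b
    (h.mem_pos hb)

theorem pos_le_of_lt (h : IsDecomp ℓ lt s L) {a b : V} (ha : a ∈ s) (hb : b ∈ s)
    (hℓ : ℓ b = ℓ a + 1) (hab : lt a b) : pos L a ≤ pos L b := by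
  by_contra! hlt
  exact (h.precedes hb ha hlt).2 hℓ hab

theorem pos_le_of_not_lt (h : IsDecomp ℓ lt s L) {a b : V} (ha : a ∈ s) (hb : b ∈ s)
    (hℓ : ℓ b = ℓ a + 1) (hab : ¬ lt a b) : pos L b ≤ pos L a := by
  by_contra! hlt
  exact hab ((h.precedes ha hb hlt).1 hℓ)

theorem piece_pos (h : IsDecomp ℓ lt s L) {v : V} (hv : v ∈ s) :
    Piece ℓ lt (L[pos L v]'(h.pos_lt hv)).1 (L[pos L v]'(h.pos_lt hv)).2 :=
  h.piece _ (List.getElem_mem _)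

/-- A violation by $a<b<c$ and $d$ gives positions $a\le b\le c\le d\le a$. Then $a$ and $c$ share a
part although they are two levels apart. -/
theorem freeOn (h : IsDecomp ℓ lt s L) : FreeOn lt s := by
  intro a ha b hb c hc d hd hab hbc
  by_contra! hno
  have h1 := h.layered.near a ha b hb hab
  have h2 := h.layered.near b hb c hc hbc
  have h3 : ℓ d ≤ ℓ a + 1 := by
    by_contra! h3
    exact hno.1 (h.layered.far a ha d hd (by omega))
  have h4 : ℓ c ≤ ℓ d + 1 := by
    by_contra! h4
    exact hno.2 (h.layered.far d hd c hc (by omega))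
  have p1 := h.pos_le_of_lt ha hb (by omega) hab
  have p2 := h.pos_le_of_lt hb hc (by omega) hbc
  have p3 := h.pos_le_of_not_lt ha hd (by omega) hno.1
  have p4 := h.pos_le_of_not_lt hd hc (by omega) hno.2
  have hpa := (h.piece_pos ha).lo_hi.2.2
  have q1 := hpa a (h.mem_pos ha)
  have q2 := hpa c ((h.mem_iff_pos hc (h.pos_lt ha)).2 (by omega))
  have q3 := (L[pos L a]'(h.pos_lt ha)).1.hi_le_lo
  omega

/-- The squeeze behind uniqueness: among vertices of one level, a vertex that distinguishes two of
them from below sits between their parts in every decomposition. -/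
theorem below (h : IsDecomp ℓ lt s L) {b x y : V} (hb : b ∈ s) (hx : x ∈ s) (hy : y ∈ s)
    (hbx : lt b x) (hby : ¬ lt b y) : ℓ y ≤ ℓ x ∧
      (ℓ x = ℓ y → ℓ x = ℓ b + 1 ∧ pos L y ≤ pos L b ∧ pos L b ≤ pos L x) := by
  have h1 := h.layered.near b hb x hx hbx
  have h2 : ℓ y ≤ ℓ b + 1 := by
    by_contra! h3
    exact hby (h.layered.far b hb y hy (by omega))
  refine ⟨by omega, fun hxy => ⟨by omega, ?_, ?_⟩⟩
  · exact h.pos_le_of_not_lt hb hy (by omega) hby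
  · exact h.pos_le_of_lt hb hx (by omega) hbx

theorem above (h : IsDecomp ℓ lt s L) {b x y : V} (hb : b ∈ s) (hx : x ∈ s) (hy : y ∈ s)
    (hbx : lt x b) (hby : ¬ lt y b) : ℓ x ≤ ℓ y ∧
      (ℓ x = ℓ y → ℓ b = ℓ x + 1 ∧ pos L x ≤ pos L b ∧ pos L b ≤ pos L y) := by
  have h1 := h.layered.near x hx b hb hbx
  have h2 : ℓ b ≤ ℓ y + 1 := by
    by_contra! h3
    exact hby (h.layered.far y hy b hb (by omega))
  refine ⟨by omega, fun hxy => ⟨by omega, ?_, ?_⟩⟩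
  · exact h.pos_le_of_lt hx hb (by omega) hbx
  · exact h.pos_le_of_not_lt hy hb (by omega) hby

theorem splits_below (h : IsDecomp ℓ lt s L) {x y : V} (hx : x ∈ s) (hy : y ∈ s)
    (hxy : Splits lt s x y) : ℓ x = ℓ y ∧ pos L x = pos L y := by
  obtain ⟨⟨b, hb, hbx, hby⟩, d, hd, hdy, hdx⟩ := hxy
  have h1 := h.below hb hx hy hbx hby
  have h2 := h.below hd hy hx hdy hdx
  have h3 : ℓ x = ℓ y := by omega
  have h4 := h1.2 h3
  have h5 := h2.2 h3.symm
  exact ⟨h3, by omega⟩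

theorem splits_above (h : IsDecomp ℓ lt s L) {x y : V} (hx : x ∈ s) (hy : y ∈ s)
    (hxy : Splits (flip lt) s x y) : ℓ x = ℓ y ∧ pos L x = pos L y := by
  obtain ⟨⟨b, hb, hbx, hby⟩, d, hd, hdy, hdx⟩ := hxy
  have h1 := h.above hb hx hy hbx hby
  have h2 := h.above hd hy hx hdy hdx
  have h3 : ℓ x = ℓ y := by omega
  have h4 := h1.2 h3
  have h5 := h2.2 h3.symm
  exact ⟨h3, by omega⟩

/-- A vertex of a tangle is split from some neighbour, and its clone is split from the same
neighbour, so all three share a part. For two clone parts with equal letters,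
`Canonical.exists_between` supplies a part between them with a vertex on an adjacent level, which
would be related differently to the two. -/
theorem pos_eq_of_clones (h : IsDecomp ℓ lt s L) (hc : Canonical (L.map Prod.fst)) {x y : V}
    (hx : x ∈ s) (hy : y ∈ s) (hxy : ℓ x = ℓ y)
    (hdown : ∀ z ∈ s, lt z x ↔ lt z y) (hup : ∀ z ∈ s, lt x z ↔ lt y z) :
    pos L x = pos L y := by
  have tangle : ∀ u ∈ s, ∀ v ∈ s, (∀ z ∈ s, lt z u ↔ lt z v) → (∀ z ∈ s, lt u z ↔ lt v z) →
      ∀ i, ∀ hu : u ∈ s, (L[pos L u]'(h.pos_lt hu)).1 = .t i → pos L u = pos L v := by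
    intro u _ v hv hd hu i hus hi
    have hp := h.piece_pos hus
    have hm := h.mem_pos hus
    have hsub := h.subset (h.pos_lt hus)
    have hpos := fun a (ha : a ∈ s) => h.mem_iff_pos ha (h.pos_lt hus)
    generalize L[pos L u]'(h.pos_lt hus) = p at *
    obtain ⟨x, X⟩ := p
    dsimp only at hi
    subst hi
    rcases hp.1 u hm with hui | hui
    · obtain ⟨a, ⟨ha, -⟩, hua⟩ := hp.2.2.exists_splits ⟨hm, hui⟩
      have hua' : Splits (flip lt) s u a := hua.mono fun z hz => hsub hz.1
      have hva : Splits (flip lt) s v a := by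
        obtain ⟨⟨b, hb, h1⟩, d, hd, h2⟩ := hua'
        simp only [flip] at h1 h2
        rw [hu b hb] at h1
        rw [hu d hd] at h2
        exact ⟨⟨b, hb, h1⟩, d, hd, h2⟩
      rw [(h.splits_above hv (hsub ha) hva).2, (h.splits_above hus (hsub ha) hua').2]
    · obtain ⟨a, ⟨ha, -⟩, hua⟩ := hp.2.1.exists_splits ⟨hm, hui⟩
      have hua' : Splits lt s u a := hua.mono fun z hz => hsub hz.1
      have hva : Splits lt s v a := by
        obtain ⟨⟨b, hb, h1⟩, d, hd', h2⟩ := hua'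
        rw [hd b hb] at h1
        rw [hd d hd'] at h2
        exact ⟨⟨b, hb, h1⟩, d, hd', h2⟩
      rw [(h.splits_below hv (hsub ha) hva).2, (h.splits_below hus (hsub ha) hua').2]
  have main : ∀ u ∈ s, ∀ v ∈ s, ℓ u = ℓ v → (∀ z ∈ s, lt z u ↔ lt z v) →
      (∀ z ∈ s, lt u z ↔ lt v z) → ¬ pos L u < pos L v := by
    intro u hu v hv huv hd hup hlt
    rcases hxu : (L[pos L u]'(h.pos_lt hu)).1 with i | i
    swap
    · exact hlt.ne (tangle u hu v hv hd hup i hu hxu)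
    rcases hxv : (L[pos L v]'(h.pos_lt hv)).1 with j | j
    swap
    · exact hlt.ne' (tangle v hv u hu (fun z hz => (hd z hz).symm) (fun z hz => (hup z hz).symm)
        j hv hxv)
    have hui := (h.piece_pos hu).lo_hi.2.2 u (h.mem_pos hu)
    have hvj := (h.piece_pos hv).lo_hi.2.2 v (h.mem_pos hv)
    rw [hxu] at hui
    rw [hxv] at hvj
    simp only [lo_c, hi_c] at hui hvj
    obtain rfl : i = j := by omega
    obtain ⟨m, hm, hum, hne, hdep⟩ := hc.exists_between hlt
      (by simpa using h.pos_lt hv) (by simpa using hxu) (by simpa using hxv)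
    have hmL : m < L.length := hm.trans (h.pos_lt hv)
    simp only [List.getElem_map] at hne hdep
    have hp := h.piece _ (List.getElem_mem hmL)
    obtain ⟨z, hz, hzl⟩ : ∃ z ∈ L[m].2, ℓ z = ℓ u + 1 ∨ ℓ u = ℓ z + 1 := by
      obtain ⟨⟨a, ha, hal⟩, ⟨b, hb, hbl⟩, -⟩ := hp.lo_hi
      have h1 : ℓ a = ℓ u + 1 ∨ ℓ u = ℓ a + 1 ∨ ℓ b = ℓ u + 1 ∨ ℓ u = ℓ b + 1 := by
        unfold Indep at hdep
        rcases hL : L[m].1 with k | k <;> rw [hL] at hne hdep hal hbl <;>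
          simp only [lo_c, hi_c, lo_t, hi_t, ne_eq, Letter.c.injEq, not_or] at hne hdep hal hbl <;>
          omega
      rcases h1 with h1 | h1 | h1 | h1
      · exact ⟨a, ha, Or.inl h1⟩
      · exact ⟨a, ha, Or.inr h1⟩
      · exact ⟨b, hb, Or.inl h1⟩
      · exact ⟨b, hb, Or.inr h1⟩
    have hzs := h.subset hmL hz
    have hzm := h.pos_eq hmL hz
    have h1 := h.precedes hu hzs (by omega)
    have h2 := h.precedes hzs hv (by omega)
    rcases hzl with hzl | hzl
    · exact h2.2 (by omega) ((hup z hzs).1 (h1.1 hzl))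
    · exact h1.2 hzl ((hd z hzs).2 (h2.1 (by omega)))
  have m1 := main x hx y hy hxy hdown hup
  have m2 := main y hy x hx hxy.symm (fun z hz => (hdown z hz).symm) fun z hz => (hup z hz).symm
  omega

/-- A vertex that tells `x` and `y` apart would be squeezed into their part, but it is on another
level. -/
theorem clones_of_pos_eq (h : IsDecomp ℓ lt s L) {x y : V} (hx : x ∈ s) (hy : y ∈ s)
    (hxy : pos L x = pos L y) {i : ℕ} (hi : (L[pos L x]'(h.pos_lt hx)).1 = .c i) :
    ℓ x = ℓ y ∧ (∀ z ∈ s, lt z x → lt z y) ∧ ∀ z ∈ s, lt x z → lt y z := by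
  have hlev : ∀ v ∈ s, pos L v = pos L x → ℓ v = i := by
    intro v hv hvx
    have := (h.piece_pos hx).lo_hi.2.2 v ((h.mem_iff_pos hv (h.pos_lt hx)).2 hvx)
    rw [hi, lo_c, hi_c] at this
    omega
  have hxi := hlev x hx rfl
  have hyi := hlev y hy hxy.symm
  have hneq : ∀ z ∈ s, ℓ z ≠ i → pos L z ≠ pos L x := fun z hz hzi h' => hzi (hlev z hz h')
  refine ⟨by omega, fun z hz hzx => ?_, fun z hz hxz => ?_⟩
  · have h1 := h.layered.near z hz x hx hzx
    by_contra hzy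
    have h2 := (h.below hz hx hy hzx hzy).2 (by omega)
    exact hneq z hz (by omega) (by omega)
  · have h1 := h.layered.near x hx z hz hxz
    by_contra hyz
    have h2 := (h.above hz hx hy hxz hyz).2 (by omega)
    exact hneq z hz (by omega) (by omega)

/-- Clone parts stay together by `pos_eq_of_clones`. The top and the bottom of a tangle each stay
together by connectivity, and a bottom vertex that distinguishes two top vertices ties them to each
other. -/
theorem pos_eq_of_pos_eq (h : IsDecomp ℓ lt s L) (h' : IsDecomp ℓ lt s L')
    (hc' : Canonical (L'.map Prod.fst)) {x y : V} (hx : x ∈ s) (hy : y ∈ s)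
    (hxy : pos L x = pos L y) : pos L' x = pos L' y := by
  have hk := h.pos_lt hx
  rcases hi : (L[pos L x]'hk).1 with i | i
  · obtain ⟨hℓ, hd, hu⟩ := h.clones_of_pos_eq hx hy hxy hi
    obtain ⟨-, hd', hu'⟩ := h.clones_of_pos_eq hy hx hxy.symm (by simpa only [← hxy] using hi)
    exact h'.pos_eq_of_clones hc' hx hy hℓ (fun z hz => ⟨hd z hz, hd' z hz⟩)
      fun z hz => ⟨hu z hz, hu' z hz⟩
  · have hp := h.piece_pos hx
    have hmx := h.mem_pos hx
    have hmy := (h.mem_iff_pos hy hk).2 hxy.symm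
    have hsub := h.subset hk
    generalize L[pos L x]'hk = p at *
    obtain ⟨l, X⟩ := p
    dsimp only at hi
    subst hi
    have htop : ∀ u ∈ {v ∈ X | ℓ v = i + 1}, ∀ v ∈ {v ∈ X | ℓ v = i + 1},
        pos L' u = pos L' v := fun u hu v hv =>
      hp.2.1.eq_of_splits (fun a ha b hb hab => (h'.splits_below (hsub ha.1) (hsub hb.1)
        (hab.mono fun z hz => hsub hz.1)).2) hu hv
    have hbot : ∀ u ∈ {v ∈ X | ℓ v = i}, ∀ v ∈ {v ∈ X | ℓ v = i},
        pos L' u = pos L' v := fun u hu v hv =>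
      hp.2.2.eq_of_splits (fun a ha b hb hab => (h'.splits_above (hsub ha.1) (hsub hb.1)
        (hab.mono fun z hz => hsub hz.1)).2) hu hv
    obtain ⟨a, ha⟩ := hp.2.1.1.nonempty
    obtain ⟨a', ha', ⟨b, hb, hba, hba'⟩, -⟩ := hp.2.1.exists_splits ha
    have h1 := htop a ha a' ha'
    have h2 := (h'.below (hsub hb.1) (hsub ha.1) (hsub ha'.1) hba hba').2
      (ha.2.trans ha'.2.symm)
    have hall : ∀ u ∈ X, pos L' u = pos L' a := by
      intro u hu
      rcases hp.1 u hu with hui | hui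
      · have := hbot u ⟨hu, hui⟩ b hb
        omega
      · exact htop u ⟨hu, hui⟩ a ha
    rw [hall x hmx, hall y hmy]

theorem nodup (h : IsDecomp ℓ lt s L) : L.Nodup := by
  refine h.pairwise.imp_of_mem fun {p q} hp _ hpq => ?_
  rintro rfl
  obtain ⟨v, hv⟩ := (h.piece p hp).nonempty
  exact Set.disjoint_left.1 hpq.1 hv hv

theorem mem_of_mem (h : IsDecomp ℓ lt s L) (h' : IsDecomp ℓ lt s L')
    (hc : Canonical (L.map Prod.fst)) (hc' : Canonical (L'.map Prod.fst)) {p : Letter × Set V}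
    (hp : p ∈ L) : p ∈ L' := by
  obtain ⟨k, hk, rfl⟩ := List.getElem_of_mem hp
  have hpc := h.piece _ hp
  obtain ⟨v, hv⟩ := hpc.nonempty
  have hvs := h.subset hk hv
  have hvk := h.pos_eq hk hv
  have hX : L[k].2 = (L'[pos L' v]'(h'.pos_lt hvs)).2 := by
    ext u
    constructor
    · intro hu
      have hus := h.subset hk hu
      exact (h'.mem_iff_pos hus _).2
        (h.pos_eq_of_pos_eq h' hc' hus hvs ((h.pos_eq hk hu).trans hvk.symm))
    · intro hu
      have hus := h'.subset _ hu
      exact (h.mem_iff_pos hus hk).2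
        ((h'.pos_eq_of_pos_eq h hc hus hvs (h'.pos_eq (h'.pos_lt hvs) hu)).trans hvk)
  have hpc' := h'.piece_pos hvs
  rw [← hX] at hpc'
  have : L[k] = L'[pos L' v]'(h'.pos_lt hvs) := Prod.ext (hpc.letter_unique hpc') hX
  rw [this]
  exact List.getElem_mem _

/-- Dependent letters, other than two equal $c$'s, occupy adjacent levels, and a relation between
adjacent levels reveals which part comes first. -/
theorem order_forced (h : IsDecomp ℓ lt s L) (h' : IsDecomp ℓ lt s L') {j k j' k' : ℕ}
    (hj : j < L.length) (hk : k < L.length) (hj' : j' < L'.length) (hk' : k' < L'.length)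
    (hjj : L[j] = L'[j']) (hkk : L[k] = L'[k']) (hjk : j < k)
    (hdep : ¬ Indep L[j].1 L[k].1) (hne : ¬ (L[j].1 = L[k].1 ∧ L[j].1.isC = true)) : j' < k' := by
  obtain ⟨⟨a, ha, hal⟩, ⟨b, hb, hbl⟩, -⟩ := (h.piece _ (List.getElem_mem hj)).lo_hi
  obtain ⟨⟨d, hd, hdl⟩, ⟨e, he, hel⟩, -⟩ := (h.piece _ (List.getElem_mem hk)).lo_hi
  have main : ∀ u ∈ L[j].2, ∀ v ∈ L[k].2, ℓ v = ℓ u + 1 ∨ ℓ u = ℓ v + 1 → j' < k' := by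
    intro u hu v hv huv
    have hus := h.subset hj hu
    have hvs := h.subset hk hv
    have hju := h.pos_eq hj hu
    have hkv := h.pos_eq hk hv
    have hp := h.precedes hus hvs (by omega)
    have hju' := h'.pos_eq hj' (hjj ▸ hu)
    have hkv' := h'.pos_eq hk' (hkk ▸ hv)
    have hle : j' ≤ k' := by
      rw [← hju', ← hkv']
      rcases huv with huv | huv
      · exact h'.pos_le_of_lt hus hvs huv (hp.1 huv)
      · exact h'.pos_le_of_not_lt hvs hus huv (hp.2 huv)
    refine lt_of_le_of_ne hle ?_
    rintro rfl
    exact hjk.ne ((h.nodup.getElem_inj_iff).1 (hjj.trans hkk.symm))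
  have hcases : (ℓ d = ℓ a + 1 ∨ ℓ a = ℓ d + 1) ∨ (ℓ e = ℓ a + 1 ∨ ℓ a = ℓ e + 1) ∨
      (ℓ d = ℓ b + 1 ∨ ℓ b = ℓ d + 1) ∨ (ℓ e = ℓ b + 1 ∨ ℓ b = ℓ e + 1) := by
    unfold Indep at hdep
    rw [hal, hbl, hdl, hel]
    rcases hx : L[j].1 with m | m <;> rcases hy : L[k].1 with n | n <;>
      simp only [hx, hy, lo_c, hi_c, lo_t, hi_t, Letter.c.injEq, isC_c, and_true, not_or] at *
        <;> omega
  rcases hcases with hh | hh | hh | hh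
  · exact main a ha d hd hh
  · exact main a ha e he hh
  · exact main b hb d hd hh
  · exact main b hb e he hh

end IsDecomp

theorem pair_sublist_iff {α : Type*} {a b : α} {L : List α} : [a, b].Sublist L ↔
    ∃ j k, ∃ h : j < k, ∃ hk : k < L.length, L[j] = a ∧ L[k] = b := by
  constructor
  · intro h
    have key : L.Pairwise fun a b => ∃ j k, ∃ h : j < k, ∃ hk : k < L.length,
        L[j] = a ∧ L[k] = b :=
      List.pairwise_iff_getElem.2 fun i j _ hj hij => ⟨i, j, hij, hj, rfl, rfl⟩
    exact List.pairwise_iff_forall_sublist.1 key h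
  · rintro ⟨j, k, h, hk, rfl, rfl⟩
    have key : L.Pairwise fun a b => [a, b].Sublist L := List.pairwise_iff_forall_sublist.2 id
    exact List.pairwise_iff_getElem.1 key j k _ hk h

/-- Only one list has to be canonical. Two equal $c$'s are ordered through a dependent part between
them, so the lemma also applies to arbitrary compatible listings. -/
theorem IsDecomp.filterEq {ℓ : V → ℕ} {lt : V → V → Prop} {s : Set V}
    {L L' : List (Letter × Set V)} (h : IsDecomp ℓ lt s L) (h' : IsDecomp ℓ lt s L')
    (hc : Canonical (L.map Prod.fst)) (hmem : ∀ p, p ∈ L ↔ p ∈ L') :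
    FilterEq Prod.fst L L' := by
  refine filterEq_of_perm h.nodup ((List.perm_ext_iff_of_nodup h.nodup h'.nodup).2 hmem) ?_
  intro p q hpq hdep hsub
  obtain ⟨j, k, hjk, hk, rfl, rfl⟩ := pair_sublist_iff.1 hsub
  have hj := hjk.trans hk
  obtain ⟨j', hj', hjj⟩ := List.getElem_of_mem ((hmem L[j]).1 (List.getElem_mem _))
  obtain ⟨k', hk', hkk⟩ := List.getElem_of_mem ((hmem L[k]).1 (List.getElem_mem _))
  refine pair_sublist_iff.2 ⟨j', k', ?_, hk', hjj, hkk⟩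
  by_cases hne : L[j].1 = L[k].1 ∧ L[j].1.isC = true
  · obtain ⟨i, hi⟩ : ∃ i, L[j].1 = .c i := by
      rcases hx : L[j].1 with i | i
      · exact ⟨i, rfl⟩
      · simp [hx] at hne
    obtain ⟨m, hm, hjm, hmi, hdm⟩ := hc.exists_between hjk (by simpa using hk) (by simpa using hi)
      (by simpa using hne.1 ▸ hi)
    simp only [List.getElem_map] at hmi hdm
    obtain ⟨m', hm', hmm⟩ := List.getElem_of_mem ((hmem L[m]).1 (List.getElem_mem _))
    have h1 := h.order_forced h' hj (hm.trans hk) hj' hm' hjj.symm hmm.symm hjm (hi ▸ hdm)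
      (fun hh => hmi (hh.1.symm.trans hi))
    have h2 := h.order_forced h' (hm.trans hk) hk hm' hk' hmm.symm hkk.symm hm
      (by rw [← hne.1, hi]; exact fun h => hdm h.symm)
      (fun hh => hmi (hh.1.trans (hne.1 ▸ hi)))
    exact h1.trans h2
  · exact h.order_forced h' hj hk hj' hk' hjj.symm hkk.symm hjk hdep hne

theorem IsDecomp.unique {ℓ : V → ℕ} {lt : V → V → Prop} {s : Set V}
    {L L' : List (Letter × Set V)} (h : IsDecomp ℓ lt s L) (h' : IsDecomp ℓ lt s L')
    (hc : Canonical (L.map Prod.fst)) (hc' : Canonical (L'.map Prod.fst)) : L = L' :=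
  (h.filterEq h' hc fun _ => ⟨h.mem_of_mem h' hc hc', h'.mem_of_mem h hc' hc⟩).eq_of_canonical
    hc hc'

/-! ### Grounded structures -/

/-- Every vertex above the bottom level is above some vertex of the next lower level. -/
def Grounded (ℓ : V → ℕ) (lt : V → V → Prop) (s : Set V) : Prop :=
  ∀ v ∈ s, 0 < ℓ v → ∃ u ∈ s, lt u v ∧ ℓ u + 1 = ℓ v

/-- A letter starts at most one level above the top of its predecessor, so a canonical word cannot
jump over a level on the way up. -/
theorem Canonical.exists_crossing {w : List Letter} (hw : Canonical w) {m k : ℕ}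
    (hk : k < w.length) (hm : m < w[k].lo) (h0 : ∀ x ∈ w.head?, x.lo = 0) :
    ∃ j, ∃ h : j < k, w[j].lo ≤ m ∧ m ≤ w[j].hi := by
  have hlink := List.isChain_iff_getElem.1 hw
  induction k with
  | zero =>
    have := h0 w[0] (by rw [List.head?_eq_getElem?]; simp)
    omega
  | succ k ih =>
    by_cases hmk : m < w[k].lo
    · obtain ⟨j, hj, h⟩ := ih (by omega) hmk
      exact ⟨j, by omega, h⟩
    · have := (hlink k hk).1
      exact ⟨k, by omega, by omega, by omega⟩

/-- Nothing one level down can be below the lowest vertices of the first part. Conversely an earlier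
part crosses the level below `v`, or `v` is in the top of a tangle, where some bottom vertex is
below it. -/
theorem IsDecomp.grounded_iff {ℓ : V → ℕ} {lt : V → V → Prop} {s : Set V}
    {L : List (Letter × Set V)} (h : IsDecomp ℓ lt s L) (hc : Canonical (L.map Prod.fst)) :
    Grounded ℓ lt s ↔ ∀ x ∈ (L.map Prod.fst).head?, x.lo = 0 := by
  constructor
  · intro hg x hx
    rcases L with _ | ⟨p, L⟩
    · simp at hx
    · simp only [List.map_cons, List.head?_cons, Option.mem_def, Option.some.injEq] at hx
      subst hx
      by_contra hne
      have hp := (h.piece p (by simp)).lo_hi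
      obtain ⟨v, hv, hvl⟩ := hp.1
      have h0 : 0 < (p :: L).length := by simp
      have hvs := h.subset h0 hv
      obtain ⟨u, hu, huv, hul⟩ := hg v hvs (by omega)
      have hle := h.pos_le_of_lt hu hvs hul.symm huv
      have hv0 := h.pos_eq h0 hv
      have hu0 := (h.mem_iff_pos hu h0).2 (by omega)
      have := hp.2.2 u hu0
      omega
  · intro h0 v hv hpos
    have hk := h.pos_lt hv
    have hp := h.piece_pos hv
    have hmv := h.mem_pos hv
    have hb := hp.lo_hi.2.2 v hmv
    have hhl := (L[pos L v]'hk).1.hi_le_lo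
    by_cases hlo : ℓ v = (L[pos L v]'hk).1.lo
    · obtain ⟨j, hj, h1, h2⟩ := hc.exists_crossing (m := ℓ v - 1) (k := pos L v) (by simpa using hk)
        (by simp; omega) h0
      simp only [List.getElem_map] at h1 h2
      have hjL : j < L.length := hj.trans hk
      obtain ⟨⟨a, ha, hal⟩, ⟨b, hb, hbl⟩, -⟩ := (h.piece _ (List.getElem_mem hjL)).lo_hi
      obtain ⟨u, hu, hul⟩ : ∃ u ∈ L[j].2, ℓ u + 1 = ℓ v := by
        have := L[j].1.hi_le_lo
        by_cases hal' : ℓ a + 1 = ℓ v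
        · exact ⟨a, ha, hal'⟩
        · exact ⟨b, hb, by omega⟩
      have hus := h.subset hjL hu
      have hup := h.pos_eq hjL hu
      exact ⟨u, hus, (h.precedes hus hv (by omega)).1 hul.symm, hul⟩
    · have hsub := h.subset hk
      generalize L[pos L v]'hk = p at *
      obtain ⟨x, X⟩ := p
      rcases x with i | i
      · simp only [lo_c, hi_c] at *
        omega
      · simp only [lo_t, hi_t] at *
        obtain ⟨a, ha, ⟨b, hb, hbv, -⟩, -⟩ := hp.2.1.exists_splits ⟨hmv, by omega⟩
        exact ⟨b, hsub hb.1, hbv, by rw [hb.2]; omega⟩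

end Layered

/-! ### Exponential generating functions -/

section EGF

open Nat (factorial)

/-- The number that a series counts as an exponential generating function. -/
def egfCount (F : PowerSeries ℚ) (n : ℕ) : ℚ := factorial n * PowerSeries.coeff n F

theorem factorial_ne (n : ℕ) : (factorial n : ℚ) ≠ 0 := by exact_mod_cast Nat.factorial_ne_zero n

theorem egfCount_mul {V : Type} (F G : PowerSeries ℚ) (s : Finset V) :
    egfCount (F * G) s.card =
      ∑ X ∈ s.powerset, egfCount F X.card * egfCount G (s \ X).card := by
  have h1 : ∑ X ∈ s.powerset, egfCount F X.card * egfCount G (s \ X).card =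
      ∑ X ∈ s.powerset, egfCount F X.card * egfCount G (s.card - X.card) :=
    Finset.sum_congr rfl fun X hX => by
      rw [Finset.card_sdiff_of_subset (Finset.mem_powerset.1 hX)]
  rw [h1, Finset.sum_powerset_apply_card (fun k => egfCount F k * egfCount G (s.card - k)),
    egfCount, PowerSeries.coeff_mul, Finset.Nat.sum_antidiagonal_eq_sum_range_succ
      (fun i j => PowerSeries.coeff i F * PowerSeries.coeff j G), Finset.mul_sum]
  refine Finset.sum_congr rfl fun k hk => ?_
  have hk' : k ≤ s.card := Nat.lt_succ_iff.1 (Finset.mem_range.1 hk)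
  rw [← Nat.choose_mul_factorial_mul_factorial hk', egfCount, egfCount, nsmul_eq_mul]
  push_cast
  ring

/-- The exponents of the monomial $c^i t^j$. -/
def bidegree (i j : ℕ) : Fin 2 →₀ ℕ := Finsupp.equivFunOnFinite.symm ![i, j]

@[simp] theorem bidegree_zero (i j : ℕ) : bidegree i j 0 = i := rfl
@[simp] theorem bidegree_one (i j : ℕ) : bidegree i j 1 = j := rfl

theorem bidegree_eta (d : Fin 2 →₀ ℕ) : bidegree (d 0) (d 1) = d := by
  ext i
  fin_cases i <;> rfl

theorem coeff_pow_mul_pow_eq_zero {f g : PowerSeries ℚ} (hf : PowerSeries.constantCoeff f = 0)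
    (hg : PowerSeries.constantCoeff g = 0) {i j n : ℕ} (h : n < i + j) :
    PowerSeries.coeff n (f ^ i * g ^ j) = 0 := by
  refine PowerSeries.X_pow_dvd_iff.1 ?_ n h
  rw [pow_add]
  exact mul_dvd_mul (pow_dvd_pow_of_dvd (PowerSeries.X_dvd_iff.2 hf) _)
    (pow_dvd_pow_of_dvd (PowerSeries.X_dvd_iff.2 hg) _)

theorem hasSubst₂ {f g : PowerSeries ℚ} (hf : PowerSeries.constantCoeff f = 0)
    (hg : PowerSeries.constantCoeff g = 0) :
    MvPowerSeries.HasSubst (![f, g] : Fin 2 → MvPowerSeries Unit ℚ) := by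
  refine MvPowerSeries.hasSubst_of_constantCoeff_zero fun i => ?_
  fin_cases i
  · exact hf
  · exact hg

/-- Since $f^ig^j$ starts in degree $i+j$ or later, only finitely many terms contribute. -/
theorem coeff_subst₂ (F : MvPowerSeries (Fin 2) ℚ) {f g : PowerSeries ℚ}
    (hf : PowerSeries.constantCoeff f = 0) (hg : PowerSeries.constantCoeff g = 0) (n : ℕ) :
    PowerSeries.coeff n (subst₂ F f g) =
      ∑ ij ∈ Finset.range (n + 1) ×ˢ Finset.range (n + 1),
        MvPowerSeries.coeff (bidegree ij.1 ij.2) F * PowerSeries.coeff n (f ^ ij.1 * g ^ ij.2) := by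
  have h1 : PowerSeries.coeff n (subst₂ F f g) = ∑ᶠ d : Fin 2 →₀ ℕ,
      MvPowerSeries.coeff d F * PowerSeries.coeff n (f ^ d 0 * g ^ d 1) := by
    rw [PowerSeries.coeff, subst₂, MvPowerSeries.coeff_subst (hasSubst₂ hf hg)]
    refine finsum_congr fun d => ?_
    rw [Finsupp.prod_fintype _ _ (fun i => pow_zero _), Fin.prod_univ_two]
    rfl
  have hinj : Set.InjOn (fun ij : ℕ × ℕ => bidegree ij.1 ij.2)
      (Finset.range (n + 1) ×ˢ Finset.range (n + 1) : Finset (ℕ × ℕ)) := by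
    intro x _ y _ hxy
    exact Prod.ext (DFunLike.congr_fun hxy 0) (DFunLike.congr_fun hxy 1)
  rw [h1, finsum_eq_sum_of_support_subset
    (s := (Finset.range (n + 1) ×ˢ Finset.range (n + 1)).image fun ij => bidegree ij.1 ij.2) _ ?_,
    Finset.sum_image hinj]
  · rfl
  · intro d hd
    have : d 0 + d 1 ≤ n := by
      by_contra! hlt
      apply hd
      dsimp only
      rw [coeff_pow_mul_pow_eq_zero hf hg hlt, mul_zero]
    simp only [Finset.coe_image, Finset.coe_product, Finset.coe_range, Set.mem_image,
      Set.mem_prod, Set.mem_Iio]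
    exact ⟨(d 0, d 1), ⟨by dsimp only; omega, by dsimp only; omega⟩, bidegree_eta d⟩

theorem LocallyFin.finite_le {W : Set (List Letter)} (hW : LocallyFin W) (n : ℕ) :
    {w ∈ W | w.length ≤ n}.Finite := by
  have : {w ∈ W | w.length ≤ n} = ⋃ k ∈ Set.Iic n, {w ∈ W | w.length = k} := by
    ext w
    simp
  rw [this]
  exact (Set.finite_Iic n).biUnion fun k _ => hW k

theorem coeff_subst₂_wordGF {W : Set (List Letter)} (hW : LocallyFin W) {f g : PowerSeries ℚ}
    (hf : PowerSeries.constantCoeff f = 0) (hg : PowerSeries.constantCoeff g = 0) (n : ℕ) :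
    PowerSeries.coeff n (subst₂ (wordGF W) f g) = ∑ w ∈ (hW.finite_le n).toFinset,
      PowerSeries.coeff n (f ^ w.countP isC * g ^ w.countP isT) := by
  rw [coeff_subst₂ _ hf hg, ← Finset.sum_fiberwise_of_maps_to
    (g := fun w : List Letter => (w.countP isC, w.countP isT))
    (t := Finset.range (n + 1) ×ˢ Finset.range (n + 1))]
  · refine Finset.sum_congr rfl fun ij _ => ?_
    obtain ⟨i, j⟩ := ij
    rw [Finset.sum_congr rfl (g := fun _ => PowerSeries.coeff n (f ^ i * g ^ j))]
    · rw [Finset.sum_const, nsmul_eq_mul, coeff_wordGF]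
      by_cases hij : i + j ≤ n
      · congr 2
        rw [← Set.ncard_coe_finset]
        congr 1
        ext w
        have := countP_add w
        simp only [graded, Set.mem_ofPred_eq, bidegree_zero, bidegree_one, Finset.coe_filter,
          Set.Finite.mem_toFinset, Prod.mk.injEq]
        constructor
        · rintro ⟨h1, h2, h3⟩
          exact ⟨⟨h1, by omega⟩, h2, h3⟩
        · rintro ⟨⟨h1, -⟩, h2, h3⟩
          exact ⟨h1, h2, h3⟩
      · rw [coeff_pow_mul_pow_eq_zero hf hg (by omega), mul_zero, mul_zero]
    · intro w hw
      have := (Finset.mem_filter.1 hw).2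
      simp only [Prod.mk.injEq] at this
      rw [this.1, this.2]
  · intro w hw
    have h1 := ((Set.Finite.mem_toFinset _).1 hw).2
    have h2 := countP_add w
    simp only [Finset.mem_product, Finset.mem_range]
    omega

theorem constantCoeff_exp_sub_one : PowerSeries.constantCoeff (PowerSeries.exp ℚ - 1) = 0 := by
  simp

theorem egfCount_exp_sub_one (n : ℕ) :
    egfCount (PowerSeries.exp ℚ - 1) n = if n = 0 then 0 else 1 := by
  rw [egfCount, map_sub, PowerSeries.coeff_exp, PowerSeries.coeff_one]
  split_ifs with h
  · simp [h]
  · simp [factorial_ne n]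

theorem egfCount_one (n : ℕ) : egfCount 1 n = if n = 0 then 1 else 0 := by
  rw [egfCount, PowerSeries.coeff_one]
  split_ifs with h
  · simp [h]
  · simp

theorem egfCount_tangleDiag {V : Type} (s : Finset V) :
    egfCount tangleDiag s.card = ∑ B ∈ s.powerset, (numTangles B.card (s \ B).card : ℚ) := by
  have h1 : ∑ B ∈ s.powerset, (numTangles B.card (s \ B).card : ℚ) =
      ∑ B ∈ s.powerset, (numTangles B.card (s.card - B.card) : ℚ) :=
    Finset.sum_congr rfl fun X hX => by
      rw [Finset.card_sdiff_of_subset (Finset.mem_powerset.1 hX)]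
  rw [h1, Finset.sum_powerset_apply_card (fun k => (numTangles k (s.card - k) : ℚ)),
    egfCount, tangleDiag, coeff_subst₂ _ (by simp) (by simp), Finset.mul_sum, Finset.sum_product]
  refine Finset.sum_congr rfl fun k hk => ?_
  have hk' : k ≤ s.card := Nat.lt_succ_iff.1 (Finset.mem_range.1 hk)
  rw [Finset.sum_eq_single (s.card - k)]
  · have h2 : MvPowerSeries.coeff (bidegree k (s.card - k)) tangleEGF =
        (numTangles k (s.card - k) : ℚ) /
          ((factorial k : ℚ) * (factorial (s.card - k) : ℚ)) := rfl
    rw [h2, ← pow_add, Nat.add_sub_cancel' hk', PowerSeries.coeff_X_pow_self, mul_one,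
      ← Nat.choose_mul_factorial_mul_factorial hk', nsmul_eq_mul]
    have h3 := factorial_ne k
    have h4 := factorial_ne (s.card - k)
    push_cast
    field_simp
  · intro j _ hj
    rw [← pow_add, PowerSeries.coeff_X_pow, if_neg (by dsimp only; omega), mul_zero, mul_zero]
  · intro h
    exact absurd (Finset.mem_range.2 (by omega)) h

end EGF

section Fillings

variable {V : Type}

/-! ### Counting labelled decompositions -/

theorem CutConn.congr {r r' : V → V → Prop} {B A : Set V} (h : CutConn r B A)
    (hr : ∀ b ∈ B, ∀ a ∈ A, r b a ↔ r' b a) : CutConn r' B A := by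
  refine ⟨h.1, fun S hS h1 h2 => ?_⟩
  obtain ⟨x, hx, y, hy, ⟨b, hb, h3, h4⟩, b', hb', h5, h6⟩ := h.2 S hS h1 h2
  exact ⟨x, hx, y, hy, ⟨b, hb, (hr b hb x (hS hx)).1 h3, fun h => h4 ((hr b hb y hy.1).2 h)⟩,
    b', hb', (hr b' hb' y hy.1).1 h5, fun h => h6 ((hr b' hb' x (hS hx)).2 h)⟩

theorem TangleRel.congr {r r' : V → V → Prop} {B A : Set V} (h : TangleRel r B A)
    (hr : ∀ b ∈ B, ∀ a ∈ A, r b a ↔ r' b a) : TangleRel r' B A :=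
  ⟨h.1.congr hr, h.2.congr fun a ha b hb => hr b hb a ha⟩

theorem Piece.congr {ℓ ℓ' : V → ℕ} {lt lt' : V → V → Prop} {x : Letter} {X : Set V}
    (h : Piece ℓ lt x X) (hℓ : ∀ v ∈ X, ℓ v = ℓ' v)
    (hlt : ∀ a ∈ X, ∀ b ∈ X, lt a b ↔ lt' a b) : Piece ℓ' lt' x X := by
  rcases x with i | i
  · exact ⟨h.1, fun v hv => (hℓ v hv).symm.trans (h.2 v hv)⟩
  · refine ⟨fun v hv => hℓ v hv ▸ h.1 v hv, ?_⟩
    have e : ∀ k, {v ∈ X | ℓ' v = k} = {v ∈ X | ℓ v = k} := fun k => by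
      ext v
      simp only [Set.mem_ofPred_eq]
      exact and_congr_right fun hv => by rw [hℓ v hv]
    rw [e, e]
    exact h.2.congr fun b hb a ha => hlt b hb.1 a ha.1

theorem IsDecomp.congr {ℓ ℓ' : V → ℕ} {lt lt' : V → V → Prop} {s : Set V}
    {L : List (Letter × Set V)} (h : IsDecomp ℓ lt s L) (hℓ : ∀ v ∈ s, ℓ v = ℓ' v)
    (hlt : ∀ a ∈ s, ∀ b ∈ s, lt a b ↔ lt' a b) : IsDecomp ℓ' lt' s L := by
  have hsub : ∀ p ∈ L, p.2 ⊆ s := fun p hp v hv => (h.cover v).2 ⟨p, hp, hv⟩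
  refine ⟨⟨fun a ha b hb hab => ?_, fun a ha b hb hab => ?_⟩, fun p hp => ?_, ?_, h.cover⟩
  · rw [← hlt a ha b hb]
    exact h.layered.far a ha b hb (by rwa [hℓ a ha, hℓ b hb])
  · rw [← hℓ a ha, ← hℓ b hb]
    exact h.layered.near a ha b hb ((hlt a ha b hb).2 hab)
  · exact (h.piece p hp).congr (fun v hv => hℓ v (hsub p hp hv))
      fun a ha b hb => hlt a (hsub p hp ha) b (hsub p hp hb)
  · refine h.pairwise.imp_of_mem fun {p q} hp hq hpq => ⟨hpq.1, fun a ha b hb => ?_⟩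
    have ha' := hsub p hp ha
    have hb' := hsub q hq hb
    rw [← hℓ a ha', ← hℓ b hb', ← hlt a ha' b hb', ← hlt b hb' a ha']
    exact hpq.2 a ha b hb

theorem isDecomp_singleton {ℓ : V → ℕ} {lt : V → V → Prop} {s : Set V} {x : Letter} {X : Set V} :
    IsDecomp ℓ lt s [(x, X)] ↔ s = X ∧ Layered ℓ lt X ∧ Piece ℓ lt x X := by
  rw [isDecomp_cons, isDecomp_nil]
  constructor
  · rintro ⟨h1, h2, h3, -, h4⟩
    obtain rfl := h2.antisymm (Set.sdiff_eq_empty.1 h4)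
    exact ⟨rfl, h1, h3⟩
  · rintro ⟨rfl, h1, h2⟩
    exact ⟨h1, subset_rfl, h2, fun a _ b hb => absurd hb.1 hb.2, by simp⟩

/-- Levels, an order and a list of parts. -/
abbrev Filling (V : Type) : Type := (V → ℕ) × (V → V → Prop) × List (Letter × Set V)

/-- The decomposed structures on `s` with a given word, extended by junk outside of `s`. -/
def fillings (w : List Letter) (s : Set V) : Set (Filling V) :=
  {T | IsDecomp T.1 T.2.1 s T.2.2 ∧ T.2.2.map Prod.fst = w ∧ (∀ v ∉ s, T.1 v = 0) ∧
    ∀ a b, T.2.1 a b → a ∈ s ∧ b ∈ s}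

/-- Restriction of the levels and the order to `X`, with a new list. -/
def restr (T : Filling V) (X : Set V) (L : List (Letter × Set V)) : Filling V :=
  (fun v => if v ∈ X then T.1 v else 0, fun a b => T.2.1 a b ∧ a ∈ X ∧ b ∈ X, L)

theorem restr_mem {T : Filling V} {X : Set V} {L : List (Letter × Set V)} {w : List Letter}
    (h : IsDecomp T.1 T.2.1 X L) (hw : L.map Prod.fst = w) : restr T X L ∈ fillings w X :=
  ⟨h.congr (fun v hv => by simp [restr, hv]) (fun a ha b hb => by simp [restr, ha, hb]), hw,
    fun v hv => by simp [restr, hv], fun a b hab => hab.2⟩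

theorem restr_eq {T T' : Filling V} {X : Set V} {w : List Letter} (hT : T ∈ fillings w X)
    (hℓ : ∀ v ∈ X, T'.1 v = T.1 v) (hlt : ∀ a ∈ X, ∀ b ∈ X, T'.2.1 a b ↔ T.2.1 a b) :
    restr T' X T.2.2 = T := by
  obtain ⟨-, -, h1, h2⟩ := hT
  refine Prod.ext ?_ (Prod.ext ?_ rfl)
  · funext v
    by_cases hv : v ∈ X
    · simp [restr, hv, hℓ v hv]
    · simp [restr, hv, h1 v hv]
  · funext a b
    simp only [restr, eq_iff_iff]
    constructor
    · rintro ⟨h, ha, hb⟩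
      exact (hlt a ha b hb).1 h
    · intro h
      obtain ⟨ha, hb⟩ := h2 a b h
      exact ⟨(hlt a ha b hb).2 h, ha, hb⟩

/-- Place the part `X` below the rest `Y`. -/
def glue (X Y : Set V) (T : Filling V × Filling V) : Filling V :=
  (fun v => if v ∈ X then T.1.1 v else T.2.1 v,
    fun a b => (a ∈ X ∧ b ∈ X ∧ T.1.2.1 a b) ∨ (a ∈ Y ∧ b ∈ Y ∧ T.2.2.1 a b) ∨
      -- Because `X` comes first, one level suffices for an element of `X` to be below one of `Y`;
      -- the reverse relation needs two.
      (a ∈ X ∧ b ∈ Y ∧ T.1.1 a + 1 ≤ T.2.1 b) ∨ (a ∈ Y ∧ b ∈ X ∧ T.2.1 a + 2 ≤ T.1.1 b),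
    T.1.2.2 ++ T.2.2.2)

theorem fillings_singleton {x : Letter} {X : Set V} {T : Filling V} (h : T ∈ fillings [x] X) :
    T.2.2 = [(x, X)] := by
  obtain ⟨h, hw, -⟩ := h
  obtain ⟨p, hp, rfl⟩ := List.map_eq_singleton_iff.1 hw
  obtain ⟨y, Y⟩ := p
  rw [hp] at h ⊢
  obtain ⟨rfl, -⟩ := isDecomp_singleton.1 h
  rfl

/-- Cutting off the first part loses nothing, as all relations between it and the rest are
determined by the levels. This makes the exponential generating functions multiplicative. -/
theorem bijOn_fillings_cons {x : Letter} {w : List Letter} {s X : Set V} (hX : X ⊆ s) :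
    Set.BijOn (fun T : Filling V => (restr T X [(x, X)], restr T (s \ X) T.2.2.tail))
      {T ∈ fillings (x :: w) s | ∃ L, T.2.2 = (x, X) :: L}
      (fillings [x] X ×ˢ fillings w (s \ X)) := by
  refine Set.InvOn.bijOn (f' := glue X (s \ X)) ⟨?_, ?_⟩ ?_ ?_
  · rintro ⟨ℓ, lt, L'⟩ ⟨⟨h, -, h1, h2⟩, L, hL⟩
    dsimp only at h h1 h2 hL
    subst hL
    obtain ⟨hlay, -, -, hpr, -⟩ := isDecomp_cons.1 h
    refine Prod.ext ?_ (Prod.ext ?_ rfl)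
    · funext v
      by_cases hv : v ∈ X
      · simp [glue, restr, hv]
      · by_cases hvs : v ∈ s
        · simp [glue, restr, hv, hvs]
        · simp [glue, restr, hv, hvs, h1 v hvs]
    · funext a b
      by_cases ha : a ∈ s
      swap
      · have : ¬ lt a b := fun h => ha (h2 a b h).1
        have ha' : a ∉ X := fun h => ha (hX h)
        simp [glue, restr, ha, ha', this]
      by_cases hb : b ∈ s
      swap
      · have : ¬ lt a b := fun h => hb (h2 a b h).2
        have hb' : b ∉ X := fun h => hb (hX h)
        simp [glue, restr, hb, hb', this]
      by_cases haX : a ∈ X <;> by_cases hbX : b ∈ X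
      · simp [glue, restr, haX, hbX]
      · simp only [glue, restr, haX, hbX, Set.mem_sdiff, ha, hb, if_true, if_false, true_and,
          false_and, and_false, false_or, or_false, not_true, not_false_eq_true, and_true,
          eq_iff_iff]
        have h3 := (hpr a haX b ⟨hb, hbX⟩).1
        have h4 := hlay.near a ha b hb
        have h5 := hlay.far a ha b hb
        refine ⟨fun h => ?_, h4⟩
        rcases h.lt_or_eq with h | h
        · exact h5 h
        · exact h3 h.symm
      · simp only [glue, restr, haX, hbX, Set.mem_sdiff, ha, hb, if_true, if_false, true_and,
          false_and, and_false, false_or, not_true, not_false_eq_true, and_true,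
          eq_iff_iff]
        have h3 := (hpr b hbX a ⟨ha, haX⟩).2
        have h4 := hlay.near a ha b hb
        have h5 := hlay.far a ha b hb
        refine ⟨h5, fun h => ?_⟩
        rcases (h4 h).lt_or_eq with h' | h'
        · exact h'
        · exact absurd h (h3 h'.symm)
      · simp [glue, restr, haX, hbX, ha, hb]
  · rintro ⟨T₁, T₂⟩ ⟨h₁, h₂⟩
    have e1 := fillings_singleton h₁
    have e2 : (glue X (s \ X) (T₁, T₂)).2.2.tail = T₂.2.2 := by
      dsimp only at e1
      simp only [glue, e1]
      rfl
    refine Prod.ext ?_ ?_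
    · dsimp only
      rw [← e1]
      refine restr_eq h₁ (fun v hv => by simp [glue, hv]) fun a ha b hb => by
        simp [glue, ha, hb]
    · dsimp only
      rw [e2]
      refine restr_eq h₂ (fun v hv => by simp [glue, hv.2]) fun a ha b hb => by
        simp [glue, ha.1, hb.1, ha.2, hb.2]
  · rintro ⟨ℓ, lt, L'⟩ ⟨⟨h, hw, h1, h2⟩, L, hL⟩
    dsimp only at h h1 h2 hL hw
    subst hL
    obtain ⟨hlay, -, hp, -, hd⟩ := isDecomp_cons.1 h
    exact ⟨restr_mem (isDecomp_singleton.2 ⟨rfl, hlay.mono hX, hp⟩) rfl,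
      restr_mem hd (List.cons.inj hw).2⟩
  · rintro ⟨T₁, T₂⟩ ⟨h₁, h₂⟩
    have e1 := fillings_singleton h₁
    obtain ⟨d₁, w₁, -, j₁⟩ := h₁
    obtain ⟨d₂, w₂, z₂, j₂⟩ := h₂
    dsimp only at *
    rw [e1] at d₁
    obtain ⟨-, lay₁, p₁⟩ := isDecomp_singleton.1 d₁
    have eℓ₁ : ∀ v ∈ X, (glue X (s \ X) (T₁, T₂)).1 v = T₁.1 v := fun v hv => by
      simp [glue, hv]
    have eℓ₂ : ∀ v ∈ s \ X, (glue X (s \ X) (T₁, T₂)).1 v = T₂.1 v := fun v hv => by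
      simp [glue, hv.2]
    have elt₁ : ∀ a ∈ X, ∀ b ∈ X, (glue X (s \ X) (T₁, T₂)).2.1 a b ↔ T₁.2.1 a b :=
      fun a ha b hb => by simp [glue, ha, hb]
    have elt₂ : ∀ a ∈ s \ X, ∀ b ∈ s \ X, (glue X (s \ X) (T₁, T₂)).2.1 a b ↔ T₂.2.1 a b :=
      fun a ha b hb => by simp [glue, ha.1, hb.1, ha.2, hb.2]
    have elt₃ : ∀ a ∈ X, ∀ b ∈ s \ X,
        (glue X (s \ X) (T₁, T₂)).2.1 a b ↔ T₁.1 a + 1 ≤ T₂.1 b :=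
      fun a ha b hb => by simp [glue, ha, hb.1, hb.2]
    have elt₄ : ∀ a ∈ s \ X, ∀ b ∈ X,
        (glue X (s \ X) (T₁, T₂)).2.1 a b ↔ T₂.1 a + 2 ≤ T₁.1 b :=
      fun a ha b hb => by simp [glue, hb, ha.1, ha.2]
    have elist : (glue X (s \ X) (T₁, T₂)).2.2 = (x, X) :: T₂.2.2 := by
      simp [glue, e1]
    refine ⟨⟨?_, ?_, fun v hv => ?_, fun a b hab => ?_⟩, _, elist⟩
    · rw [elist]
      refine isDecomp_cons.2 ⟨⟨fun a ha b hb => ?_, fun a ha b hb => ?_⟩, hX,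
        p₁.congr (fun v hv => (eℓ₁ v hv).symm) fun a ha b hb => (elt₁ a ha b hb).symm,
        fun a ha b hb => ?_,
        d₂.congr (fun v hv => (eℓ₂ v hv).symm) fun a ha b hb => (elt₂ a ha b hb).symm⟩
      · by_cases haX : a ∈ X <;> by_cases hbX : b ∈ X
        · rw [eℓ₁ a haX, eℓ₁ b hbX, elt₁ a haX b hbX]
          exact lay₁.far a haX b hbX
        · rw [eℓ₁ a haX, eℓ₂ b ⟨hb, hbX⟩, elt₃ a haX b ⟨hb, hbX⟩]
          omega
        · rw [eℓ₂ a ⟨ha, haX⟩, eℓ₁ b hbX, elt₄ a ⟨ha, haX⟩ b hbX]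
          exact id
        · rw [eℓ₂ a ⟨ha, haX⟩, eℓ₂ b ⟨hb, hbX⟩, elt₂ a ⟨ha, haX⟩ b ⟨hb, hbX⟩]
          exact d₂.layered.far a ⟨ha, haX⟩ b ⟨hb, hbX⟩
      · by_cases haX : a ∈ X <;> by_cases hbX : b ∈ X
        · rw [eℓ₁ a haX, eℓ₁ b hbX, elt₁ a haX b hbX]
          exact lay₁.near a haX b hbX
        · rw [eℓ₁ a haX, eℓ₂ b ⟨hb, hbX⟩, elt₃ a haX b ⟨hb, hbX⟩]
          exact id
        · rw [eℓ₂ a ⟨ha, haX⟩, eℓ₁ b hbX, elt₄ a ⟨ha, haX⟩ b hbX]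
          omega
        · rw [eℓ₂ a ⟨ha, haX⟩, eℓ₂ b ⟨hb, hbX⟩, elt₂ a ⟨ha, haX⟩ b ⟨hb, hbX⟩]
          exact d₂.layered.near a ⟨ha, haX⟩ b ⟨hb, hbX⟩
      · rw [eℓ₁ a ha, eℓ₂ b hb, elt₃ a ha b hb, elt₄ b hb a ha]
        omega
    · rw [elist, List.map_cons, w₂]
    · have : v ∉ X := fun h => hv (hX h)
      simp only [glue, this, if_false]
      exact z₂ v fun h => hv h.1
    · rcases hab with h | h | h | h
      · exact ⟨hX h.1, hX h.2.1⟩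
      · exact ⟨h.1.1, h.2.1.1⟩
      · exact ⟨hX h.1, h.2.1.1⟩
      · exact ⟨h.1.1, hX h.2.1⟩

theorem ncard_biUnion_finset {α ι : Type*} {t : Finset ι} {A : ι → Set α}
    (hfin : ∀ i ∈ t, (A i).Finite) (hdisj : (t : Set ι).PairwiseDisjoint A) :
    (⋃ i ∈ t, A i).ncard = ∑ i ∈ t, (A i).ncard := by
  rw [← finsum_mem_coe_finset]
  exact t.finite_toSet.ncard_biUnion hfin hdisj

theorem fillings_nil (s : Set V) (hs : s.Nonempty) : fillings [] s = ∅ := by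
  rw [Set.eq_empty_iff_forall_notMem]
  rintro T ⟨h, hw, -⟩
  rw [List.map_eq_nil_iff.1 hw, isDecomp_nil] at h
  exact hs.ne_empty h

theorem fillings_nil_empty : fillings [] (∅ : Set V) = {(fun _ => 0, fun _ _ => False, [])} := by
  ext T
  obtain ⟨ℓ, lt, L⟩ := T
  simp only [Set.mem_singleton_iff, Prod.mk.injEq]
  constructor
  · rintro ⟨h, hw, h1, h2⟩
    refine ⟨funext fun v => h1 v (by simp), ?_, List.map_eq_nil_iff.1 hw⟩
    funext a b
    simp only [eq_iff_iff, iff_false]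
    exact fun hab => (h2 a b hab).1
  · rintro ⟨rfl, rfl, rfl⟩
    exact ⟨isDecomp_nil.2 rfl, rfl, fun _ _ => rfl, fun _ _ h => h.elim⟩

theorem fillings_cons_eq (x : Letter) (w : List Letter) (s : Finset V) :
    fillings (x :: w) (s : Set V) = ⋃ X ∈ s.powerset,
      {T ∈ fillings (x :: w) (s : Set V) | ∃ L, T.2.2 = (x, (X : Set V)) :: L} := by
  ext T
  simp only [Set.mem_iUnion, Finset.mem_powerset, exists_prop]
  constructor
  · intro hT
    obtain ⟨hd, hw, -⟩ := id hT
    obtain ⟨p, L, hpL, rfl, -⟩ := List.map_eq_cons_iff.1 hw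
    obtain ⟨y, Y⟩ := p
    rw [hpL] at hd
    have hY : Y ⊆ s := (isDecomp_cons.1 hd).2.1
    have hYfin : Y.Finite := s.finite_toSet.subset hY
    refine ⟨hYfin.toFinset, ?_, hT, L, ?_⟩
    · simpa using hY
    · simpa using hpL
  · rintro ⟨X, -, hT, -⟩
    exact hT

/-- The relations between `B` and `A` that make these sets the bottom and the top of a tangle. -/
def tangleRels (B A : Set V) : Set (V → V → Prop) :=
  {lt | TangleRel lt B A ∧ ∀ a b, lt a b → a ∈ B ∧ b ∈ A}

theorem fillings_clone (i : ℕ) {X : Set V} (hX : X.Nonempty) :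
    fillings [.c i] X = {(fun v => if v ∈ X then i else 0, fun _ _ => False, [(.c i, X)])} := by
  ext T
  constructor
  · intro hT
    have e := fillings_singleton hT
    obtain ⟨ℓ, lt, L⟩ := T
    obtain ⟨h, -, h1, h2⟩ := hT
    dsimp only at *
    subst e
    obtain ⟨-, hlay, hp⟩ := isDecomp_singleton.1 h
    have hℓ : ∀ v ∈ X, ℓ v = i := hp.2
    refine Prod.ext ?_ (Prod.ext ?_ rfl)
    · funext v
      by_cases hv : v ∈ X
      · simp [hv, hℓ v hv]
      · simp [hv, h1 v hv]
    · funext a b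
      simp only [eq_iff_iff, iff_false]
      intro hab
      obtain ⟨ha, hb⟩ := h2 a b hab
      have := hlay.near a ha b hb hab
      rw [hℓ a ha, hℓ b hb] at this
      omega
  · rintro rfl
    refine ⟨isDecomp_singleton.2 ⟨rfl, ⟨fun a ha b hb hab => ?_, fun _ _ _ _ h => h.elim⟩, hX,
      fun v hv => by simp [hv]⟩, rfl, fun v hv => by simp [hv], fun _ _ h => h.elim⟩
    simp [ha, hb] at hab

theorem bijOn_fillings_tangle (i : ℕ) {X B : Set V} (hB : B ⊆ X) :
    Set.BijOn (fun T : Filling V => T.2.1) {T ∈ fillings [.t i] X | {v ∈ X | T.1 v = i} = B}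
      (tangleRels B (X \ B)) := by
  have levels : ∀ T ∈ fillings [.t i] X, {v ∈ X | T.1 v = i} = B →
      {v ∈ X | T.1 v = i + 1} = X \ B := by
    rintro T hT rfl
    have e := fillings_singleton hT
    obtain ⟨h, -⟩ := hT
    rw [e] at h
    have hp := (isDecomp_singleton.1 h).2.2.1
    ext v
    simp only [Set.mem_ofPred_eq, Set.mem_sdiff, not_and]
    constructor
    · rintro ⟨hv, hvi⟩
      exact ⟨hv, fun _ => by omega⟩
    · rintro ⟨hv, hvi⟩
      exact ⟨hv, (hp v hv).resolve_left (hvi hv)⟩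
  refine ⟨?_, ?_, ?_⟩
  · rintro T ⟨hT, hTB⟩
    have hA := levels T hT hTB
    have e := fillings_singleton hT
    obtain ⟨h, -, -, h2⟩ := hT
    rw [e] at h
    obtain ⟨-, hlay, hp⟩ := isDecomp_singleton.1 h
    have h6 := hp.2
    rw [hTB, hA] at h6
    refine ⟨h6, fun a b hab => ?_⟩
    obtain ⟨ha, hb⟩ := h2 a b hab
    have h3 := hlay.near a ha b hb hab
    have h4 := hp.1 a ha
    have h5 := hp.1 b hb
    rw [← hA, ← hTB]
    exact ⟨⟨ha, by omega⟩, hb, by omega⟩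
  · rintro T ⟨hT, hTB⟩ T' ⟨hT', hTB'⟩ heq
    have hA := levels T hT hTB
    have hA' := levels T' hT' hTB'
    refine Prod.ext ?_ (Prod.ext heq ?_)
    · funext v
      by_cases hv : v ∈ X
      · by_cases hvB : v ∈ B
        · rw [← hTB] at hvB
          have hvB' := hvB
          rw [hTB, ← hTB'] at hvB'
          rw [hvB.2, hvB'.2]
        · have h1 : v ∈ X \ B := ⟨hv, hvB⟩
          have h2 := h1
          rw [← hA] at h1
          rw [← hA'] at h2
          rw [h1.2, h2.2]
      · rw [hT.2.2.1 v hv, hT'.2.2.1 v hv]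
    · rw [fillings_singleton hT, fillings_singleton hT']
  · rintro lt ⟨h, hlt⟩
    have eB : {v ∈ X | (if v ∈ B then i else if v ∈ X then i + 1 else 0) = i} = B := by
      ext v
      constructor
      · rintro ⟨hv, hvi⟩
        by_contra hvB
        simp [hv, hvB] at hvi
      · intro hv
        exact ⟨hB hv, by simp [hv]⟩
    have eA : {v ∈ X | (if v ∈ B then i else if v ∈ X then i + 1 else 0) = i + 1} = X \ B := by
      ext v
      constructor
      · rintro ⟨hv, hvi⟩
        refine ⟨hv, fun hvB => ?_⟩
        simp [hvB] at hvi
      · rintro ⟨hv, hvB⟩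
        exact ⟨hv, by simp [hv, hvB]⟩
    refine ⟨(fun v => if v ∈ B then i else if v ∈ X then i + 1 else 0, lt, [(.t i, X)]),
      ⟨⟨isDecomp_singleton.2 ⟨rfl, ⟨fun a ha b hb hab => ?_, fun a ha b hb hab => ?_⟩, ?_, ?_⟩,
        rfl, fun v hv => ?_, fun a b hab => ?_⟩, eB⟩, rfl⟩
    · exfalso
      dsimp only at hab
      simp only [ha, hb, if_true] at hab
      split_ifs at hab <;> omega
    · obtain ⟨haB, hbX, hbB⟩ := hlt a b hab
      simp [haB, hbX, hbB]
    · intro v hv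
      dsimp only
      by_cases hvB : v ∈ B
      · simp [hvB]
      · simp [hvB, hv]
    · dsimp only
      rw [eB, eA]
      exact h
    · have : v ∉ B := fun h => hv (hB h)
      simp [this, hv]
    · exact ⟨hB (hlt a b hab).1, (hlt a b hab).2.1⟩

/-! ### Tangle relations under relabelling, and the number of fillings of a word -/

theorem CutConn.map {W : Type} {r : W → W → Prop} {B A : Set V} {e : V → W}
    (he : Function.Injective e) :
    CutConn (fun a b => r (e a) (e b)) B A ↔ CutConn r (e '' B) (e '' A) := by
  constructor
  · intro h
    refine ⟨h.1.image he, fun S hS h1 h2 => ?_⟩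
    obtain ⟨x, hx, y, hy, ⟨b, hb, h3⟩, b', hb', h4⟩ := h.2 (e ⁻¹' S) (fun v hv => by
        obtain ⟨u, hu, huv⟩ := hS hv
        exact he huv ▸ hu) (by
        obtain ⟨v, hv⟩ := h1
        obtain ⟨u, hu, rfl⟩ := hS hv
        exact ⟨u, hv⟩) (by
        obtain ⟨_, ⟨u, hu, rfl⟩, hv⟩ := h2
        exact ⟨u, hu, hv⟩)
    exact ⟨e x, hx, e y, ⟨⟨y, hy.1, rfl⟩, hy.2⟩, ⟨e b, ⟨b, hb, rfl⟩, h3⟩, e b', ⟨b', hb', rfl⟩, h4⟩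
  · intro h
    refine ⟨?_, fun S hS h1 h2 => ?_⟩
    · obtain ⟨_, ⟨a, ha, rfl⟩, _, ⟨b, hb, rfl⟩, hab⟩ := h.1
      exact ⟨a, ha, b, hb, fun h => hab (h ▸ rfl)⟩
    · obtain ⟨_, ⟨x, hx, rfl⟩, _, ⟨⟨y, hy, rfl⟩, hyS⟩, ⟨_, ⟨b, hb, rfl⟩, h3⟩, _, ⟨b', hb', rfl⟩, h4⟩ :=
        h.2 (e '' S) (Set.image_mono hS) (h1.image e) (by
          obtain ⟨v, hv, hvS⟩ := h2
          refine ⟨e v, ⟨v, hv, rfl⟩, ?_⟩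
          rintro ⟨u, hu, huv⟩
          exact hvS (he huv ▸ hu))
      exact ⟨x, hx, y, ⟨hy, fun h => hyS ⟨y, h, rfl⟩⟩, ⟨b, hb, h3⟩, b', hb', h4⟩

theorem TangleRel.map {W : Type} {r : W → W → Prop} {B A : Set V} {e : V → W}
    (he : Function.Injective e) :
    TangleRel (fun a b => r (e a) (e b)) B A ↔ TangleRel r (e '' B) (e '' A) :=
  and_congr (CutConn.map he) (CutConn.map (r := flip r) he)

theorem ncard_tangleRels_image {W : Type} {B A : Set V} {e : V → W}
    (he : Function.Injective e) :
    (tangleRels (e '' B) (e '' A)).ncard = (tangleRels B A).ncard := by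
  refine Set.ncard_congr (fun r _ a b => r (e a) (e b)) ?_ ?_ ?_
  · rintro r ⟨h, hr⟩
    refine ⟨(TangleRel.map he).2 h, fun a b hab => ?_⟩
    obtain ⟨⟨a', ha, ha'⟩, b', hb, hb'⟩ := hr _ _ hab
    exact ⟨he ha' ▸ ha, he hb' ▸ hb⟩
  · rintro r r' ⟨-, hr⟩ ⟨-, hr'⟩ heq
    funext x y
    rw [eq_iff_iff]
    constructor
    · intro h
      obtain ⟨⟨a, -, rfl⟩, b, -, rfl⟩ := hr _ _ h
      exact (congrFun (congrFun heq a) b).mp h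
    · intro h
      obtain ⟨⟨a, -, rfl⟩, b, -, rfl⟩ := hr' _ _ h
      exact (congrFun (congrFun heq a) b).mpr h
  · rintro r ⟨h, hr⟩
    have key : ∀ a b, (∃ a', ∃ b', r a' b' ∧ e a' = e a ∧ e b' = e b) ↔ r a b := by
      intro a b
      constructor
      · rintro ⟨a', b', h, ha, hb⟩
        exact he ha ▸ he hb ▸ h
      · exact fun h => ⟨a, b, h, rfl, rfl⟩
    refine ⟨fun x y => ∃ a' b', r a' b' ∧ e a' = x ∧ e b' = y, ⟨?_, ?_⟩, ?_⟩
    · rw [← TangleRel.map he]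
      simpa only [key] using h
    · rintro _ _ ⟨a, b, hab, rfl, rfl⟩
      exact ⟨⟨a, (hr a b hab).1, rfl⟩, b, (hr a b hab).2, rfl⟩
    · funext a b
      exact propext (key a b)

/-- The relations that make the two summands the bottom and the top of a tangle. -/
def stdTangleRels (i j : ℕ) : Set (Fin i ⊕ Fin j → Fin i ⊕ Fin j → Prop) :=
  tangleRels (Set.range Sum.inl) (Set.range Sum.inr)

theorem ncard_tangleRels {B A : Finset V} (h : Disjoint B A) :
    (tangleRels (B : Set V) (A : Set V)).ncard = (stdTangleRels B.card A.card).ncard := by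
  let e : Fin B.card ⊕ Fin A.card → V :=
    Sum.elim (fun k => (B.equivFin.symm k : V)) (fun k => (A.equivFin.symm k : V))
  have he : Function.Injective e := by
    refine Function.Injective.sumElim (Subtype.val_injective.comp (Equiv.injective _))
      (Subtype.val_injective.comp (Equiv.injective _)) fun a b hab => ?_
    exact Finset.disjoint_left.1 h (B.equivFin.symm a).2 (hab ▸ (A.equivFin.symm b).2)
  have hB : e '' Set.range Sum.inl = (B : Set V) := by
    rw [← Set.range_comp]
    ext v
    constructor
    · rintro ⟨k, rfl⟩
      exact (B.equivFin.symm k).2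
    · intro hv
      exact ⟨B.equivFin ⟨v, hv⟩, by simp [e]⟩
  have hA : e '' Set.range Sum.inr = (A : Set V) := by
    rw [← Set.range_comp]
    ext v
    constructor
    · rintro ⟨k, rfl⟩
      exact (A.equivFin.symm k).2
    · intro hv
      exact ⟨A.equivFin ⟨v, hv⟩, by simp [e]⟩
  rw [← hB, ← hA, ncard_tangleRels_image he, stdTangleRels]

theorem finite_tangleRels {B A : Set V} (hB : B.Finite) (hA : A.Finite) :
    (tangleRels B A).Finite := by
  have : (fun r : V → V → Prop => {p : V × V | r p.1 p.2}) '' tangleRels B A ⊆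
      𝒫 (B ×ˢ A) := by
    rintro _ ⟨r, ⟨-, hr⟩, rfl⟩ ⟨a, b⟩ hab
    exact hr a b hab
  refine Set.Finite.of_finite_image ((hB.prod hA).finite_subsets.subset this) ?_
  intro r _ r' _ h
  funext a b
  exact propext (Set.ext_iff.1 h (a, b))

theorem ncard_fillings_tangle (i : ℕ) (X : Finset V) :
    (fillings [.t i] (X : Set V)).Finite ∧ (fillings [.t i] (X : Set V)).ncard =
      ∑ B ∈ X.powerset, (stdTangleRels B.card (X \ B).card).ncard := by
  have hU : fillings [.t i] (X : Set V) = ⋃ B ∈ X.powerset,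
      {T ∈ fillings [.t i] (X : Set V) | {v ∈ (X : Set V) | T.1 v = i} = (B : Set V)} := by
    ext T
    simp only [Set.mem_iUnion, Finset.mem_powerset, exists_prop]
    constructor
    · intro hT
      refine ⟨X.filter fun v => T.1 v = i, Finset.filter_subset _ _, hT, ?_⟩
      ext v
      simp
    · rintro ⟨B, -, hT, -⟩
      exact hT
  have hbij : ∀ B ∈ X.powerset, Set.BijOn (fun T : Filling V => T.2.1)
      {T ∈ fillings [.t i] (X : Set V) | {v ∈ (X : Set V) | T.1 v = i} = (B : Set V)}
      (tangleRels (B : Set V) ((X \ B : Finset V) : Set V)) := fun B hB => by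
    rw [Finset.coe_sdiff]
    exact bijOn_fillings_tangle i (by exact_mod_cast Finset.mem_powerset.1 hB)
  have hfin : ∀ B ∈ X.powerset,
      {T ∈ fillings [.t i] (X : Set V) | {v ∈ (X : Set V) | T.1 v = i} = (B : Set V)}.Finite :=
    fun B hB => (hbij B hB).finite_iff_finite.2
      (finite_tangleRels (Finset.finite_toSet _) (Finset.finite_toSet _))
  constructor
  · rw [hU]
    exact Set.Finite.biUnion (Finset.finite_toSet _) hfin
  · rw [hU, ncard_biUnion_finset hfin]
    · refine Finset.sum_congr rfl fun B hB => ?_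
      rw [← ncard_tangleRels Finset.disjoint_sdiff, ← (hbij B hB).image_eq,
        (hbij B hB).injOn.ncard_image]
    · intro B _ B' _ hne
      rw [Function.onFun, Set.disjoint_left]
      rintro T ⟨-, h⟩ ⟨-, h'⟩
      exact hne (by exact_mod_cast h.symm.trans h')

/-- The exponential generating function of the structures with a given word. -/
def wordEGF (w : List Letter) : PowerSeries ℚ :=
  (PowerSeries.exp ℚ - 1) ^ w.countP isC * tangleDiag ^ w.countP isT

theorem wordEGF_cons (x : Letter) (w : List Letter) : wordEGF (x :: w) = wordEGF [x] * wordEGF w := by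
  rcases x with i | i <;> simp [wordEGF, List.countP_cons, pow_succ] <;> ring

/-- The number depends on the letters only through their kinds, not through their levels. The
hypothesis `hstd`, supplied by `numTangles_eq`, links tangles as posets with tangle relations. -/
theorem ncard_fillings (hstd : ∀ i j, numTangles i j = (stdTangleRels i j).ncard)
    (w : List Letter) (s : Finset V) : (fillings w (s : Set V)).Finite ∧
      ((fillings w (s : Set V)).ncard : ℚ) = egfCount (wordEGF w) s.card := by
  have single : ∀ x (X : Finset V), (fillings [x] (X : Set V)).Finite ∧
      ((fillings [x] (X : Set V)).ncard : ℚ) = egfCount (wordEGF [x]) X.card := by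
    intro x X
    rcases x with i | i
    · have hE : wordEGF [.c i] = PowerSeries.exp ℚ - 1 := by simp [wordEGF]
      rw [hE, egfCount_exp_sub_one]
      rcases X.eq_empty_or_nonempty with rfl | hX
      · have : fillings [.c i] ((∅ : Finset V) : Set V) = ∅ := by
          rw [Set.eq_empty_iff_forall_notMem]
          intro T hT
          have e := fillings_singleton hT
          obtain ⟨h, -⟩ := hT
          rw [e, isDecomp_singleton] at h
          simpa using h.2.2.nonempty
        rw [this]
        simp
      · rw [fillings_clone i (by exact_mod_cast hX)]
        simp [hX.ne_empty]
    · have hE : wordEGF [.t i] = tangleDiag := by simp [wordEGF]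
      obtain ⟨h1, h2⟩ := ncard_fillings_tangle i X
      refine ⟨h1, ?_⟩
      rw [hE, egfCount_tangleDiag, h2]
      push_cast
      exact Finset.sum_congr rfl fun B _ => by rw [hstd]
  induction w generalizing s with
  | nil =>
    have hE : wordEGF [] = 1 := by simp [wordEGF]
    rw [hE, egfCount_one]
    rcases s.eq_empty_or_nonempty with rfl | hs
    · rw [Finset.coe_empty, fillings_nil_empty]
      simp
    · rw [fillings_nil _ (by exact_mod_cast hs)]
      simp [hs.ne_empty]
  | cons x w ih =>
    have hbij : ∀ X ∈ s.powerset, Set.BijOn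
        (fun T : Filling V => (restr T X [(x, (X : Set V))],
          restr T ((s \ X : Finset V) : Set V) T.2.2.tail))
        {T ∈ fillings (x :: w) (s : Set V) | ∃ L, T.2.2 = (x, (X : Set V)) :: L}
        (fillings [x] (X : Set V) ×ˢ fillings w ((s \ X : Finset V) : Set V)) := fun X hX => by
      rw [Finset.coe_sdiff]
      exact bijOn_fillings_cons (by exact_mod_cast Finset.mem_powerset.1 hX)
    have hfin : ∀ X ∈ s.powerset,
        {T ∈ fillings (x :: w) (s : Set V) | ∃ L, T.2.2 = (x, (X : Set V)) :: L}.Finite :=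
      fun X hX => (hbij X hX).finite_iff_finite.2 ((single x X).1.prod (ih (s \ X)).1)
    rw [fillings_cons_eq]
    refine ⟨Set.Finite.biUnion (Finset.finite_toSet _) hfin, ?_⟩
    rw [ncard_biUnion_finset hfin, wordEGF_cons, egfCount_mul]
    · push_cast
      refine Finset.sum_congr rfl fun X hX => ?_
      rw [← (single x X).2, ← (ih (s \ X)).2, ← Nat.cast_mul, ← Set.ncard_prod,
        ← (hbij X hX).image_eq, (hbij X hX).injOn.ncard_image]
    · intro X _ X' _ hne
      rw [Function.onFun, Set.disjoint_left]
      rintro T ⟨-, L, h⟩ ⟨-, L', h'⟩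
      rw [h] at h'
      simp only [List.cons.injEq, Prod.mk.injEq, Finset.coe_inj, true_and] at h'
      exact hne h'.1

end Fillings

/-! ### Levels -/

/-- `ℓ` numbers the levels of `P` from `0`. -/
structure IsLevel (P : Type) [PartialOrder P] (ℓ : P → ℕ) : Prop where
  lt_of_lt : ∀ a b : P, a < b → ℓ a < ℓ b
  exists_lt : ∀ b : P, 0 < ℓ b → ∃ a, a < b ∧ ℓ a + 1 = ℓ b

section Level

variable {P : Type} [PartialOrder P]

theorem exists_isLevel [Finite P] : ∃ ℓ : P → ℕ, IsLevel P ℓ := by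
  have := Fintype.ofFinite P
  have hfin : ∀ a : P, Order.height a < ⊤ := fun a =>
    lt_of_le_of_lt (Order.height_le (n := (Fintype.card P : ℕ∞)) fun p _ => by
      exact_mod_cast p.length_lt_card.le) (ENat.natCast_lt_top _)
  have hcoe : ∀ a : P, ((Order.height a).toNat : ℕ∞) = Order.height a := fun a =>
    ENat.natCast_toNat (hfin a).ne
  refine ⟨fun a => (Order.height a).toNat, fun a b hab => ?_, fun b hb => ?_⟩
  · have := Order.height_strictMono hab (hfin a)
    rw [← hcoe a, ← hcoe b] at this
    exact_mod_cast this
  · have h1 : (((Order.height b).toNat - 1 : ℕ) : ℕ∞) < Order.height b := by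
      conv_rhs => rw [← hcoe b]
      exact_mod_cast Nat.sub_lt hb one_pos
    obtain ⟨a, hab, ha⟩ := (Order.coe_lt_height_iff (hfin b)).1 h1
    refine ⟨a, hab, ?_⟩
    simp only [ha, ENat.toNat_natCast]
    omega

namespace IsLevel

variable {ℓ : P → ℕ} (h : IsLevel P ℓ)

include h

theorem lowLevels_eq (k : ℕ) : lowLevels P k = {v | ℓ v < k} := by
  induction k with
  | zero => simp [lowLevels]
  | succ k ih =>
    rw [lowLevels, ih]
    ext v
    simp only [Set.mem_union, Set.mem_ofPred_eq, not_lt]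
    constructor
    · rintro (hv | hv)
      · omega
      · by_contra! hlt
        obtain ⟨u, hu, huv⟩ := h.exists_lt v (by omega)
        exact hu.not_ge (hv.2 (show k ≤ ℓ u by omega) hu.le)
    · intro hv
      rcases Nat.lt_succ_iff_lt_or_eq.1 hv with hv | rfl
      · exact Or.inl hv
      · refine Or.inr ⟨le_rfl, fun u hu huv => ?_⟩
        rcases huv.lt_or_eq with hlt | rfl
        · exact absurd (h.lt_of_lt _ _ hlt) (not_lt.2 hu)
        · exact le_rfl

theorem level_eq (v : P) : level v = ℓ v + 1 := by
  have : {k | v ∈ lowLevels P k} = Set.Ici (ℓ v + 1) := by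
    ext k
    rw [Set.mem_ofPred_eq, h.lowLevels_eq]
    exact Nat.succ_le_iff.symm
  rw [level, this]
  exact csInf_Ici

theorem unique {ℓ' : P → ℕ} (h' : IsLevel P ℓ') : ℓ = ℓ' := by
  funext v
  have h1 := h.level_eq v
  have h2 := h'.level_eq v
  omega

theorem grounded : Grounded ℓ (· < ·) (Set.univ : Set P) := fun v _ hv => by
  obtain ⟨u, huv, hu⟩ := h.exists_lt v hv
  exact ⟨u, trivial, huv, hu⟩

/-- Descend from $b$ by two levels to a chain $y<z<b$. The level of $y$ is at least that of $a$, so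
$y\not<a$, and freeness leaves $a<b$. -/
theorem layered (hf : FreeOn (· < ·) (Set.univ : Set P)) :
    Layered ℓ (· < ·) (Set.univ : Set P) := by
  refine ⟨fun a _ b _ hab => ?_, fun a _ b _ hab => h.lt_of_lt a b hab⟩
  obtain ⟨z, hzb, hz⟩ := h.exists_lt b (by omega)
  obtain ⟨y, hyz, hy⟩ := h.exists_lt z (by omega)
  rcases hf y trivial z trivial b trivial a trivial hyz hzb with hya | hab'
  · have := h.lt_of_lt _ _ hya
    omega
  · exact hab'

end IsLevel

theorem freeOn_iff : FreeOn (· < ·) (Set.univ : Set P) ↔ IsFree P := by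
  constructor
  · rintro h ⟨a, b, c, d, hab, hbc, ha, -, hc⟩
    rcases h a trivial b trivial c trivial d trivial hab hbc with h | h
    · exact ha.2 h.le
    · exact hc.1 h.le
  · intro h a _ b _ c _ d _ hab hbc
    by_contra! hno
    refine h ⟨a, b, c, d, hab, hbc, ⟨fun hda => ?_, fun had => ?_⟩, ⟨fun hdb => ?_, fun hbd => ?_⟩,
      fun hdc => ?_, fun hcd => ?_⟩
    · exact hno.2 (hda.trans_lt (hab.trans hbc))
    · rcases had.lt_or_eq with had | rfl
      · exact hno.1 had
      · exact hno.2 (hab.trans hbc)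
    · exact hno.2 (hdb.trans_lt hbc)
    · exact hno.1 (hab.trans_le hbd)
    · rcases hdc.lt_or_eq with hdc | rfl
      · exact hno.2 hdc
      · exact hno.1 (hab.trans hbc)
    · exact hno.1 ((hab.trans hbc).trans_le hcd)

theorem isLevel_of_grounded {ℓ : P → ℕ} (hl : Layered ℓ (· < ·) (Set.univ : Set P))
    (hg : Grounded ℓ (· < ·) (Set.univ : Set P)) : IsLevel P ℓ :=
  ⟨fun a b hab => hl.near a trivial b trivial hab, fun b hb => by
    obtain ⟨u, -, hub, hu⟩ := hg b trivial hb
    exact ⟨u, hub, hu⟩⟩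

end Level

/-- The partial order of a layered structure. -/
@[reducible]
def Layered.toPartialOrder {V : Type} {ℓ : V → ℕ} {lt : V → V → Prop}
    (h : Layered ℓ lt Set.univ) : PartialOrder V where
  le a b := a = b ∨ lt a b
  lt := lt
  le_refl a := Or.inl rfl
  le_trans := by
    rintro a b c (rfl | hab) (rfl | hbc)
    · exact Or.inl rfl
    · exact Or.inr hbc
    · exact Or.inr hab
    · have h1 := h.near a trivial b trivial hab
      have h2 := h.near b trivial c trivial hbc
      exact Or.inr (h.far a trivial c trivial (by omega))
  le_antisymm := by
    rintro a b (rfl | hab) (hba | hba)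
    · rfl
    · rfl
    · exact hba.symm
    · have h1 := h.near a trivial b trivial hab
      have h2 := h.near b trivial a trivial hba
      omega
  lt_iff_le_not_ge a b := by
    constructor
    · intro hab
      have h1 := h.near a trivial b trivial hab
      refine ⟨Or.inr hab, ?_⟩
      rintro (rfl | hba)
      · omega
      · have h2 := h.near b trivial a trivial hba
        omega
    · rintro ⟨rfl | hab, hba⟩
      · exact absurd (Or.inl rfl) hba
      · exact hab

/-! ### The parts of a poset -/

section Components

variable {V : Type} {r : V → V → Prop} {G : SimpleGraph V}

theorem supp_eq_of_cutConn (hG : ∀ x y, G.Adj x y ↔ Splits r Set.univ x y) {B A : Set V}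
    (hA : CutConn r B A) (hcl : ∀ x ∈ A, ∀ y, Splits r Set.univ x y → y ∈ A) {a : V} (ha : a ∈ A) :
    (G.connectedComponentMk a).supp = A := by
  ext y
  rw [SimpleGraph.ConnectedComponent.mem_supp_iff, SimpleGraph.ConnectedComponent.eq]
  constructor
  · intro h
    obtain ⟨p⟩ := h.symm
    induction p with
    | nil => exact ha
    | cons hadj _ ih => exact ih (hcl _ ha _ ((hG _ _).1 hadj)) (by
        exact (SimpleGraph.Walk.reachable ‹_›).symm)
  · intro hy
    have := hA.eq_of_splits (f := fun z => G.Reachable z a) (fun u _ v _ huv => by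
      have hadj : G.Adj u v := (hG u v).2 (huv.mono (Set.subset_univ _))
      exact propext ⟨fun h => hadj.symm.reachable.trans h, fun h => hadj.reachable.trans h⟩) ha hy
    exact this.mp (SimpleGraph.Reachable.refl _)

/-- A family of connected sets, closed under adjacency and meeting every edge, consists of exactly
the nontrivial components. It is used for tangle tops and, with the relation flipped, for tangle
bottoms. -/
theorem component_iff (hG : ∀ x y, G.Adj x y ↔ Splits r Set.univ x y) {F : Set (Set V)}
    (hF : ∀ A ∈ F, ∃ B, CutConn r B A) (hcl : ∀ A ∈ F, ∀ x ∈ A, ∀ y, Splits r Set.univ x y → y ∈ A)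
    (hcov : ∀ x y, Splits r Set.univ x y → ∃ A ∈ F, x ∈ A) (A : Set V) :
    (A.Nontrivial ∧ ∃ C : G.ConnectedComponent, C.supp = A) ↔ A ∈ F := by
  constructor
  · rintro ⟨hA, C, rfl⟩
    obtain ⟨a, ha, b, hb, hab⟩ := hA
    have hreach : G.Reachable a b := by
      rw [SimpleGraph.ConnectedComponent.mem_supp_iff] at ha hb
      exact SimpleGraph.ConnectedComponent.exact (ha.trans hb.symm)
    obtain ⟨p⟩ := hreach
    cases p with
    | nil => exact absurd rfl hab
    | cons hadj p =>
      obtain ⟨A, hA, haA⟩ := hcov _ _ ((hG _ _).1 hadj)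
      obtain ⟨B, hB⟩ := hF A hA
      have := supp_eq_of_cutConn hG hB (hcl A hA) haA
      rw [SimpleGraph.ConnectedComponent.mem_supp_iff] at ha
      rw [← ha, this]
      exact hA
  · intro hA
    obtain ⟨B, hB⟩ := hF A hA
    refine ⟨hB.1, ?_⟩
    obtain ⟨a, ha⟩ := hB.1.nonempty
    exact ⟨_, supp_eq_of_cutConn hG hB (hcl A hA) ha⟩

end Components

section Parts

variable {P : Type} [PartialOrder P]

theorem topGraph_adj (x y : P) : (topGraph P).Adj x y ↔ Splits (· < ·) Set.univ x y := by
  simp only [topGraph, Splits, Set.not_subset, Set.mem_Iio, Set.mem_univ, true_and]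

theorem botGraph_adj (x y : P) : (botGraph P).Adj x y ↔ Splits (flip (· < ·)) Set.univ x y := by
  simp only [botGraph, Splits, Set.not_subset, Set.mem_Ioi, Set.mem_univ, true_and, flip]

/-- The part given by a set of vertices and its letter. -/
def toPart (ℓ : P → ℕ) : Letter × Set P → Part P
  | (.c _, X) => .clone X
  | (.t i, X) => .tangle {v ∈ X | ℓ v = i + 1} {v ∈ X | ℓ v = i}

theorem verts_toPart {ℓ : P → ℕ} {p : Letter × Set P} (hp : Piece ℓ (· < ·) p.1 p.2) :
    (toPart ℓ p).verts = p.2 := by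
  obtain ⟨x, X⟩ := p
  rcases x with i | i
  · rfl
  · ext v
    simp only [toPart, Part.verts, Set.mem_union, Set.mem_ofPred_eq]
    have := hp.1 v
    tauto

namespace IsDecomp

variable {ℓ : P → ℕ} {L : List (Letter × Set P)}

theorem eq_of_mem (h : IsDecomp ℓ (· < ·) Set.univ L) {p q : Letter × Set P} (hp : p ∈ L)
    (hq : q ∈ L) {v : P} (hvp : v ∈ p.2) (hvq : v ∈ q.2) : p = q := by
  obtain ⟨j, hj, rfl⟩ := List.getElem_of_mem hp
  obtain ⟨k, hk, rfl⟩ := List.getElem_of_mem hq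
  obtain rfl : j = k := (h.pos_eq hj hvp).symm.trans (h.pos_eq hk hvq)
  rfl

theorem exists_tangle (h : IsDecomp ℓ (· < ·) Set.univ L) {x y : P} (hxy : pos L x = pos L y)
    (hℓ : ℓ y = ℓ x + 1) : ∃ i X, (.t i, X) ∈ L ∧ x ∈ X ∧ y ∈ X ∧ ℓ x = i ∧ ℓ y = i + 1 := by
  have hp := h.piece_pos (v := x) trivial
  have hx := h.mem_pos (v := x) trivial
  have hy := (h.mem_iff_pos (v := y) trivial (h.pos_lt (v := x) trivial)).2 hxy.symm
  have hm := List.getElem_mem (h.pos_lt (v := x) trivial)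
  generalize L[pos L x]'(h.pos_lt trivial) = p at *
  obtain ⟨l, X⟩ := p
  have h1 := hp.lo_hi.2.2 x hx
  have h2 := hp.lo_hi.2.2 y hy
  rcases l with i | i
  · simp only [lo_c, hi_c] at h1 h2
    omega
  · simp only [lo_t, hi_t] at h1 h2
    exact ⟨i, X, hm, hx, hy, by omega, by omega⟩

/-- Vertices with incomparable downsets share a level and a part, and the vertices that split them
are squeezed into that part one level lower, so it is a tangle. -/
theorem isTangleTop_iff (h : IsDecomp ℓ (· < ·) Set.univ L) (A : Set P) :
    IsTangleTop A ↔ ∃ i X, (.t i, X) ∈ L ∧ A = {v ∈ X | ℓ v = i + 1} := by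
  refine component_iff (r := (· < ·)) (F := {A | ∃ i X, (.t i, X) ∈ L ∧ A = {v ∈ X | ℓ v = i + 1}})
    topGraph_adj ?_ ?_ ?_ A
  · rintro _ ⟨i, X, hX, rfl⟩
    exact ⟨_, (h.piece _ hX).2.1⟩
  · rintro _ ⟨i, X, hX, rfl⟩ x ⟨hx, hxi⟩ y hxy
    obtain ⟨h1, h2⟩ := h.splits_below (x := x) (y := y) trivial trivial hxy
    obtain ⟨k, hk, hkX⟩ := List.getElem_of_mem hX
    have hxk := h.pos_eq (v := x) hk (by rwa [hkX])
    have := (h.mem_iff_pos (v := y) trivial hk).2 (by omega)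
    rw [hkX] at this
    exact ⟨this, by omega⟩
  · intro x y hxy
    obtain ⟨h1, h2⟩ := h.splits_below (x := x) (y := y) trivial trivial hxy
    obtain ⟨⟨b, -, hbx, hby⟩, -⟩ := hxy
    obtain ⟨h3, h4⟩ := (h.below (b := b) (x := x) (y := y) trivial trivial trivial hbx hby).2 h1
    obtain ⟨i, X, hX, -, hxX, -, hi⟩ := h.exists_tangle (x := b) (y := x) (by omega) h3
    exact ⟨_, ⟨i, X, hX, rfl⟩, hxX, hi⟩

theorem isTangleBot_iff (h : IsDecomp ℓ (· < ·) Set.univ L) (B : Set P) :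
    IsTangleBot B ↔ ∃ i X, (.t i, X) ∈ L ∧ B = {v ∈ X | ℓ v = i} := by
  refine component_iff (r := flip (· < ·)) (F := {A | ∃ i X, (.t i, X) ∈ L ∧ A = {v ∈ X | ℓ v = i}})
    botGraph_adj ?_ ?_ ?_ B
  · rintro _ ⟨i, X, hX, rfl⟩
    exact ⟨_, (h.piece _ hX).2.2⟩
  · rintro _ ⟨i, X, hX, rfl⟩ x ⟨hx, hxi⟩ y hxy
    obtain ⟨h1, h2⟩ := h.splits_above (x := x) (y := y) trivial trivial hxy
    obtain ⟨k, hk, hkX⟩ := List.getElem_of_mem hX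
    have hxk := h.pos_eq (v := x) hk (by rwa [hkX])
    have := (h.mem_iff_pos (v := y) trivial hk).2 (by omega)
    rw [hkX] at this
    exact ⟨this, by omega⟩
  · intro x y hxy
    obtain ⟨h1, h2⟩ := h.splits_above (x := x) (y := y) trivial trivial hxy
    obtain ⟨⟨b, -, hbx, hby⟩, -⟩ := hxy
    obtain ⟨h3, h4⟩ := (h.above (b := b) (x := x) (y := y) trivial trivial trivial hbx hby).2 h1
    obtain ⟨i, X, hX, hxX, -, hi, -⟩ := h.exists_tangle (x := x) (y := b) (by omega) h3
    exact ⟨_, ⟨i, X, hX, rfl⟩, hxX, hi⟩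

theorem incomp (h : IsDecomp ℓ (· < ·) Set.univ L) {x y : P} (hne : x ≠ y) (hxy : ℓ x = ℓ y) :
    Incomp x y := by
  constructor
  · intro hle
    have := h.layered.near x trivial y trivial (hle.lt_of_ne hne)
    omega
  · intro hle
    have := h.layered.near y trivial x trivial (hle.lt_of_ne hne.symm)
    omega

/-- In an induced $(2+2)$, a bottom vertex distinguishes the two top ones and so belongs to their
part; hence matched tops and bottoms come from the same letter. -/
theorem isTangle_iff (h : IsDecomp ℓ (· < ·) Set.univ L) (A B : Set P) :
    IsTangle A B ↔ ∃ i X, (.t i, X) ∈ L ∧ A = {v ∈ X | ℓ v = i + 1} ∧ B = {v ∈ X | ℓ v = i} := by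
  rw [IsTangle, h.isTangleTop_iff, h.isTangleBot_iff]
  constructor
  · rintro ⟨⟨i, X, hX, rfl⟩, ⟨j, Y, hY, rfl⟩, a₁, ha₁, a₂, ha₂, b₁, hb₁, b₂, hb₂, hlt, -, -, -, -, hinc⟩
    have hnlt : ¬ b₁ < a₂ := fun hlt => hinc.2 hlt.le
    have h1 := (h.below (b := b₁) (x := a₁) (y := a₂) trivial trivial trivial hlt hnlt).2
      (ha₁.2.trans ha₂.2.symm)
    obtain ⟨k, hk, hkX⟩ := List.getElem_of_mem hX
    have hk1 := h.pos_eq (v := a₁) hk (by rw [hkX]; exact ha₁.1)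
    have hk2 := h.pos_eq (v := a₂) hk (by rw [hkX]; exact ha₂.1)
    have hbX := (h.mem_iff_pos (v := b₁) trivial hk).2 (by omega)
    rw [hkX] at hbX
    have := h.eq_of_mem hX hY hbX hb₁.1
    simp only [Prod.mk.injEq, Letter.t.injEq] at this
    obtain ⟨rfl, rfl⟩ := this
    exact ⟨i, X, hX, rfl, rfl⟩
  · rintro ⟨i, X, hX, rfl, rfl⟩
    refine ⟨⟨i, X, hX, rfl⟩, ⟨i, X, hX, rfl⟩, ?_⟩
    have hp := h.piece _ hX
    obtain ⟨a, ha⟩ := hp.2.1.1.nonempty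
    obtain ⟨a', ha', ⟨b, hb, hba, hba'⟩, b', hb', hba₁, hba₁'⟩ := hp.2.1.exists_splits ha
    refine ⟨a, ha, a', ha', b, hb, b', hb', hba, hba₁, ?_, ?_, ?_, ?_⟩
    · refine h.incomp ?_ (ha.2.trans ha'.2.symm)
      rintro rfl
      exact hba' hba
    · refine h.incomp ?_ (hb.2.trans hb'.2.symm)
      rintro rfl
      exact hba' hba₁
    · refine ⟨fun hle => ?_, fun hle => ?_⟩
      · have h1 := ha.2
        have h2 := hb'.2
        rcases hle.lt_or_eq with hlt | rfl
        · have := h.layered.near _ trivial _ trivial hlt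
          omega
        · omega
      · rcases hle.lt_or_eq with hlt | rfl
        · exact hba₁' hlt
        · have h1 := ha.2
          have h2 := hb'.2
          omega
    · refine ⟨fun hle => ?_, fun hle => ?_⟩
      · have h1 := ha'.2
        have h2 := hb.2
        rcases hle.lt_or_eq with hlt | rfl
        · have := h.layered.near _ trivial _ trivial hlt
          omega
        · omega
      · rcases hle.lt_or_eq with hlt | rfl
        · exact hba' hlt
        · have h1 := ha'.2
          have h2 := hb.2
          omega

theorem mem_tangled_iff (h : IsDecomp ℓ (· < ·) Set.univ L) (v : P) :
    v ∈ tangled P ↔ ∃ i X, (.t i, X) ∈ L ∧ v ∈ X := by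
  constructor
  · rintro ⟨A, B, hAB, hv⟩
    obtain ⟨i, X, hX, rfl, rfl⟩ := (h.isTangle_iff A B).1 hAB
    rcases hv with hv | hv
    · exact ⟨i, X, hX, hv.1⟩
    · exact ⟨i, X, hX, hv.1⟩
  · rintro ⟨i, X, hX, hv⟩
    refine ⟨_, _, (h.isTangle_iff _ _).2 ⟨i, X, hX, rfl, rfl⟩, ?_⟩
    rcases (h.piece _ hX).1 v hv with hvi | hvi
    · exact Or.inr ⟨hv, hvi⟩
    · exact Or.inl ⟨hv, hvi⟩

/-- Groundedness makes the downset of a vertex determine its level, so clones lie on one level, as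
`pos_eq_of_clones` requires. -/
theorem cloneClass_eq (h : IsDecomp ℓ (· < ·) Set.univ L) (hc : Canonical (L.map Prod.fst))
    (hg : Grounded ℓ (· < ·) (Set.univ : Set P)) {i : ℕ} {X : Set P} (hX : (.c i, X) ∈ L) {a : P}
    (ha : a ∈ X) : {b | b ∉ tangled P ∧ Clones a b} = X := by
  have hun : ∀ v ∈ X, v ∉ tangled P := fun v hv hvt => by
    obtain ⟨j, Y, hY, hvY⟩ := (h.mem_tangled_iff v).1 hvt
    have := h.eq_of_mem hX hY hv hvY
    simp at this
  obtain ⟨k, hk, hkX⟩ := List.getElem_of_mem hX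
  have hak := h.pos_eq (v := a) hk (by rwa [hkX])
  ext b
  constructor
  · rintro ⟨hb, hd, hu⟩
    have hd' : ∀ z, z < a ↔ z < b := fun z => Set.ext_iff.1 hd z
    have hu' : ∀ z, a < z ↔ b < z := fun z => Set.ext_iff.1 hu z
    have hle : ∀ x y : P, (∀ z, z < x ↔ z < y) → ℓ y ≤ ℓ x := by
      intro x y hxy
      by_contra! hlt
      obtain ⟨u, -, huy, hul⟩ := hg y trivial (by omega)
      have := h.layered.near u trivial x trivial ((hxy u).2 huy)
      omega
    have h1 := hle a b hd'
    have h2 := hle b a fun z => (hd' z).symm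
    have h3 := h.pos_eq_of_clones hc (x := a) (y := b) trivial trivial (by omega)
      (fun z _ => hd' z) fun z _ => hu' z
    have := (h.mem_iff_pos (v := b) trivial hk).2 (by omega)
    rwa [hkX] at this
  · intro hb
    have hbk := h.pos_eq (v := b) hk (by rwa [hkX])
    have hlab : ∀ v, pos L v = k → (L[pos L v]'(h.pos_lt trivial)).1 = .c i := by
      rintro v rfl
      rw [hkX]
    obtain ⟨-, h1, h2⟩ := h.clones_of_pos_eq (x := a) (y := b) trivial trivial (by omega)
      (hlab a hak)
    obtain ⟨-, h3, h4⟩ := h.clones_of_pos_eq (x := b) (y := a) trivial trivial (by omega)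
      (hlab b hbk)
    exact ⟨hun b hb, Set.ext fun z => ⟨h1 z trivial, h3 z trivial⟩,
      Set.ext fun z => ⟨h2 z trivial, h4 z trivial⟩⟩

theorem isCloneSet_iff (h : IsDecomp ℓ (· < ·) Set.univ L) (hc : Canonical (L.map Prod.fst))
    (hg : Grounded ℓ (· < ·) (Set.univ : Set P)) (C : Set P) :
    IsCloneSet C ↔ ∃ i, (.c i, C) ∈ L := by
  constructor
  · rintro ⟨a, ha, rfl⟩
    obtain ⟨⟨x, X⟩, hX, haX⟩ := (h.cover a).1 trivial
    rcases x with i | i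
    · rw [h.cloneClass_eq hc hg hX haX]
      exact ⟨i, hX⟩
    · exact absurd ((h.mem_tangled_iff a).2 ⟨i, X, hX, haX⟩) ha
  · rintro ⟨i, hC⟩
    obtain ⟨a, ha⟩ := (h.piece _ hC).1
    have := h.cloneClass_eq hc hg hC ha
    refine ⟨a, ?_, this.symm⟩
    rw [← this] at ha
    exact ha.1

theorem isPart_iff (h : IsDecomp ℓ (· < ·) Set.univ L) (hc : Canonical (L.map Prod.fst))
    (hg : Grounded ℓ (· < ·) (Set.univ : Set P)) (X : Part P) :
    X.IsPart ↔ ∃ p ∈ L, toPart ℓ p = X := by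
  rcases X with C | ⟨A, B⟩
  · rw [Part.IsPart, h.isCloneSet_iff hc hg]
    constructor
    · rintro ⟨i, hC⟩
      exact ⟨_, hC, rfl⟩
    · rintro ⟨⟨x, X⟩, hX, hp⟩
      rcases x with i | i
      · simp only [toPart, Part.clone.injEq] at hp
        exact ⟨i, hp ▸ hX⟩
      · simp [toPart] at hp
  · rw [Part.IsPart, h.isTangle_iff]
    constructor
    · rintro ⟨i, X, hX, rfl, rfl⟩
      exact ⟨_, hX, rfl⟩
    · rintro ⟨⟨x, X⟩, hX, hp⟩
      rcases x with i | i
      · simp [toPart] at hp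
      · simp only [toPart, Part.tangle.injEq] at hp
        exact ⟨i, X, hX, hp.1.symm, hp.2.symm⟩

theorem toPart_injOn (h : IsDecomp ℓ (· < ·) Set.univ L) {p q : Letter × Set P} (hp : p ∈ L)
    (hq : q ∈ L) (hpq : toPart ℓ p = toPart ℓ q) : p = q := by
  obtain ⟨v, hv⟩ := (h.piece p hp).nonempty
  refine h.eq_of_mem hp hq hv ?_
  rw [← verts_toPart (h.piece q hq), ← hpq, verts_toPart (h.piece p hp)]
  exact hv

theorem hasLetter_iff (h : IsDecomp ℓ (· < ·) Set.univ L) (hℓ : IsLevel P ℓ) {p : Letter × Set P}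
    (hp : p ∈ L) (x : Letter) : HasLetter (toPart ℓ p) x ↔ x = p.1 := by
  have hpc := h.piece p hp
  obtain ⟨y, X⟩ := p
  rcases y with i | i <;> rcases x with j | j <;> simp only [toPart, HasLetter, hℓ.level_eq]
  · obtain ⟨⟨v, hv⟩, hX⟩ := hpc
    simp only [Letter.c.injEq]
    constructor
    · intro hj
      have h1 := hj v hv
      have h2 := hX v hv
      omega
    · rintro rfl u hu
      rw [hX u hu]
  · simp
  · simp
  · simp only [Letter.t.injEq]
    obtain ⟨v, hv⟩ := hpc.2.1.1.nonempty
    constructor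
    · rintro ⟨-, hj⟩
      have h1 := hj v hv
      have h2 := hv.2
      omega
    · rintro rfl
      exact ⟨fun u hu => by rw [hu.2], fun u hu => by rw [hu.2]⟩

theorem isWordOf (h : IsDecomp ℓ (· < ·) Set.univ L) (hc : Canonical (L.map Prod.fst))
    (hℓ : IsLevel P ℓ) : IsWordOf P (L.map Prod.fst) := by
  refine ⟨L.map (toPart ℓ), ⟨?_, fun X => ?_, ?_⟩, ?_⟩
  · exact List.Nodup.map_on (fun p hp q hq => h.toPart_injOn hp hq) h.nodup
  · rw [h.isPart_iff hc hℓ.grounded, List.mem_map]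
  · intro i j hij a ha b hb
    have hi : (i : ℕ) < L.length := by simpa using i.2
    have hj : (j : ℕ) < L.length := by simpa using j.2
    simp only [List.get_eq_getElem, List.getElem_map] at ha hb
    rw [verts_toPart (h.piece _ (List.getElem_mem hi))] at ha
    rw [verts_toPart (h.piece _ (List.getElem_mem hj))] at hb
    have hia := h.pos_eq hi ha
    have hjb := h.pos_eq hj hb
    rw [hℓ.level_eq, hℓ.level_eq]
    have hne : (i : ℕ) ≠ j := fun h => hij (Fin.ext h)
    have h1 := h.layered.near a trivial b trivial
    have h2 := h.layered.far a trivial b trivial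
    constructor
    · intro hab
      by_cases hl : ℓ b = ℓ a + 1
      · have := h.pos_le_of_lt (a := a) (b := b) trivial trivial hl hab
        refine Or.inr ⟨by omega, ?_⟩
        rw [Fin.lt_def]
        omega
      · have := h1 hab
        exact Or.inl (by omega)
    · rintro (hl | ⟨hl, hlt⟩)
      · exact h2 (by omega)
      · rw [Fin.lt_def] at hlt
        exact (h.precedes (a := a) (b := b) trivial trivial (by omega)).1 (by omega)
  · rw [List.forall₂_map_left_iff, List.forall₂_map_right_iff, List.forall₂_same]
    exact fun p hp => (h.hasLetter_iff hℓ hp _).2 rfl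

theorem eq_map_of_forall₂ (h : IsDecomp ℓ (· < ·) Set.univ L) (hℓ : IsLevel P ℓ) :
    ∀ {M : List (Part P)} {w : List Letter}, (∀ X ∈ M, ∃ p ∈ L, toPart ℓ p = X) →
      List.Forall₂ HasLetter M w →
        ∃ N : List (Letter × Set P), (∀ p ∈ N, p ∈ L) ∧ M = N.map (toPart ℓ) ∧ w = N.map Prod.fst
  | _, _, _, .nil => ⟨[], by simp, rfl, rfl⟩
  | X :: M, x :: w, hM, .cons hx hw => by
    obtain ⟨N, hN, rfl, rfl⟩ := h.eq_map_of_forall₂ hℓ (fun X hX => hM X (by simp [hX])) hw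
    obtain ⟨p, hp, rfl⟩ := hM X (by simp)
    refine ⟨p :: N, ?_, rfl, by rw [(h.hasLetter_iff hℓ hp x).1 hx]; rfl⟩
    intro q hq
    rcases List.mem_cons.1 hq with rfl | hq
    · exact hp
    · exact hN q hq

/-- Every compatible listing is itself a decomposition with the same parts, though perhaps not a
canonical one. So the skeleton does not depend on the listing. -/
theorem exists_of_isWordOf (h : IsDecomp ℓ (· < ·) Set.univ L) (hc : Canonical (L.map Prod.fst))
    (hℓ : IsLevel P ℓ) {w : List Letter} (hw : IsWordOf P w) :
    trace w = trace (L.map Prod.fst) ∧ w.Perm (L.map Prod.fst) := by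
  obtain ⟨M, ⟨hnd, hmem, hord⟩, hforall⟩ := hw
  obtain ⟨N, hN, rfl, rfl⟩ := h.eq_map_of_forall₂ hℓ
    (fun X hX => (h.isPart_iff hc hℓ.grounded X).1 ((hmem X).1 hX)) hforall
  have hmem' : ∀ p, p ∈ L ↔ p ∈ N := by
    refine fun p => ⟨fun hp => ?_, hN p⟩
    have := (hmem (toPart ℓ p)).2 ((h.isPart_iff hc hℓ.grounded _).2 ⟨p, hp, rfl⟩)
    obtain ⟨q, hq, hqp⟩ := List.mem_map.1 this
    exact h.toPart_injOn (hN q hq) hp hqp ▸ hq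
  have hndN : N.Nodup := List.Nodup.of_map _ hnd
  have hdec : IsDecomp ℓ (· < ·) Set.univ N := by
    refine ⟨h.layered, fun p hp => h.piece p (hN p hp), ?_, fun v => ?_⟩
    · rw [List.pairwise_iff_getElem]
      intro i j hi hj hij
      have hpi := hN _ (List.getElem_mem hi)
      have hpj := hN _ (List.getElem_mem hj)
      refine ⟨Set.disjoint_left.2 fun v hvi hvj => ?_, fun a ha b hb => ?_⟩
      · exact hij.ne ((hndN.getElem_inj_iff).1 (h.eq_of_mem hpi hpj hvi hvj))
      · have hi' : i < (N.map (toPart ℓ)).length := by simpa using hi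
        have hj' : j < (N.map (toPart ℓ)).length := by simpa using hj
        have ha' : a ∈ ((N.map (toPart ℓ)).get ⟨i, hi'⟩).verts := by
          simp only [List.get_eq_getElem, List.getElem_map]
          rwa [verts_toPart (h.piece _ hpi)]
        have hb' : b ∈ ((N.map (toPart ℓ)).get ⟨j, hj'⟩).verts := by
          simp only [List.get_eq_getElem, List.getElem_map]
          rwa [verts_toPart (h.piece _ hpj)]
        have h1 := hord ⟨i, hi'⟩ ⟨j, hj'⟩ (fun h => hij.ne (Fin.mk.inj h)) a ha' b hb'
        have h2 := hord ⟨j, hj'⟩ ⟨i, hi'⟩ (fun h => hij.ne' (Fin.mk.inj h)) b hb' a ha'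
        rw [hℓ.level_eq, hℓ.level_eq] at h1 h2
        simp only [Fin.mk_lt_mk] at h1 h2
        refine ⟨fun hl => h1.2 (Or.inr ⟨by omega, hij⟩), fun hl hba => ?_⟩
        have := h2.1 hba
        omega
    · rw [h.cover]
      simp only [hmem']
  have hperm : L.Perm N := (List.perm_ext_iff_of_nodup h.nodup hndN).2 hmem'
  exact ⟨(h.filterEq hdec hc hmem').trace_eq.symm, (hperm.map _).symm⟩

end IsDecomp

theorem exists_canonical_decomp [Finite P] (hf : IsFree P) : ∃ ℓ L, IsLevel P ℓ ∧
    IsDecomp ℓ (· < ·) (Set.univ : Set P) L ∧ L.map Prod.fst ∈ wordsBelow 1 := by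
  obtain ⟨ℓ, hℓ⟩ := exists_isLevel (P := P)
  have hfree := freeOn_iff.2 hf
  obtain ⟨L, hL, hc⟩ := exists_isDecomp Set.finite_univ (hℓ.layered hfree) hfree
  exact ⟨ℓ, L, hℓ, hL, hc, fun x hx => by
    rw [(hL.grounded_iff hc).1 hℓ.grounded x hx]
    exact one_pos⟩

end Parts

/-! ### Labelled tangles -/

section Tangles

variable {V : Type}

theorem IsTangle.mem_tangleRels [PartialOrder V] [Finite V] (hf : IsFree V) {A B : Set V}
    (h : IsTangle A B) (hAB : ∀ v, v ∈ B ∨ v ∈ A) : (· < ·) ∈ tangleRels B A := by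
  obtain ⟨ℓ, L, -, hL, -⟩ := exists_canonical_decomp hf
  obtain ⟨i, X, hX, rfl, rfl⟩ := (hL.isTangle_iff A B).1 h
  refine ⟨(hL.piece _ hX).2, fun a b hab => ?_⟩
  have := hL.layered.near a trivial b trivial hab
  rcases hAB a with ha | ha <;> rcases hAB b with hb | hb
  · have := ha.2
    have := hb.2
    omega
  · exact ⟨ha, hb⟩
  all_goals
    have := ha.2
    have := hb.2
    omega

/-- Put `B` on level $0$ and `A` on level $1$; the whole set is then a decomposition with the single
letter `t 0`. -/
theorem exists_order_of_mem_tangleRels {A B : Set V} {lt : V → V → Prop}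
    (h : lt ∈ tangleRels B A) (hd : Disjoint B A) (hAB : ∀ v, v ∈ B ∨ v ∈ A) :
    ∃ p : PartialOrder V, p.lt = lt ∧ @IsFree V p ∧ @IsTangle V p A B := by
  let ℓ : V → ℕ := fun v => if v ∈ B then 0 else 1
  have hB : {v ∈ (Set.univ : Set V) | ℓ v = 0} = B := by
    ext v
    simp [ℓ]
  have hA : {v ∈ (Set.univ : Set V) | ℓ v = 0 + 1} = A := by
    ext v
    have := hAB v
    have : v ∈ B → v ∉ A := fun hv => Set.disjoint_left.1 hd hv
    simp only [ℓ, Set.mem_ofPred_eq, Set.mem_univ, true_and]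
    split_ifs <;> simp <;> tauto
  have hℓ : ∀ v, ℓ v = 0 ∨ ℓ v = 1 := fun v => by
    simp only [ℓ]
    split_ifs <;> simp
  have hlay : Layered ℓ lt Set.univ := by
    refine ⟨fun a _ b _ hab => ?_, fun a _ b _ hab => ?_⟩
    · have := hℓ b
      omega
    · have := h.2 a b hab
      rw [← hB, ← hA] at this
      rw [this.1.2, this.2.2]
  have hdec : IsDecomp ℓ lt Set.univ [(.t 0, Set.univ)] := by
    refine isDecomp_singleton.2 ⟨rfl, hlay, fun v _ => hℓ v, ?_⟩
    rw [hB, hA]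
    exact h.1
  let p := hlay.toPartialOrder
  have hdec' : IsDecomp ℓ (· < ·) Set.univ [(.t 0, (Set.univ : Set V))] := hdec
  exact ⟨p, rfl, freeOn_iff.1 hdec'.freeOn,
    (hdec'.isTangle_iff A B).2 ⟨0, Set.univ, by simp, hA.symm, hB.symm⟩⟩

theorem numTangles_eq (i j : ℕ) : numTangles i j = (stdTangleRels i j).ncard := by
  have hcov : ∀ v : Fin i ⊕ Fin j,
      v ∈ Set.range (Sum.inl : Fin i → Fin i ⊕ Fin j) ∨ v ∈ Set.range Sum.inr := by
    rintro (k | k) <;> simp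
  have hdisj : Disjoint (Set.range (Sum.inl : Fin i → Fin i ⊕ Fin j)) (Set.range Sum.inr) :=
    Set.isCompl_range_inl_range_inr.disjoint
  rw [numTangles, ← Nat.card_coe_set_eq]
  refine Nat.card_eq_of_bijective (fun p =>
    ⟨p.1.lt, @IsTangle.mem_tangleRels _ p.1 _ p.2.1 _ _ p.2.2 hcov⟩) ⟨fun p q hpq => ?_, ?_⟩
  · refine Subtype.ext (PartialOrder.ext_lt fun x y => ?_)
    exact iff_of_eq (congrFun (congrFun (congrArg Subtype.val hpq) x) y)
  · rintro ⟨lt, hlt⟩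
    obtain ⟨p, rfl, h⟩ := exists_order_of_mem_tangleRels hlt hdisj hcov
    exact ⟨⟨p, h⟩, rfl⟩

theorem ncard_fillings_eq (w : List Letter) (s : Finset V) : (fillings w (s : Set V)).Finite ∧
    ((fillings w (s : Set V)).ncard : ℚ) = egfCount (wordEGF w) s.card :=
  ncard_fillings numTangles_eq w s

/-- The perfect matching, that is the poset $2+2$, is a tangle. -/
theorem stdTangleRels_two_two_nonempty : (stdTangleRels 2 2).Nonempty := by
  have key : ∀ f g : Fin 2 → Fin 2 ⊕ Fin 2, Function.Injective f → ∀ r : _ → _ → Prop,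
      (∀ k l, r (g k) (f l) ↔ k = l) → CutConn r (Set.range g) (Set.range f) := by
    intro f g hf r hr
    refine ⟨⟨f 0, ⟨0, rfl⟩, f 1, ⟨1, rfl⟩, fun h => by simpa using hf h⟩, ?_⟩
    rintro S hS ⟨x, hx⟩ ⟨y, hy⟩
    refine ⟨x, hx, y, hy, ?_⟩
    obtain ⟨k, rfl⟩ := hS hx
    obtain ⟨l, rfl⟩ := hy.1
    have hkl : k ≠ l := by
      rintro rfl
      exact hy.2 hx
    exact ⟨⟨g k, ⟨k, rfl⟩, (hr k k).2 rfl, fun h => hkl ((hr k l).1 h)⟩,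
      g l, ⟨l, rfl⟩, (hr l l).2 rfl, fun h => hkl ((hr l k).1 h).symm⟩
  refine ⟨fun a b => ∃ k, a = Sum.inl k ∧ b = Sum.inr k, ⟨?_, ?_⟩, ?_⟩
  · exact key _ _ Sum.inr_injective _ fun k l => by simp [eq_comm]
  · exact key _ _ Sum.inl_injective _ fun k l => by simp [flip]
  · rintro _ _ ⟨k, rfl, rfl⟩
    exact ⟨⟨k, rfl⟩, ⟨k, rfl⟩⟩

theorem numTangles_zero_zero : numTangles 0 0 = 0 := by
  rw [numTangles_eq, stdTangleRels,
    Set.ncard_eq_zero (finite_tangleRels (Set.toFinite _) (Set.toFinite _)), Set.eq_empty_iff_forall_notMem]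
  rintro lt ⟨h, -⟩
  obtain ⟨_, ⟨k, rfl⟩, -⟩ := h.1.1
  exact k.elim0

theorem constantCoeff_tangleDiag : PowerSeries.constantCoeff tangleDiag = 0 := by
  have := egfCount_tangleDiag (∅ : Finset ℕ)
  simpa [egfCount, numTangles_zero_zero] using this

theorem tangleDiag_ne_zero : tangleDiag ≠ 0 := by
  intro h0
  have h1 := egfCount_tangleDiag (Finset.range 4)
  rw [h0, egfCount, map_zero, mul_zero, eq_comm,
    Finset.sum_eq_zero_iff_of_nonneg fun _ _ => Nat.cast_nonneg _] at h1
  have h2 := h1 (Finset.range 2) (by decide)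
  let : DecidableEq ℕ := fun a b => Classical.propDecidable (a = b)
  rw [Finset.card_sdiff_of_subset (Finset.range_subset_range.2 (by omega)), Finset.card_range,
    Finset.card_range,
    Nat.cast_eq_zero, numTangles_eq, stdTangleRels,
    Set.ncard_eq_zero (finite_tangleRels (Set.toFinite _) (Set.toFinite _))] at h2
  exact stdTangleRels_two_two_nonempty.ne_empty h2

theorem exp_sub_one_ne_zero : PowerSeries.exp ℚ - 1 ≠ 0 := by
  intro h
  have := egfCount_exp_sub_one 1
  rw [h] at this
  simp [egfCount] at this

theorem wordEGF_ne_zero (w : List Letter) : wordEGF w ≠ 0 :=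
  mul_ne_zero (pow_ne_zero _ exp_sub_one_ne_zero) (pow_ne_zero _ tangleDiag_ne_zero)

end Tangles

/-! ### Counting structures by their words -/

section Structures

open Nat (factorial)

/-- The decomposed structures on `V` whose words belong to `W`. -/
def structures (W : Set (List Letter)) (V : Type) : Set (Filling V) :=
  {T | IsDecomp T.1 T.2.1 Set.univ T.2.2 ∧ T.2.2.map Prod.fst ∈ W}

theorem mem_fillings_univ {V : Type} {w : List Letter} {T : Filling V} :
    T ∈ fillings w Set.univ ↔ IsDecomp T.1 T.2.1 Set.univ T.2.2 ∧ T.2.2.map Prod.fst = w := by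
  simp [fillings]

theorem ncard_fillings_univ (n : ℕ) (w : List Letter) :
    (fillings w (Set.univ : Set (Fin n))).Finite ∧
      ((fillings w (Set.univ : Set (Fin n))).ncard : ℚ) = egfCount (wordEGF w) n := by
  simpa using ncard_fillings_eq w (Finset.univ : Finset (Fin n))

/-- Parts are nonempty, so only the finitely many words of length at most `n` have fillings on `n`
vertices. -/
theorem ncard_structures {W : Set (List Letter)} (hW : LocallyFin W) (n : ℕ) :
    ((structures W (Fin n)).ncard : ℚ) =
      egfCount (subst₂ (wordGF W) (PowerSeries.exp ℚ - 1) tangleDiag) n := by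
  have hU : structures W (Fin n) =
      ⋃ w ∈ (hW.finite_le n).toFinset, fillings w (Set.univ : Set (Fin n)) := by
    ext T
    simp only [Set.mem_iUnion, Set.Finite.mem_toFinset, exists_prop, mem_fillings_univ]
    constructor
    · rintro ⟨h, hw⟩
      refine ⟨_, ⟨hw, ?_⟩, h, rfl⟩
      by_contra! hlt
      obtain ⟨h1, h2⟩ := ncard_fillings_univ n (T.2.2.map Prod.fst)
      rw [egfCount, wordEGF, coeff_pow_mul_pow_eq_zero constantCoeff_exp_sub_one
        constantCoeff_tangleDiag (by rwa [countP_add]), mul_zero, Nat.cast_eq_zero,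
        Set.ncard_eq_zero h1] at h2
      exact (h2 ▸ mem_fillings_univ.2 ⟨h, rfl⟩ : T ∈ (∅ : Set (Filling (Fin n))))
    · rintro ⟨w, ⟨hw, -⟩, h, rfl⟩
      exact ⟨h, hw⟩
  rw [hU, ncard_biUnion_finset fun w _ => (ncard_fillings_univ n w).1, egfCount,
    coeff_subst₂_wordGF hW constantCoeff_exp_sub_one constantCoeff_tangleDiag, Finset.mul_sum]
  · push_cast
    exact Finset.sum_congr rfl fun w _ => (ncard_fillings_univ n w).2
  · intro w _ w' _ hne
    rw [Function.onFun, Set.disjoint_left]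
    intro T h h'
    exact hne ((mem_fillings_univ.1 h).2.symm.trans (mem_fillings_univ.1 h').2)

theorem eq_of_egfCount {F G : PowerSeries ℚ} (h : ∀ n, egfCount F n = egfCount G n) : F = G := by
  ext n
  exact mul_left_cancel₀ (factorial_ne n) (h n)

theorem egfCount_mk (f : ℕ → ℚ) (n : ℕ) :
    egfCount (PowerSeries.mk fun n => f n / (factorial n : ℚ)) n = f n := by
  rw [egfCount, PowerSeries.coeff_mk, mul_div_cancel₀ _ (factorial_ne n)]

/-! ### Labelled posets -/

theorem isLevel_of_mem_structures {V : Type} {T : Filling V} (h : T ∈ structures (wordsBelow 1) V) :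
    @IsLevel V h.1.layered.toPartialOrder T.1 := by
  let := h.1.layered.toPartialOrder
  refine isLevel_of_grounded h.1.layered ((h.1.grounded_iff h.2.1).2 fun x hx => ?_)
  have := h.2.2 x hx
  omega

/-- The order determines the levels, because a nonempty word starts on level $0$, and then the list,
because decompositions with canonical words are unique. -/
theorem numPosets_eq (n : ℕ) : numPosets n = (structures (wordsBelow 1) (Fin n)).ncard := by
  rw [numPosets, ← Nat.card_coe_set_eq]
  have hfree : ∀ T : structures (wordsBelow 1) (Fin n),
      @IsFree (Fin n) T.2.1.layered.toPartialOrder := fun T => by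
    let := T.2.1.layered.toPartialOrder
    exact freeOn_iff.1 T.2.1.freeOn
  refine (Nat.card_eq_of_bijective (fun T : structures (wordsBelow 1) (Fin n) =>
    (⟨T.2.1.layered.toPartialOrder, hfree T⟩ :
      {p : PartialOrder (Fin n) // @IsFree (Fin n) p})) ⟨?_, ?_⟩).symm
  · rintro ⟨⟨ℓ, lt, L⟩, h⟩ ⟨⟨ℓ', lt', L'⟩, h'⟩ heq
    have hp := congrArg Subtype.val heq
    dsimp only at hp
    obtain rfl : lt = lt' := congrArg (fun p : PartialOrder (Fin n) => p.lt) hp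
    obtain rfl : ℓ = ℓ' := by
      have hl := isLevel_of_mem_structures h
      have hl' := isLevel_of_mem_structures h'
      dsimp only at hl hl'
      rw [← hp] at hl'
      let := h.1.layered.toPartialOrder
      exact IsLevel.unique hl hl'
    obtain rfl : L = L' := h.1.unique h'.1 h.2.1 h'.2.1
    rfl
  · rintro ⟨p, hp⟩
    obtain ⟨ℓ, L, -, hL, hw⟩ := exists_canonical_decomp hp
    exact ⟨⟨(ℓ, p.lt, L), hL, hw⟩, Subtype.ext (PartialOrder.ext_lt fun x y => Iff.rfl)⟩

theorem posetEGF_eq : posetEGF =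
    subst₂ (wordGF (wordsBelow 1)) (PowerSeries.exp ℚ - 1) tangleDiag :=
  eq_of_egfCount fun n => by
    rw [← ncard_structures (locallyFin_wordsBelow 1), posetEGF,
      egfCount_mk fun n => (numPosets n : ℚ), numPosets_eq]

/-! ### Bicoloured graphs -/

/-- On two levels any set of pairs from the lower to the upper level is allowed: there are no chains
of three, so freeness is vacuous. The levels need not be the true ones, so isolated vertices may
have either colour. -/
theorem ncard_structures_bicoloured (n : ℕ) : (structures bicolouredWords (Fin n)).ncard =
    ∑ i ∈ Finset.range (n + 1), n.choose i * 2 ^ (i * (n - i)) := by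
  let f : Filling (Fin n) → (_ : Finset (Fin n)) × Finset (Fin n × Fin n) := fun T =>
    ⟨Finset.univ.filter fun v => T.1 v = 0, Finset.univ.filter fun p => T.2.1 p.1 p.2⟩
  have hℓ : ∀ T ∈ structures bicolouredWords (Fin n), ∀ v, T.1 v ≤ 1 := by
    rintro T ⟨h, -, hw⟩ v
    obtain ⟨p, hp, hv⟩ := (h.cover v).1 trivial
    exact ((h.piece p hp).lo_hi.2.2 v hv).2.trans (hw _ (List.mem_map_of_mem hp))
  have hbij : Set.BijOn f (structures bicolouredWords (Fin n))
      ((Finset.univ : Finset (Fin n)).powerset.sigma fun B =>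
        (B ×ˢ (Finset.univ \ B)).powerset : Finset _) := by
    refine ⟨?_, ?_, ?_⟩
    · intro T hT
      simp only [f, Finset.mem_coe, Finset.mem_sigma, Finset.mem_powerset, Finset.subset_univ,
        true_and]
      intro p hp
      have h1 := hT.1.layered.near p.1 trivial p.2 trivial (by simpa using hp)
      have h2 := hℓ T hT p.2
      simp only [Finset.mem_product, Finset.mem_filter, Finset.mem_univ, true_and,
        Finset.mem_sdiff]
      omega
    · rintro ⟨ℓ, lt, L⟩ hT ⟨ℓ', lt', L'⟩ hT' heq
      simp only [f, Sigma.mk.injEq, heq_eq_eq, Finset.ext_iff, Finset.mem_filter, Finset.mem_univ,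
        true_and, Prod.forall] at heq
      obtain ⟨e1, e2⟩ := heq
      have h1 := hℓ _ hT
      have h2 := hℓ _ hT'
      dsimp only at h1 h2
      obtain rfl : ℓ = ℓ' := by
        funext v
        have := e1 v
        have := h1 v
        have := h2 v
        omega
      obtain rfl : lt = lt' := by
        funext a b
        exact propext (e2 a b)
      obtain rfl : L = L' := hT.1.unique hT'.1 hT.2.1 hT'.2.1
      rfl
    · rintro ⟨B, R⟩ hR
      simp only [Finset.mem_coe, Finset.mem_sigma, Finset.mem_powerset, Finset.subset_univ,
        true_and] at hR
      have hR' : ∀ a b, (a, b) ∈ R → a ∈ B ∧ b ∉ B := fun a b hab => by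
        simpa using hR hab
      let ℓ : Fin n → ℕ := fun v => if v ∈ B then 0 else 1
      have hle : ∀ v, ℓ v ≤ 1 := fun v => by
        simp only [ℓ]
        split_ifs <;> simp
      have hlay : Layered ℓ (fun a b => (a, b) ∈ R) Set.univ := by
        refine ⟨fun a _ b _ hab => ?_, fun a _ b _ hab => ?_⟩
        · have := hle b
          omega
        · obtain ⟨ha, hb⟩ := hR' a b hab
          simp [ℓ, ha, hb]
      obtain ⟨L, hL, hc⟩ := exists_isDecomp Set.finite_univ hlay
        fun a _ b _ c _ d _ hab hbc => absurd (hR' b c hbc).1 (hR' a b hab).2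
      refine ⟨(ℓ, fun a b => (a, b) ∈ R, L), ⟨hL, hc, fun x hx => ?_⟩, ?_⟩
      · obtain ⟨p, hp, rfl⟩ := List.mem_map.1 hx
        obtain ⟨v, -, hv⟩ := (hL.piece p hp).lo_hi.2.1
        exact hv ▸ hle v
      · simp only [f, Sigma.mk.injEq, heq_eq_eq]
        constructor <;> ext <;> simp [ℓ]
  rw [← hbij.injOn.ncard_image, hbij.image_eq, Set.ncard_coe_finset, Finset.card_sigma]
  have h1 : ∀ B ∈ (Finset.univ : Finset (Fin n)).powerset,
      (B ×ˢ (Finset.univ \ B)).powerset.card = 2 ^ (B.card * (n - B.card)) := fun B hB => by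
    rw [Finset.card_powerset, Finset.card_product,
      Finset.card_sdiff_of_subset (Finset.mem_powerset.1 hB), Finset.card_univ, Fintype.card_fin]
  rw [Finset.sum_congr rfl h1, Finset.sum_powerset_apply_card fun k => 2 ^ (k * (n - k))]
  simp

theorem bicolouredEGF_eq : bicolouredEGF =
    subst₂ (wordGF bicolouredWords) (PowerSeries.exp ℚ - 1) tangleDiag :=
  eq_of_egfCount fun n => by
    rw [← ncard_structures locallyFin_bicolouredWords, bicolouredEGF,
      egfCount_mk fun n => ∑ i ∈ Finset.range (n + 1), (n.choose i : ℚ) * 2 ^ (i * (n - i)),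
      ncard_structures_bicoloured]
    push_cast
    rfl

/-- Substituting $c=e^x-1$ and $t=T$ into the equation for two-level words turns $(1+c)^{-1}$ into
$e^{-x}$ and leaves an equation linear in $T$. -/
theorem tangleDiag_eq_tangleSeries : tangleDiag = tangleSeries := by
  have hs := hasSubst₂ constantCoeff_exp_sub_one constantCoeff_tangleDiag
  let φ := MvPowerSeries.substAlgHom (R := ℚ) hs
  have hφ : ∀ F, φ F = subst₂ F (PowerSeries.exp ℚ - 1) tangleDiag := fun F =>
    congrFun (MvPowerSeries.coe_substAlgHom hs) F
  have hX0 : φ (MvPowerSeries.X 0) = PowerSeries.exp ℚ - 1 := by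
    rw [hφ]
    exact MvPowerSeries.subst_X hs 0
  have hX1 : φ (MvPowerSeries.X 1) = tangleDiag := by
    rw [hφ]
    exact MvPowerSeries.subst_X hs 1
  have hinv : φ ((1 + MvPowerSeries.X 0)⁻¹) = PowerSeries.evalNegHom (PowerSeries.exp ℚ) := by
    have h1 : PowerSeries.exp ℚ * φ ((1 + MvPowerSeries.X 0)⁻¹) = 1 := by
      have := congrArg φ (MvPowerSeries.mul_inv_cancel _ (constantCoeff_one_add_X 0))
      rw [map_mul, map_add, map_one, hX0] at this
      rw [← this]
      congr 1
      exact (add_sub_cancel _ _).symm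
    calc φ ((1 + MvPowerSeries.X 0)⁻¹)
        = (PowerSeries.exp ℚ * PowerSeries.evalNegHom (PowerSeries.exp ℚ)) *
            φ ((1 + MvPowerSeries.X 0)⁻¹) := by
          rw [PowerSeries.exp_mul_exp_neg_eq_one]
          exact (one_mul _).symm
      _ = PowerSeries.evalNegHom (PowerSeries.exp ℚ) *
            (PowerSeries.exp ℚ * φ ((1 + MvPowerSeries.X 0)⁻¹)) := by ring
      _ = _ := by rw [h1, mul_one]
  have hB : (2 * PowerSeries.evalNegHom (PowerSeries.exp ℚ) - 1 - tangleDiag) * bicolouredEGF =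
      1 := by
    have := congrArg φ wordGF_bicoloured
    rw [map_mul, map_sub, map_sub, map_mul, map_one, hinv, hX1, hφ (wordGF _),
      ← bicolouredEGF_eq, map_ofNat] at this
    exact this
  have hB0 : PowerSeries.constantCoeff bicolouredEGF ≠ 0 := by
    intro h
    have := congrArg PowerSeries.constantCoeff hB
    rw [map_mul, h, mul_zero, map_one] at this
    exact zero_ne_one this
  rw [tangleSeries, (PowerSeries.eq_inv_iff_mul_eq_one hB0).2 hB |>.symm]
  ring

end Structures

/-! ### Skeleta -/

/-- The series that counts the fillings of `w` is a product of nonzero series, so some coefficient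
is nonzero; no poset has to be built by hand. -/
theorem exists_structure (w : List Letter) :
    ∃ n, (fillings w (Set.univ : Set (Fin n))).Nonempty := by
  by_contra! hno
  refine wordEGF_ne_zero w (eq_of_egfCount fun n => ?_)
  rw [← (ncard_fillings_univ n w).2, hno n]
  simp [egfCount]

/-- The canonical word of a poset is empty or starts on level $0$ because its levels are grounded.
Conversely a filling of such a word is a poset whose levels are the prescribed ones. -/
theorem skeleta_eq (d : Fin 2 →₀ ℕ) : skeleta (d 0) (d 1) = trace '' graded (wordsBelow 1) d := by
  ext m
  constructor
  · rintro ⟨P, _, w, _, hf, hw, h0, h1, rfl⟩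
    obtain ⟨ℓ, L, hℓ, hL, hc⟩ := exists_canonical_decomp hf
    obtain ⟨htr, hperm⟩ := hL.exists_of_isWordOf hc.1 hℓ hw
    exact ⟨_, ⟨hc, by rw [← hperm.countP_eq, h0], by rw [← hperm.countP_eq, h1]⟩, htr.symm⟩
  · rintro ⟨w, ⟨hw, h0, h1⟩, rfl⟩
    obtain ⟨n, T, hT⟩ := exists_structure w
    obtain ⟨hT', rfl⟩ := mem_fillings_univ.1 hT
    clear hT
    rename' hT' => hT
    have hlev := isLevel_of_mem_structures (T := T) ⟨hT, hw⟩
    let p := hT.layered.toPartialOrder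
    have hdec : IsDecomp T.1 p.lt Set.univ T.2.2 := hT
    exact ⟨Fin n, p, _, inferInstance, freeOn_iff.1 hdec.freeOn, hdec.isWordOf hw.1 hlev, h0, h1,
      rfl⟩

theorem skeletonGF_eq : skeletonGF = wordGF (wordsBelow 1) := by
  ext d
  rw [coeff_wordGF]
  change ((skeleta (d 0) (d 1)).ncard : ℚ) = _
  have hinj : Set.InjOn trace (graded (wordsBelow 1) d) := fun w hw w' hw' h =>
    Canonical.eq_of_trace_eq hw.1.1 hw'.1.1 h
  rw [skeleta_eq, hinj.ncard_image]

end ThreePlusOne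
end


theorem mainTheorem2 :
    -- `S(c,t)`, the generating function of skeleta, is the unique solution of the cubic equation
    (ThreePlusOne.SatisfiesCubic ThreePlusOne.skeletonGF ∧
      ∀ S, ThreePlusOne.SatisfiesCubic S → S = ThreePlusOne.skeletonGF) ∧
    -- all series that are substituted have no constant term
    PowerSeries.constantCoeff (PowerSeries.exp ℚ - 1) = 0 ∧
    PowerSeries.constantCoeff ThreePlusOne.tangleDiag = 0 ∧
    PowerSeries.constantCoeff ThreePlusOne.tangleSeries = 0 ∧
    ThreePlusOne.posetEGF =
      ThreePlusOne.subst₂ ThreePlusOne.skeletonGF (PowerSeries.exp ℚ - 1)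
        ThreePlusOne.tangleDiag ∧
    ThreePlusOne.posetEGF =
      ThreePlusOne.subst₂ ThreePlusOne.skeletonGF (PowerSeries.exp ℚ - 1)
        ThreePlusOne.tangleSeries := by
  have hS := ThreePlusOne.skeletonGF_eq
  have hT := ThreePlusOne.tangleDiag_eq_tangleSeries
  have hP := ThreePlusOne.posetEGF_eq
  rw [← hS] at hP
  have hcubic : ThreePlusOne.SatisfiesCubic ThreePlusOne.skeletonGF :=
    hS ▸ ThreePlusOne.satisfiesCubic_wordGF
  exact ⟨⟨hcubic, fun S h => h.unique hcubic⟩, ThreePlusOne.constantCoeff_exp_sub_one,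
    ThreePlusOne.constantCoeff_tangleDiag, hT ▸ ThreePlusOne.constantCoeff_tangleDiag, hP, hT ▸ hP⟩
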